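/- Let $\mathbb{T}=\mathbb{R}/2\pi\mathbb{Z}$, and let $X=L^2_0(\mathbb{T}^2)$ be the space of all complex-valued $\omega\in L^2(\mathbb{T}^2)$ with $\int_0^{2\pi}\omega(x,y)\,dx=0$ for a.e. $y\in\mathbb{T}$. Let $A=\Delta$ in $X$ with domain $D(A)=W^{2,2}(\mathbb{T}^2)\cap X$, and let $$\hat\Lambda\,\omega=-i\,\partial_x\big(\sin y\,(\omega+A^{-1}\omega)\big),\qquad D(\hat\Lambda)=\{\omega\in X:\ \partial_x(\sin y\,\omega)\in X\}.$$ For $\alpha\in\mathbb{R}$ put $L_\alpha=A-i\alpha\hat\Lambda$ with $D(L_\alpha)=D(A)$. For $l\in\mathbb{Z}$ let $(\mathcal{P}_l\omega)(x,y)=\frac1{2\pi}\int_0^{2\pi}\omega(s,y)e^{-ils}\,ds\;e^{ilx}$, let $$Y=\Big\{\omega\in X:\ \int_0^{2\pi}(\mathcal{P}_l\omega)(x,y)\,dy=0\ \text{ for } |l|=1 \text{ and all } x\in\mathbb{T}\Big\},$$ and let $\mathbb{Q}$ be the orthogonal projection of $X$ onto $Y$. The operator $\mathbb{Q}L_\alpha$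 is considered in $Y$ with domain $D(A)\cap Y$. For $l\in\mathbb{Z}\setminus\{0\}$ let, in $L^2(\mathbb{T})$, $A_l=\partial_y^2-l^2$ with $D(A_l)=W^{2,2}(\mathbb{T})$, $\hat\Lambda_l f=\sin y\,(f+A_l^{-1}f)$ with $D(\hat\Lambda_l)=L^2(\mathbb{T})$, and $L_{\alpha,l}=A_l-i\alpha l\hat\Lambda_l$ with $D(L_{\alpha,l})=W^{2,2}(\mathbb{T})$. Let $Y_l=L^2(\mathbb{T})$ if $l\neq\pm1$ and $Y_l=\{f\in L^2(\mathbb{T}):\int_0^{2\pi}f\,dy=0\}$ if $l=\pm1$, and let $\mathbb{Q}_l$ be the orthogonal projection of $L^2(\mathbb{T})$ onto $Y_l$. The operator $\mathbb{Q}_lL_{\alpha,l}$ is considered in $Y_l$ with domain $W^{2,2}(\mathbb{T})\cap Y_l$. **Theorem.** For all sufficiently large $|\alpha|$ the imaginary axis is contained in the resolvent set of $\mathbb{Q}L_\alpha$ in $Y$ and in the resolvent set of $L_\alpha$ in $X$, and $$\lim_{|\alpha|\to\infty}\ \sup_{\lambda\in\mathbb{R}}\big\|(i\lambda-\mathbb{Q}L_\alpha)^{-1}\big\|_{Y\to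 Y}=\lim_{|\alpha|\to\infty}\ \sup_{\lambda\in\mathbb{R}}\big\|\mathbb{Q}(i\lambda-L_\alpha)^{-1}\big\|_{X\to X}=0.$$ Likewise, for each $l\in\mathbb{Z}\setminus\{0\}$ and all $|\alpha|$ sufficiently large (depending on $l$), the imaginary axis is contained in the resolvent set of $\mathbb{Q}_lL_{\alpha,l}$ in $Y_l$ and in the resolvent set of $L_{\alpha,l}$ in $L^2(\mathbb{T})$, and $$\lim_{|\alpha|\to\infty}\ \sup_{\lambda\in\mathbb{R}}\big\|(i\lambda-\mathbb{Q}_lL_{\alpha,l})^{-1}\big\|_{Y_l\to Y_l}=\lim_{|\alpha|\to\infty}\ \sup_{\lambda\in\mathbb{R}}\big\|\mathbb{Q}_l(i\lambda-L_{\alpha,l})^{-1}\big\|_{L^2(\mathbb{T})\to L^2(\mathbb{T})}=0.$$ -/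

import Mathlib

open MeasureTheory Filter Topology

noncomputable section

namespace Kolmogorov

/-! ### Unbounded operators: resolvent set, resolvent, compression -/

/-- `R` is a bounded two-sided inverse of `z - T : D(T) → E`. -/
structure IsResolvent {E : Type*} [NormedAddCommGroup E] [NormedSpace ℂ E]
    (T : E →ₗ.[ℂ] E) (z : ℂ) (R : E →L[ℂ] E) : Prop where
  right_inv : ∀ f : E, ∃ h : R f ∈ T.domain, z • R f - T ⟨R f, h⟩ = f
  left_inv : ∀ u : T.domain, R (z • (u : E) - T u) = u

/-- The resolvent set of an unbounded operator. -/
def opResolventSet {E : Type*} [NormedAddCommGroup E] [NormedSpace ℂ E]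
    (T : E →ₗ.[ℂ] E) : Set ℂ :=
  {z | ∃ R : E →L[ℂ] E, IsResolvent T z R}

open Classical in
/-- The resolvent `(z - T)⁻¹` for `z` in the resolvent set (and `0` elsewhere). -/
def opResolvent {E : Type*} [NormedAddCommGroup E] [NormedSpace ℂ E]
    (T : E →ₗ.[ℂ] E) (z : ℂ) : E →L[ℂ] E :=
  if h : ∃ R : E →L[ℂ] E, IsResolvent T z R then h.choose else 0

/-- The operator `Q T` in the subspace `Y`, with domain `D(T) ∩ Y`, where `Q` is the orthogonal
projection onto `Y`. -/
def compression {H : Type*} [NormedAddCommGroup H] [InnerProductSpace ℂ H]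
    (Y : Submodule ℂ H) [Y.HasOrthogonalProjection] (T : H →ₗ.[ℂ] H) : Y →ₗ.[ℂ] Y where
  domain := T.domain.comap Y.subtype
  toFun :=
    { toFun := fun u => Y.orthogonalProjectionOnto (T ⟨(u : Y), u.2⟩)
      map_add' := fun u v => by
        rw [← map_add, ← LinearPMap.map_add]; rfl
      map_smul' := fun c u => by
        rw [RingHom.id_apply, ← map_smul, ← LinearPMap.map_smul]; rfl }

/-! ### The tori and the `L²` spaces -/

instance instFactTwoPiPos : Fact (0 < 2 * Real.pi) := ⟨Real.two_pi_pos⟩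

/-- The circle `ℝ / 2πℤ`, with Lebesgue measure of total mass `2π`. -/
abbrev Circ : Type := AddCircle (2 * Real.pi)

/-- The torus `(ℝ / 2πℤ)²`; points are `(x, y)`. -/
abbrev Torus : Type := Circ × Circ

abbrev L2Circ : Type := Lp ℂ 2 (volume : Measure Circ)

abbrev L2Torus : Type := Lp ℂ 2 (volume : Measure Torus)

/-- The sine function on the circle. -/
def sinC : Circ → ℝ := Real.sin_periodic.lift

/-! ### Weak derivatives -/

open scoped ContDiff in
/-- Smooth test functions on the circle. -/
def TestCirc (φ : C(Circ, ℂ)) : Prop :=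
  ContDiff ℝ ∞ (fun y : ℝ => φ (y : Circ))

open scoped ContDiff in
/-- Smooth test functions on the torus. -/
def TestTorus (φ : C(Torus, ℂ)) : Prop :=
  ContDiff ℝ ∞ (fun p : ℝ × ℝ => φ ((p.1 : Circ), (p.2 : Circ)))

/-- Classical derivative on the circle. -/
def dCirc (φ : Circ → ℂ) (y : Circ) : ℂ := deriv (fun t : ℝ => φ (y + (t : Circ))) 0

/-- Classical partial derivative in `x`. -/
def dX (φ : Torus → ℂ) (p : Torus) : ℂ := deriv (fun t : ℝ => φ (p.1 + (t : Circ), p.2)) 0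

/-- Classical partial derivative in `y`. -/
def dY (φ : Torus → ℂ) (p : Torus) : ℂ := deriv (fun t : ℝ => φ (p.1, p.2 + (t : Circ))) 0

/-- `g` is the weak derivative of `f` on the circle. -/
def HasWeakD (f g : Circ → ℂ) : Prop :=
  ∀ φ : C(Circ, ℂ), TestCirc φ → ∫ y, f y * dCirc φ y = -∫ y, g y * φ y

/-- `g` is the weak derivative `∂ₓ f` on the torus. -/
def HasWeakDX (f g : Torus → ℂ) : Prop :=
  ∀ φ : C(Torus, ℂ), TestTorus φ → ∫ p, f p * dX φ p = -∫ p, g p * φ p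

/-- `g` is the weak derivative `∂_y f` on the torus. -/
def HasWeakDY (f g : Torus → ℂ) : Prop :=
  ∀ φ : C(Torus, ℂ), TestTorus φ → ∫ p, f p * dY φ p = -∫ p, g p * φ p

theorem continuous_sinC : Continuous sinC :=
  Real.continuous_sin.quotient_lift _

theorem continuous_dCirc {φ : C(Circ, ℂ)} (hφ : TestCirc φ) : Continuous (dCirc φ) := by
  have hq : IsOpenQuotientMap (fun y : ℝ => (y : Circ)) := QuotientAddGroup.isOpenQuotientMap_mk
  rw [hq.isQuotientMap.continuous_iff]
  have h : (dCirc φ) ∘ (fun y : ℝ => (y : Circ)) = deriv (fun y : ℝ => φ (y : Circ)) := by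
    funext y
    have := deriv_comp_const_add (f := fun y : ℝ => φ (y : Circ)) y 0
    simpa [dCirc] using this
  rw [h]
  exact hφ.continuous_deriv (by simp)

theorem isOpenQuotientMap_torus :
    IsOpenQuotientMap (fun p : ℝ × ℝ => (((p.1 : Circ), (p.2 : Circ)) : Torus)) :=
  IsOpenQuotientMap.prodMap QuotientAddGroup.isOpenQuotientMap_mk
    QuotientAddGroup.isOpenQuotientMap_mk

theorem continuous_dX {φ : C(Torus, ℂ)} (hφ : TestTorus φ) : Continuous (dX φ) := by
  rw [isOpenQuotientMap_torus.isQuotientMap.continuous_iff]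
  have h : (dX φ) ∘ (fun p : ℝ × ℝ => (((p.1 : Circ), (p.2 : Circ)) : Torus)) =
      fun p => fderiv ℝ (fun p : ℝ × ℝ => φ ((p.1 : Circ), (p.2 : Circ))) p (1, 0) := by
    funext p
    have h1 := ((hφ.differentiable (by simp)) p).lineDeriv_eq_fderiv (v := ((1, 0) : ℝ × ℝ))
    rw [← h1]
    simp [dX, lineDeriv]
  rw [h]
  exact (hφ.continuous_fderiv (by simp)).clm_apply continuous_const

theorem continuous_dY {φ : C(Torus, ℂ)} (hφ : TestTorus φ) : Continuous (dY φ) := by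
  rw [isOpenQuotientMap_torus.isQuotientMap.continuous_iff]
  have h : (dY φ) ∘ (fun p : ℝ × ℝ => (((p.1 : Circ), (p.2 : Circ)) : Torus)) =
      fun p => fderiv ℝ (fun p : ℝ × ℝ => φ ((p.1 : Circ), (p.2 : Circ))) p (0, 1) := by
    funext p
    have h1 := ((hφ.differentiable (by simp)) p).lineDeriv_eq_fderiv (v := ((0, 1) : ℝ × ℝ))
    rw [← h1]
    simp [dY, lineDeriv]
  rw [h]
  exact (hφ.continuous_fderiv (by simp)).clm_apply continuous_const

theorem integrable_mul_continuous {S : Type*} [TopologicalSpace S] [CompactSpace S]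
    [MeasurableSpace S] [BorelSpace S] {μ : Measure S}
    {f c : S → ℂ} (hf : Integrable f μ) (hc : Continuous c) :
    Integrable (fun s => f s * c s) μ := by
  obtain ⟨C, hC⟩ := isCompact_univ.exists_bound_of_continuousOn hc.continuousOn
  exact hf.mul_bdd (c := C) hc.aestronglyMeasurable (ae_of_all _ fun s => hC s (Set.mem_univ s))

theorem integrable_L2 {S : Type*} [MeasurableSpace S] {μ : Measure S} [IsFiniteMeasure μ]
    (f : Lp ℂ 2 μ) : Integrable f μ :=
  (Lp.memLp f).integrable one_le_two

theorem weak_add {S : Type*} [TopologicalSpace S] [CompactSpace S]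
    [MeasurableSpace S] [BorelSpace S] {μ : Measure S} {f f₁ f₂ g g₁ g₂ d c : S → ℂ}
    (hf : f =ᵐ[μ] fun s => f₁ s + f₂ s) (hg : g =ᵐ[μ] fun s => g₁ s + g₂ s)
    (hf₁ : Integrable f₁ μ) (hf₂ : Integrable f₂ μ) (hg₁ : Integrable g₁ μ)
    (hg₂ : Integrable g₂ μ) (hd : Continuous d) (hc : Continuous c)
    (h₁ : ∫ s, f₁ s * d s ∂μ = -∫ s, g₁ s * c s ∂μ)
    (h₂ : ∫ s, f₂ s * d s ∂μ = -∫ s, g₂ s * c s ∂μ) :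
    ∫ s, f s * d s ∂μ = -∫ s, g s * c s ∂μ := by
  have e₁ : ∫ s, f s * d s ∂μ = ∫ s, (f₁ s * d s + f₂ s * d s) ∂μ :=
    integral_congr_ae (hf.mono fun s hs => by simp only [hs, add_mul])
  have e₂ : ∫ s, g s * c s ∂μ = ∫ s, (g₁ s * c s + g₂ s * c s) ∂μ :=
    integral_congr_ae (hg.mono fun s hs => by simp only [hs, add_mul])
  rw [e₁, e₂, integral_add (integrable_mul_continuous hf₁ hd) (integrable_mul_continuous hf₂ hd),
    integral_add (integrable_mul_continuous hg₁ hc) (integrable_mul_continuous hg₂ hc), h₁, h₂]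
  ring

theorem weak_smul {S : Type*} [MeasurableSpace S] {μ : Measure S} {f f₁ g g₁ d c : S → ℂ}
    (a : ℂ) (hf : f =ᵐ[μ] fun s => a * f₁ s) (hg : g =ᵐ[μ] fun s => a * g₁ s)
    (h₁ : ∫ s, f₁ s * d s ∂μ = -∫ s, g₁ s * c s ∂μ) :
    ∫ s, f s * d s ∂μ = -∫ s, g s * c s ∂μ := by
  have e₁ : ∫ s, f s * d s ∂μ = ∫ s, a * (f₁ s * d s) ∂μ :=
    integral_congr_ae (hf.mono fun s hs => by simp only [hs, mul_assoc])
  have e₂ : ∫ s, g s * c s ∂μ = ∫ s, a * (g₁ s * c s) ∂μ :=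
    integral_congr_ae (hg.mono fun s hs => by simp only [hs, mul_assoc])
  rw [e₁, e₂, integral_const_mul, integral_const_mul, h₁]
  ring

theorem coeFn_add_ae {S : Type*} [MeasurableSpace S] {μ : Measure S} (f g : Lp ℂ 2 μ) :
    (f + g : Lp ℂ 2 μ) =ᵐ[μ] fun s => f s + g s :=
  Lp.coeFn_add f g

theorem coeFn_smul_ae {S : Type*} [MeasurableSpace S] {μ : Measure S} (a : ℂ) (f : Lp ℂ 2 μ) :
    (a • f : Lp ℂ 2 μ) =ᵐ[μ] fun s => a * f s :=
  Lp.coeFn_smul a f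

theorem coeFn_zero_ae {S : Type*} [MeasurableSpace S] {μ : Measure S} :
    (0 : Lp ℂ 2 μ) =ᵐ[μ] fun s => (0 : ℂ) * (0 : S → ℂ) s := by
  filter_upwards [Lp.coeFn_zero ℂ 2 μ] with s hs
  simpa using hs

theorem HasWeakD.add {f₁ f₂ g₁ g₂ : L2Circ} (h₁ : HasWeakD f₁ g₁) (h₂ : HasWeakD f₂ g₂) :
    HasWeakD (f₁ + f₂ : L2Circ) (g₁ + g₂ : L2Circ) := fun φ hφ =>
  weak_add (coeFn_add_ae _ _) (coeFn_add_ae _ _) (integrable_L2 _) (integrable_L2 _)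
    (integrable_L2 _) (integrable_L2 _) (continuous_dCirc hφ) φ.continuous (h₁ φ hφ) (h₂ φ hφ)

theorem HasWeakD.smul {f g : L2Circ} (a : ℂ) (h : HasWeakD f g) :
    HasWeakD (a • f : L2Circ) (a • g : L2Circ) := fun φ hφ =>
  weak_smul a (coeFn_smul_ae _ _) (coeFn_smul_ae _ _) (h φ hφ)

theorem HasWeakD.zero : HasWeakD (0 : L2Circ) (0 : L2Circ) := fun φ _ =>
  weak_smul (f₁ := 0) (g₁ := 0) 0 coeFn_zero_ae coeFn_zero_ae (by simp)

theorem HasWeakDX.add {f₁ f₂ g₁ g₂ : L2Torus} (h₁ : HasWeakDX f₁ g₁) (h₂ : HasWeakDX f₂ g₂) :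
    HasWeakDX (f₁ + f₂ : L2Torus) (g₁ + g₂ : L2Torus) := fun φ hφ =>
  weak_add (coeFn_add_ae _ _) (coeFn_add_ae _ _) (integrable_L2 _) (integrable_L2 _)
    (integrable_L2 _) (integrable_L2 _) (continuous_dX hφ) φ.continuous (h₁ φ hφ) (h₂ φ hφ)

theorem HasWeakDX.smul {f g : L2Torus} (a : ℂ) (h : HasWeakDX f g) :
    HasWeakDX (a • f : L2Torus) (a • g : L2Torus) := fun φ hφ =>
  weak_smul a (coeFn_smul_ae _ _) (coeFn_smul_ae _ _) (h φ hφ)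

theorem HasWeakDX.zero : HasWeakDX (0 : L2Torus) (0 : L2Torus) := fun φ _ =>
  weak_smul (f₁ := 0) (g₁ := 0) 0 coeFn_zero_ae coeFn_zero_ae (by simp)

theorem HasWeakDY.add {f₁ f₂ g₁ g₂ : L2Torus} (h₁ : HasWeakDY f₁ g₁) (h₂ : HasWeakDY f₂ g₂) :
    HasWeakDY (f₁ + f₂ : L2Torus) (g₁ + g₂ : L2Torus) := fun φ hφ =>
  weak_add (coeFn_add_ae _ _) (coeFn_add_ae _ _) (integrable_L2 _) (integrable_L2 _)
    (integrable_L2 _) (integrable_L2 _) (continuous_dY hφ) φ.continuous (h₁ φ hφ) (h₂ φ hφ)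

theorem HasWeakDY.smul {f g : L2Torus} (a : ℂ) (h : HasWeakDY f g) :
    HasWeakDY (a • f : L2Torus) (a • g : L2Torus) := fun φ hφ =>
  weak_smul a (coeFn_smul_ae _ _) (coeFn_smul_ae _ _) (h φ hφ)

theorem HasWeakDY.zero : HasWeakDY (0 : L2Torus) (0 : L2Torus) := fun φ _ =>
  weak_smul (f₁ := 0) (g₁ := 0) 0 coeFn_zero_ae coeFn_zero_ae (by simp)

/-! ### The operators on the torus -/

theorem ae_slice {f g : Torus → ℂ} (h : f =ᵐ[volume] g) :
    ∀ᵐ y : Circ, (fun x : Circ => f (x, y)) =ᵐ[volume] fun x => g (x, y) :=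
  Measure.ae_ae_of_ae_prod (p := fun q : Circ × Circ => f q.swap = g q.swap)
    (Measure.measurePreserving_swap.quasiMeasurePreserving.ae h)

/-- `X = L²₀(𝕋²)`: the functions with zero mean in `x` for a.e. `y`. -/
def L2Zero : Submodule ℂ L2Torus where
  carrier := {ω | ∀ᵐ y : Circ, ∫ x : Circ, ω (x, y) = 0}
  zero_mem' := by
    have h := ae_slice (Lp.coeFn_zero ℂ 2 (volume : Measure Torus))
    filter_upwards [h] with y hy
    rw [integral_congr_ae hy]
    simp
  add_mem' := by
    intro f g hf hg
    have h := ae_slice (coeFn_add_ae f g)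
    filter_upwards [h, hf, hg, (integrable_L2 f).prod_left_ae, (integrable_L2 g).prod_left_ae]
      with y hy hfy hgy if_ ig
    rw [integral_congr_ae hy]
    rw [integral_add if_ ig, hfy, hgy, add_zero]
  smul_mem' := by
    intro c f hf
    have h := ae_slice (coeFn_smul_ae c f)
    change ∀ᵐ y : Circ, ∫ x : Circ, (c • f : L2Torus) (x, y) = 0
    change ∀ᵐ y : Circ, ∫ x : Circ, f (x, y) = 0 at hf
    filter_upwards [h, hf] with y hy hfy
    rw [integral_congr_ae hy]
    rw [integral_const_mul, hfy, mul_zero]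

theorem isClosed_L2Zero : IsClosed (L2Zero : Set L2Torus) := by
  have h : (L2Zero : Set L2Torus) = ⋂ (s : Set Circ) (_ : MeasurableSet s),
      {f : L2Torus | ∫ p in Set.univ ×ˢ s, f p = 0} := by
    ext f
    have hfub : ∀ s : Set Circ, ∫ p in Set.univ ×ˢ s, f p = ∫ y in s, ∫ x : Circ, f (x, y) := by
      intro s
      have h1 : (volume : Measure Torus).restrict (Set.univ ×ˢ s) =
          (volume : Measure Circ).prod ((volume : Measure Circ).restrict s) := by
        rw [Measure.volume_eq_prod, ← Measure.prod_restrict, Measure.restrict_univ]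
      rw [h1]
      refine integral_prod_symm _ ?_
      rw [← h1]
      exact (integrable_L2 f).integrableOn
    simp only [Set.mem_iInter, Set.mem_ofPred_eq, hfub]
    constructor
    · intro hf s _
      rw [integral_congr_ae (ae_restrict_of_ae hf)]
      simp
    · intro hf
      exact (integrable_L2 f).integral_prod_right.ae_eq_zero_of_forall_setIntegral_eq_zero
        fun s hs _ => hf s hs
  rw [h]
  refine isClosed_iInter fun s => isClosed_iInter fun hs => ?_
  have hm : MeasurableSet ((Set.univ : Set Circ) ×ˢ s) := MeasurableSet.univ.prod hs
  have : {f : L2Torus | ∫ p in Set.univ ×ˢ s, f p = 0} =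
      {f : L2Torus | inner ℂ (indicatorConstLp 2 hm (measure_ne_top volume _) (1 : ℂ)) f = 0} := by
    ext f
    rw [Set.mem_ofPred_eq, Set.mem_ofPred_eq, L2.inner_indicatorConstLp_one]
  rw [this]
  exact isClosed_eq (continuous_const.inner continuous_id) continuous_const

/-- `L²₀(𝕋²)` as a Hilbert space, with the inner product of `L²(𝕋²)`. -/
def SpaceX : Type := L2Zero

instance : NormedAddCommGroup SpaceX := inferInstanceAs (NormedAddCommGroup L2Zero)

instance : InnerProductSpace ℂ SpaceX := inferInstanceAs (InnerProductSpace ℂ L2Zero)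

instance : CompleteSpace SpaceX := isClosed_L2Zero.completeSpace_coe

/-- The inclusion of `L²₀(𝕋²)` into `L²(𝕋²)`. -/
def SpaceX.incl : SpaceX →ₗᵢ[ℂ] L2Torus := L2Zero.subtypeₗᵢ

instance : CoeOut SpaceX L2Torus := ⟨fun f => SpaceX.incl f⟩

/-- The graph of `A`, the realization of `Δ` in `L²₀(𝕋²)` with domain `W^{2,2}(𝕋²) ∩ L²₀(𝕋²)`. -/
def graphA : Submodule ℂ (SpaceX × SpaceX) where
  carrier := {p | ∃ fx fy fxx fxy fyy : L2Torus,
    HasWeakDX (p.1 : L2Torus) fx ∧ HasWeakDY (p.1 : L2Torus) fy ∧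
    HasWeakDX fx fxx ∧ HasWeakDY fx fxy ∧ HasWeakDY fy fyy ∧ (p.2 : L2Torus) = fxx + fyy}
  zero_mem' := ⟨0, 0, 0, 0, 0, .zero, .zero, .zero, .zero, .zero, by simp⟩
  add_mem' := by
    rintro p q ⟨a, b, c, d, e, h1, h2, h3, h4, h5, h6⟩ ⟨a', b', c', d', e', k1, k2, k3, k4, k5, k6⟩
    refine ⟨a + a', b + b', c + c', d + d', e + e', h1.add k1, h2.add k2, h3.add k3, h4.add k4,
      h5.add k5, ?_⟩
    rw [Prod.snd_add, map_add, h6, k6]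
    abel
  smul_mem' := by
    rintro r p ⟨a, b, c, d, e, h1, h2, h3, h4, h5, h6⟩
    refine ⟨r • a, r • b, r • c, r • d, r • e, h1.smul r, h2.smul r, h3.smul r, h4.smul r,
      h5.smul r, ?_⟩
    rw [Prod.smul_snd, map_smul, h6, smul_add]

/-- `A = Δ` in `L²₀(𝕋²)`. -/
def opA : SpaceX →ₗ.[ℂ] SpaceX := graphA.toLinearPMap

/-- `sin y · f`. -/
def sinMul (f : Torus → ℂ) (p : Torus) : ℂ := (sinC p.2 : ℂ) * f p

theorem integrable_sinMul (f : L2Torus) : Integrable (sinMul f) := by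
  have h : Continuous fun p : Torus => (sinC p.2 : ℂ) :=
    Complex.continuous_ofReal.comp (continuous_sinC.comp continuous_snd)
  refine (integrable_mul_continuous (integrable_L2 f) h).congr (ae_of_all _ fun p => ?_)
  simp only [sinMul, mul_comm]

theorem HasWeakDX.sin_add {f₁ f₂ g₁ g₂ : L2Torus} (h₁ : HasWeakDX (sinMul f₁) g₁)
    (h₂ : HasWeakDX (sinMul f₂) g₂) :
    HasWeakDX (sinMul (f₁ + f₂ : L2Torus)) (g₁ + g₂ : L2Torus) := fun φ hφ =>
  weak_add ((coeFn_add_ae f₁ f₂).mono fun p hp => by simp only [sinMul, hp, mul_add])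
    (coeFn_add_ae _ _) (integrable_sinMul f₁) (integrable_sinMul f₂)
    (integrable_L2 _) (integrable_L2 _) (continuous_dX hφ) φ.continuous (h₁ φ hφ) (h₂ φ hφ)

theorem HasWeakDX.sin_smul {f g : L2Torus} (a : ℂ) (h : HasWeakDX (sinMul f) g) :
    HasWeakDX (sinMul (a • f : L2Torus)) (a • g : L2Torus) := fun φ hφ =>
  weak_smul a ((coeFn_smul_ae a f).mono fun p hp => by simp only [sinMul, hp, mul_left_comm])
    (coeFn_smul_ae _ _) (h φ hφ)

theorem HasWeakDX.sin_zero : HasWeakDX (sinMul (0 : L2Torus)) (0 : L2Torus) := fun φ _ =>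
  weak_smul (f₁ := 0) (g₁ := 0) 0
    (coeFn_zero_ae.mono fun p hp => by simp only [sinMul, hp, zero_mul, mul_zero])
    coeFn_zero_ae (by simp)

/-- The graph of `Λ̂ ω = -i ∂ₓ (sin y (ω + A⁻¹ ω))` in `L²₀(𝕋²)`, where `ψ = A⁻¹ ω`; the domain
consists of the `ω` with `∂ₓ (sin y ω) ∈ L²₀(𝕋²)`. -/
def graphΛ : Submodule ℂ (SpaceX × SpaceX) where
  carrier := {p | (∃ k : SpaceX, HasWeakDX (sinMul (p.1 : L2Torus)) (k : L2Torus)) ∧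
    ∃ ψ g : SpaceX, (ψ, p.1) ∈ opA.graph ∧
      HasWeakDX (sinMul (p.1 + ψ : SpaceX)) (g : L2Torus) ∧ p.2 = (-Complex.I) • g}
  zero_mem' := by
    refine ⟨⟨0, .sin_zero⟩, 0, 0, opA.graph.zero_mem, ?_, by simp⟩
    have h : ((0 : SpaceX × SpaceX).1 + 0 : SpaceX) = 0 := by simp
    rw [h]
    exact .sin_zero
  add_mem' := by
    rintro p q ⟨⟨k, hk⟩, ψ, g, h1, h2, h3⟩ ⟨⟨k', hk'⟩, ψ', g', h1', h2', h3'⟩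
    refine ⟨⟨k + k', hk.sin_add hk'⟩, ψ + ψ', g + g', opA.graph.add_mem h1 h1', ?_, ?_⟩
    · have h : ((p + q).1 + (ψ + ψ') : SpaceX) = (p.1 + ψ) + (q.1 + ψ') := by
        rw [Prod.fst_add]; abel
      rw [h]
      exact h2.sin_add h2'
    · rw [Prod.snd_add, h3, h3', smul_add]
  smul_mem' := by
    rintro a p ⟨⟨k, hk⟩, ψ, g, h1, h2, h3⟩
    refine ⟨⟨a • k, hk.sin_smul a⟩, a • ψ, a • g, opA.graph.smul_mem a h1, ?_, ?_⟩
    · have h : ((a • p).1 + a • ψ : SpaceX) = a • (p.1 + ψ) := by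
        rw [Prod.smul_fst, smul_add]
      rw [h]
      exact h2.sin_smul a
    · rw [Prod.smul_snd, h3, smul_comm]

/-- `Λ̂ = -i ∂ₓ sin y (I + A⁻¹)` in `L²₀(𝕋²)`. -/
def opΛ : SpaceX →ₗ.[ℂ] SpaceX := graphΛ.toLinearPMap

/-- `L_α = A - i α Λ̂` in `L²₀(𝕋²)`. The domain is `D(A) ∩ D(Λ̂) = D(A)`. -/
def opL (α : ℝ) : SpaceX →ₗ.[ℂ] SpaceX := opA - (Complex.I * (α : ℂ)) • opΛ

/-- The projection `𝒫_l` onto the `l`-th Fourier mode in `x`; `fourier l x = e^{ilx}`. -/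
def modeProj (l : ℤ) (f : Torus → ℂ) (p : Torus) : ℂ :=
  (1 / (2 * Real.pi) : ℂ) * (∫ s : Circ, f (s, p.2) * fourier (-l) s) * fourier l p.1

theorem integral_modeProj (l : ℤ) (f : L2Torus) (x : Circ) :
    ∫ y : Circ, modeProj l f (x, y) =
      (1 / (2 * Real.pi) : ℂ) * (∫ p : Torus, f p * fourier (-l) p.1) * fourier l x := by
  have hc : Continuous fun p : Torus => (fourier (-l) p.1 : ℂ) :=
    (fourier (-l)).continuous.comp continuous_fst
  have h : ∫ p : Torus, f p * fourier (-l) p.1 =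
      ∫ y : Circ, ∫ s : Circ, f (s, y) * fourier (-l) s :=
    integral_prod_symm _ (integrable_mul_continuous (integrable_L2 f) hc)
  simp only [modeProj]
  rw [integral_mul_const, integral_const_mul, h]

theorem integral_modeProj_eq_zero_iff (l : ℤ) (f : L2Torus) :
    (∀ x : Circ, ∫ y : Circ, modeProj l f (x, y) = 0) ↔
      ∫ p : Torus, f p * fourier (-l) p.1 = 0 := by
  simp only [integral_modeProj]
  constructor
  · intro h
    have h0 := h 0
    simpa [Real.pi_ne_zero] using h0
  · intro h x
    rw [h, mul_zero, zero_mul]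

theorem exists_pairing {S : Type*} [TopologicalSpace S] [CompactSpace S]
    [MeasurableSpace S] [BorelSpace S] {μ : Measure S} [IsFiniteMeasure μ]
    (c : C(S, ℂ)) : ∃ T : Lp ℂ 2 μ →L[ℂ] ℂ, ∀ f : Lp ℂ 2 μ, T f = ∫ s, f s * c s ∂μ := by
  refine ⟨innerSL ℂ (ContinuousMap.toLp 2 μ ℂ (star c)), fun f => ?_⟩
  rw [innerSL_apply_apply, L2.inner_def]
  refine integral_congr_ae ?_
  filter_upwards [ContinuousMap.coeFn_toLp (p := 2) (𝕜 := ℂ) μ (star c)] with s hs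
  rw [hs]
  simp

/-- The subspace `Y` of `L²₀(𝕋²)`. -/
def spaceY : Submodule ℂ SpaceX where
  carrier := {ω | ∀ l : ℤ, |l| = 1 → ∀ x : Circ, ∫ y : Circ, modeProj l (ω : L2Torus) (x, y) = 0}
  zero_mem' := by
    intro l _
    rw [integral_modeProj_eq_zero_iff]
    obtain ⟨T, hT⟩ := exists_pairing (μ := (volume : Measure Torus))
      ((fourier (-l)).comp ⟨Prod.fst, continuous_fst⟩)
    exact (hT _).symm.trans (map_zero T)
  add_mem' := by
    intro f g hf hg l hl
    have hf := (integral_modeProj_eq_zero_iff l f).1 (hf l hl)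
    have hg := (integral_modeProj_eq_zero_iff l g).1 (hg l hl)
    rw [integral_modeProj_eq_zero_iff]
    obtain ⟨T, hT⟩ := exists_pairing (μ := (volume : Measure Torus))
      ((fourier (-l)).comp ⟨Prod.fst, continuous_fst⟩)
    have := map_add T (f : L2Torus) g
    rw [hT, hT, hT] at this
    refine this.trans ?_
    exact (congrArg₂ (· + ·) hf hg).trans (add_zero _)
  smul_mem' := by
    intro c f hf l hl
    have hf := (integral_modeProj_eq_zero_iff l f).1 (hf l hl)
    rw [integral_modeProj_eq_zero_iff]
    obtain ⟨T, hT⟩ := exists_pairing (μ := (volume : Measure Torus))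
      ((fourier (-l)).comp ⟨Prod.fst, continuous_fst⟩)
    have := map_smul T c (f : L2Torus)
    rw [hT, hT] at this
    exact this.trans ((congrArg (c • ·) hf).trans (smul_zero _))

theorem isClosed_spaceY : IsClosed (spaceY : Set SpaceX) := by
  have h : (spaceY : Set SpaceX) = ⋂ (l : ℤ) (_ : |l| = 1),
      {f : SpaceX | ∫ p : Torus, (f : L2Torus) p * fourier (-l) p.1 = 0} := by
    ext f
    simp only [Set.mem_iInter, Set.mem_ofPred_eq, ← integral_modeProj_eq_zero_iff]
    rfl
  rw [h]
  refine isClosed_iInter fun l => isClosed_iInter fun _ => ?_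
  obtain ⟨T, hT⟩ := exists_pairing (μ := (volume : Measure Torus))
    ((fourier (-l)).comp ⟨Prod.fst, continuous_fst⟩)
  have : {f : SpaceX | ∫ p : Torus, (f : L2Torus) p * fourier (-l) p.1 = 0} =
      {f : SpaceX | T (f : L2Torus) = 0} := by
    ext f
    rw [Set.mem_ofPred_eq, Set.mem_ofPred_eq, hT]
    rfl
  rw [this]
  exact isClosed_eq (T.continuous.comp continuous_subtype_val) continuous_const

instance instCompleteSpaceY : CompleteSpace spaceY :=
  isClosed_spaceY.completeSpace_coe

/-! ### The operators for a single Fourier mode -/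

/-- The graph of `A_l = ∂_y² - l²` in `L²(𝕋)` with domain `W^{2,2}(𝕋)`. -/
def graphAMode (l : ℤ) : Submodule ℂ (L2Circ × L2Circ) where
  carrier := {p | ∃ f₁ f₂ : L2Circ, HasWeakD p.1 f₁ ∧ HasWeakD f₁ f₂ ∧
    p.2 = f₂ - ((l : ℂ) ^ 2) • p.1}
  zero_mem' := ⟨0, 0, .zero, .zero, by simp⟩
  add_mem' := by
    rintro p q ⟨a, b, h1, h2, h3⟩ ⟨a', b', k1, k2, k3⟩
    refine ⟨a + a', b + b', h1.add k1, h2.add k2, ?_⟩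
    rw [Prod.snd_add, Prod.fst_add, h3, k3, smul_add]
    abel
  smul_mem' := by
    rintro r p ⟨a, b, h1, h2, h3⟩
    refine ⟨r • a, r • b, h1.smul r, h2.smul r, ?_⟩
    rw [Prod.smul_snd, Prod.smul_fst, h3, smul_sub, smul_comm r]

/-- `A_l = ∂_y² - l²` in `L²(𝕋)`. -/
def opAMode (l : ℤ) : L2Circ →ₗ.[ℂ] L2Circ := (graphAMode l).toLinearPMap

/-- The graph of `Λ̂_l f = sin y (f + A_l⁻¹ f)` in `L²(𝕋)`, where `ψ = A_l⁻¹ f`. -/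
def graphΛMode (l : ℤ) : Submodule ℂ (L2Circ × L2Circ) where
  carrier := {p | ∃ ψ : L2Circ, (ψ, p.1) ∈ (opAMode l).graph ∧
    p.2 =ᵐ[volume] fun y => (sinC y : ℂ) * (p.1 + ψ : L2Circ) y}
  zero_mem' := by
    refine ⟨0, (opAMode l).graph.zero_mem, ?_⟩
    have h : ((0 : L2Circ × L2Circ).1 + 0 : L2Circ) = 0 := by simp
    rw [h]
    filter_upwards [Lp.coeFn_zero ℂ 2 (volume : Measure Circ)] with y hy
    rw [Prod.snd_zero, hy]
    simp
  add_mem' := by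
    rintro p q ⟨ψ, h1, h2⟩ ⟨ψ', k1, k2⟩
    refine ⟨ψ + ψ', (opAMode l).graph.add_mem h1 k1, ?_⟩
    have h : ((p + q).1 + (ψ + ψ') : L2Circ) = (p.1 + ψ) + (q.1 + ψ') := by
      rw [Prod.fst_add]; abel
    rw [h, Prod.snd_add]
    filter_upwards [coeFn_add_ae p.2 q.2, coeFn_add_ae (p.1 + ψ) (q.1 + ψ'), h2, k2]
      with y e1 e2 e3 e4
    rw [e1, e2, e3, e4, mul_add]
  smul_mem' := by
    rintro a p ⟨ψ, h1, h2⟩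
    refine ⟨a • ψ, (opAMode l).graph.smul_mem a h1, ?_⟩
    have h : ((a • p).1 + a • ψ : L2Circ) = a • (p.1 + ψ) := by
      rw [Prod.smul_fst, smul_add]
    rw [h, Prod.smul_snd]
    filter_upwards [coeFn_smul_ae a p.2, coeFn_smul_ae a (p.1 + ψ), h2] with y e1 e2 e3
    rw [e1, e2, e3, mul_left_comm]

/-- `Λ̂_l = sin y (I + A_l⁻¹)` in `L²(𝕋)`. -/
def opΛMode (l : ℤ) : L2Circ →ₗ.[ℂ] L2Circ := (graphΛMode l).toLinearPMap

/-- `L_{α,l} = A_l - i α l Λ̂_l` in `L²(𝕋)`. The domain is `D(A_l) = W^{2,2}(𝕋)`. -/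
def opLMode (α : ℝ) (l : ℤ) : L2Circ →ₗ.[ℂ] L2Circ :=
  opAMode l - (Complex.I * (α : ℂ) * (l : ℂ)) • opΛMode l

/-- `Y_l`: the mean-zero functions if `l = ±1`, and all of `L²(𝕋)` otherwise. -/
def spaceYMode (l : ℤ) : Submodule ℂ L2Circ where
  carrier := {f | |l| = 1 → ∫ y : Circ, f y = 0}
  zero_mem' := fun _ => by
    rw [integral_congr_ae (Lp.coeFn_zero ℂ 2 (volume : Measure Circ))]
    simp
  add_mem' := fun {f g} hf hg hl => by
    rw [integral_congr_ae (coeFn_add_ae f g), integral_add (integrable_L2 f) (integrable_L2 g),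
      hf hl, hg hl, add_zero]
  smul_mem' := fun c f hf hl => by
    rw [integral_congr_ae (coeFn_smul_ae c f), integral_const_mul, hf hl, mul_zero]

theorem isClosed_spaceYMode (l : ℤ) : IsClosed (spaceYMode l : Set L2Circ) := by
  have h : (spaceYMode l : Set L2Circ) = ⋂ (_ : |l| = 1), {f : L2Circ | ∫ y : Circ, f y = 0} := by
    ext f
    simp only [Set.mem_iInter, Set.mem_ofPred_eq]
    rfl
  rw [h]
  refine isClosed_iInter fun _ => ?_
  obtain ⟨T, hT⟩ := exists_pairing (μ := (volume : Measure Circ)) (1 : C(Circ, ℂ))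
  have : {f : L2Circ | ∫ y : Circ, f y = 0} = {f : L2Circ | T f = 0} := by
    ext f
    simp [hT]
  rw [this]
  exact isClosed_eq T.continuous continuous_const

instance instCompleteSpaceYMode (l : ℤ) : CompleteSpace (spaceYMode l) :=
  (isClosed_spaceYMode l).completeSpace_coe

/-! ### Uniqueness of weak derivatives: `graphA` and `graphAMode` are graphs of operators -/

theorem eq_zero_of_test {S : Type*} [TopologicalSpace S] [CompactSpace S] [T2Space S]
    [NormalSpace S] [R1Space S] [SecondCountableTopologyEither S ℂ]
    [MeasurableSpace S] [BorelSpace S] {μ : Measure S} [IsFiniteMeasure μ] [μ.WeaklyRegular]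
    (B : StarSubalgebra ℂ C(S, ℂ)) (hB : B.SeparatesPoints) (g : Lp ℂ 2 μ)
    (h : ∀ c ∈ B, ∫ s, g s * c s ∂μ = 0) : g = 0 := by
  have hd := ContinuousMap.starSubalgebra_topologicalClosure_eq_top_of_separatesPoints B hB
  have h1 : ∀ c : C(S, ℂ), inner ℂ (ContinuousMap.toLp 2 μ ℂ c) g = 0 := by
    intro c
    have hc : c ∈ closure (B : Set C(S, ℂ)) := by
      have : c ∈ B.topologicalClosure := hd ▸ StarSubalgebra.mem_top
      exact this
    have hcl : IsClosed {c : C(S, ℂ) | inner ℂ (ContinuousMap.toLp 2 μ ℂ c) g = 0} :=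
      isClosed_eq (((ContinuousMap.toLp 2 μ ℂ).continuous).inner continuous_const) continuous_const
    refine closure_minimal (fun b hb => ?_) hcl hc
    rw [Set.mem_ofPred_eq, L2.inner_def, ← h (star b) (star_mem hb)]
    refine integral_congr_ae ?_
    filter_upwards [ContinuousMap.coeFn_toLp (p := 2) (𝕜 := ℂ) μ b] with s hs
    rw [hs]
    simp
  have hdr := ContinuousMap.toLp_denseRange ℂ μ ℂ (p := 2) (by simp)
  refine hdr.eq_zero_of_inner_right ℂ ?_
  intro c
  exact h1 c

/-- The smooth functions on the circle, as a star subalgebra. -/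
def testCircAlg : StarSubalgebra ℂ C(Circ, ℂ) where
  carrier := {φ | TestCirc φ}
  mul_mem' := fun {a b} ha hb => by
    change TestCirc a at ha
    change TestCirc b at hb
    change TestCirc (a * b)
    exact ContDiff.mul ha hb
  add_mem' := fun {a b} ha hb => by
    change TestCirc a at ha
    change TestCirc b at hb
    change TestCirc (a + b)
    exact ContDiff.add ha hb
  algebraMap_mem' := fun r => by
    change TestCirc (algebraMap ℂ _ r)
    exact contDiff_const
  star_mem' := fun {a} ha => by
    change TestCirc a at ha
    change TestCirc (star a)
    exact Complex.conjCLE.contDiff.comp ha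

/-- The smooth functions on the torus, as a star subalgebra. -/
def testTorusAlg : StarSubalgebra ℂ C(Torus, ℂ) where
  carrier := {φ | TestTorus φ}
  mul_mem' := fun {a b} ha hb => by
    change TestTorus a at ha
    change TestTorus b at hb
    change TestTorus (a * b)
    exact ContDiff.mul ha hb
  add_mem' := fun {a b} ha hb => by
    change TestTorus a at ha
    change TestTorus b at hb
    change TestTorus (a + b)
    exact ContDiff.add ha hb
  algebraMap_mem' := fun r => by
    change TestTorus (algebraMap ℂ _ r)
    exact contDiff_const
  star_mem' := fun {a} ha => by
    change TestTorus a at ha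
    change TestTorus (star a)
    exact Complex.conjCLE.contDiff.comp ha

theorem testCirc_fourier (n : ℤ) : TestCirc (fourier n) := by
  unfold TestCirc
  simp only [fourier_coe_apply]
  refine Complex.contDiff_exp.comp ?_
  exact (contDiff_const.mul Complex.ofRealCLM.contDiff).div_const _

theorem fourier_one_injective : Function.Injective (fourier 1 : Circ → ℂ) := by
  intro x y h
  rw [fourier_one, fourier_one] at h
  exact AddCircle.injective_toCircle Real.two_pi_pos.ne' (Subtype.ext h)

theorem testCircAlg_separatesPoints : testCircAlg.SeparatesPoints := fun _ _ hxy =>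
  ⟨_, ⟨fourier 1, testCirc_fourier 1, rfl⟩, fun h => hxy (fourier_one_injective h)⟩

theorem testTorusAlg_separatesPoints : testTorusAlg.SeparatesPoints := by
  intro p q hpq
  by_cases h : p.1 = q.1
  · refine ⟨_, ⟨(fourier 1).comp ⟨Prod.snd, continuous_snd⟩, ?_, rfl⟩, fun h' => hpq ?_⟩
    · exact ContDiff.comp (testCirc_fourier 1) contDiff_snd
    · exact Prod.ext h (fourier_one_injective h')
  · refine ⟨_, ⟨(fourier 1).comp ⟨Prod.fst, continuous_fst⟩, ?_, rfl⟩, fun h' => h ?_⟩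
    · exact ContDiff.comp (testCirc_fourier 1) contDiff_fst
    · exact fourier_one_injective h'

theorem HasWeakD.eq_zero {g : L2Circ} (h : HasWeakD (0 : L2Circ) g) : g = 0 :=
  eq_zero_of_test testCircAlg testCircAlg_separatesPoints g fun φ hφ => by
    have h0 := HasWeakD.zero φ hφ
    have e : ∫ y, (0 : L2Circ) y * φ y = 0 := by
      rw [integral_congr_ae (g := fun _ => 0)
        ((Lp.coeFn_zero ℂ 2 (volume : Measure Circ)).mono fun y _ => by simp)]
      simp
    rw [e] at h0
    have := h φ hφ
    rw [h0] at this
    simpa using this.symm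

theorem HasWeakDX.eq_zero {g : L2Torus} (h : HasWeakDX (0 : L2Torus) g) : g = 0 :=
  eq_zero_of_test testTorusAlg testTorusAlg_separatesPoints g fun φ hφ => by
    have h0 := HasWeakDX.zero φ hφ
    have e : ∫ y, (0 : L2Torus) y * φ y = 0 := by
      rw [integral_congr_ae (g := fun _ => 0)
        ((Lp.coeFn_zero ℂ 2 (volume : Measure Torus)).mono fun y _ => by simp)]
      simp
    rw [e] at h0
    have := h φ hφ
    rw [h0] at this
    simpa using this.symm

theorem HasWeakDY.eq_zero {g : L2Torus} (h : HasWeakDY (0 : L2Torus) g) : g = 0 :=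
  eq_zero_of_test testTorusAlg testTorusAlg_separatesPoints g fun φ hφ => by
    have h0 := HasWeakDY.zero φ hφ
    have e : ∫ y, (0 : L2Torus) y * φ y = 0 := by
      rw [integral_congr_ae (g := fun _ => 0)
        ((Lp.coeFn_zero ℂ 2 (volume : Measure Torus)).mono fun y _ => by simp)]
      simp
    rw [e] at h0
    have := h φ hφ
    rw [h0] at this
    simpa using this.symm

theorem graph_opA : opA.graph = graphA := by
  refine Submodule.toLinearPMap_graph_eq _ ?_
  rintro ⟨f, h⟩ ⟨a, b, c, d, e, h1, h2, h3, h4, h5, h6⟩ hf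
  simp only at hf h1 h2 h6
  subst hf
  obtain rfl := HasWeakDX.eq_zero h1
  obtain rfl := HasWeakDY.eq_zero h2
  obtain rfl := HasWeakDX.eq_zero h3
  obtain rfl := HasWeakDY.eq_zero h5
  exact SpaceX.incl.injective (h6.trans ((add_zero _).trans (map_zero SpaceX.incl).symm))

theorem graph_opAMode (l : ℤ) : (opAMode l).graph = graphAMode l := by
  refine Submodule.toLinearPMap_graph_eq _ ?_
  rintro ⟨f, h⟩ ⟨a, b, h1, h2, h3⟩ hf
  simp only at hf h1 h3
  subst hf
  obtain rfl := HasWeakD.eq_zero h1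
  obtain rfl := HasWeakD.eq_zero h2
  simpa using h3

end Kolmogorov

end

noncomputable section

namespace Kolmogorov

/-! Expand in the exponentials e^{i(lx+ky)} with l ≠ 0, and put a = k² + l², b = 1 - 1/a. Then (iλ -
L_α) f = h reads iλ f + a f + α · `conv` f = h, where `conv` is ∂ₓ(sin y · b f) in coefficients. The
factor b vanishes exactly on the modes |l| = 1, k = 0 (`Bad`) and is at least 1/2 on all others; Y
is the closed span of the good modes. Since b kills the bad modes, the equations on the good modes
form a closed system.

Energy. Pairing the equation with b f makes the transport term skew-symmetric, so for f supported on
the good modes the real part is the sum of a b |f|², at least half the squared H¹ norm. Conjugated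
by (-Δ)^{-1/2} this is `coercive_form`. It gives invertibility for all real α and λ
(`exists_good_resolvent`, `exists_full_resolvent`) and, in `energy`, an H¹ bound in which neither α
nor λ appears.

Smallness. If the resolvents did not become small, there would be normalized solutions with bounded
data and |α| → ∞. The H¹ bound is compact in L², so a subsequence converges to some F of norm one.
Dividing the equations by α, the ratios λ/α converge to a real ν, and F satisfies iνF + `conv` F = 0
on the good modes (`not_exists_bounded_sequence`).

Rigidity. `eq_zero_of_eigen` excludes such an F. For ν = 0 the coefficients of b F are two-periodic
in k on each half-line, and they decay. For ν ≠ 0 each x-mode gives an H¹ eigenfunction of sin y (1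
+ A_l⁻¹) with eigenvalue μ ≠ 0. With ψ = A_l⁻¹ f, g = f + ψ and w = sin y - μ one has w g = -μ ψ,
and two integrations by parts give ‖w g'‖² + l² μ² ‖ψ‖² = 0 (`eq_zero_of_sinShift_eq`). There is no
division by w, so critical values |μ| ≤ 1 need no separate treatment.

The remaining work identifies the weakly defined operators with their Fourier symbols
(`represents_opL`, `represents_opLMode`). Both halves of the theorem are then instances of
`resolvent_bounds`. -/

variable {ι : Type*}

/-! ### Square-summable sequences and weighted shifts -/

/-- The space of square-summable complex sequences. -/
abbrev SqSum (ι : Type*) : Type _ := lp (fun _ : ι => ℂ) 2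

theorem memlp_two_iff {f : ι → ℂ} : Memℓp f 2 ↔ Summable fun i => ‖f i‖ ^ 2 := by
  rw [memℓp_gen_iff (by simp)]
  simp

theorem SqSum.summable (x : SqSum ι) : Summable fun i => ‖x i‖ ^ 2 :=
  memlp_two_iff.1 (lp.memℓp x)

theorem SqSum.norm_sq (x : SqSum ι) : ‖x‖ ^ 2 = ∑' i, ‖x i‖ ^ 2 := by
  have := lp.norm_rpow_eq_tsum (p := 2) (by simp) x
  simpa using this

/-- A square-summable function as an element of `SqSum`. -/
def SqSum.mk (f : ι → ℂ) (hf : Summable fun i => ‖f i‖ ^ 2) : SqSum ι :=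
  ⟨f, memlp_two_iff.2 hf⟩

@[simp] theorem SqSum.mk_apply (f : ι → ℂ) (hf : Summable fun i => ‖f i‖ ^ 2) (i : ι) :
    SqSum.mk f hf i = f i := rfl

theorem SqSum.ext {x y : SqSum ι} (h : ∀ i, x i = y i) : x = y :=
  lp.ext (funext h)

theorem summable_sq_of_le {f g : ι → ℂ} (hg : Summable fun i => ‖g i‖ ^ 2)
    (h : ∀ i, ‖f i‖ ≤ ‖g i‖) : Summable fun i => ‖f i‖ ^ 2 :=
  hg.of_nonneg_of_le (fun _ => by positivity) fun i => by gcongr; exact h i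

theorem summable_sq_const_mul {g : ι → ℂ} (c : ℂ) (hg : Summable fun i => ‖g i‖ ^ 2) :
    Summable fun i => ‖c * g i‖ ^ 2 := by
  simp only [norm_mul, mul_pow]
  exact hg.mul_left _

theorem summable_sq_add {f g : ι → ℂ} (hf : Summable fun i => ‖f i‖ ^ 2)
    (hg : Summable fun i => ‖g i‖ ^ 2) : Summable fun i => ‖f i + g i‖ ^ 2 :=
  memlp_two_iff.1 ((memlp_two_iff.2 hf).add (memlp_two_iff.2 hg))

theorem summable_sq_sub {f g : ι → ℂ} (hf : Summable fun i => ‖f i‖ ^ 2)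
    (hg : Summable fun i => ‖g i‖ ^ 2) : Summable fun i => ‖f i - g i‖ ^ 2 :=
  memlp_two_iff.1 ((memlp_two_iff.2 hf).sub (memlp_two_iff.2 hg))

theorem summable_weightedShift {m : ι → ℂ} {C : ℝ} (hm : ∀ i, ‖m i‖ ≤ C) (σ : ι ≃ ι) (x : SqSum ι) :
    Summable fun i => ‖m i * x (σ i)‖ ^ 2 := by
  have h := ((σ.summable_iff (f := fun i => ‖x i‖ ^ 2)).2 x.summable).mul_left (C ^ 2)
  refine h.of_nonneg_of_le (fun _ => by positivity) fun i => ?_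
  rw [norm_mul, mul_pow]
  exact mul_le_mul_of_nonneg_right (pow_le_pow_left₀ (norm_nonneg _) (hm i) 2) (by positivity)

/-- The bounded operator `(x i) ↦ (m i * x (σ i))` for a bounded weight `m` and a permutation `σ`. -/
def weightedShift (m : ι → ℂ) {C : ℝ} (hm : ∀ i, ‖m i‖ ≤ C) (σ : ι ≃ ι) : SqSum ι →L[ℂ] SqSum ι :=
  LinearMap.mkContinuous
    { toFun := fun x => SqSum.mk (fun i => m i * x (σ i)) (summable_weightedShift hm σ x)
      map_add' := fun x y => SqSum.ext fun i => by
        simp only [SqSum.mk_apply, lp.coeFn_add, Pi.add_apply, mul_add]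
      map_smul' := fun c x => SqSum.ext fun i => by
        simp only [SqSum.mk_apply, lp.coeFn_smul, Pi.smul_apply, smul_eq_mul, RingHom.id_apply]
        ring }
    |C| (fun x => by
      refine le_of_sq_le_sq ?_ (by positivity)
      rw [mul_pow, SqSum.norm_sq, SqSum.norm_sq, ← tsum_mul_left, sq_abs,
        ← σ.tsum_eq (fun i => C ^ 2 * ‖x i‖ ^ 2)]
      refine Summable.tsum_le_tsum (fun i => ?_) (summable_weightedShift hm σ x)
        ((σ.summable_iff (f := fun i => C ^ 2 * ‖x i‖ ^ 2)).2 (x.summable.mul_left _))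
      change ‖m i * x (σ i)‖ ^ 2 ≤ _
      rw [norm_mul, mul_pow]
      exact mul_le_mul_of_nonneg_right (pow_le_pow_left₀ (norm_nonneg _) (hm i) 2) (by positivity))

@[simp] theorem weightedShift_apply (m : ι → ℂ) {C : ℝ} (hm : ∀ i, ‖m i‖ ≤ C) (σ : ι ≃ ι)
    (x : SqSum ι) (i : ι) : weightedShift m hm σ x i = m i * x (σ i) := rfl

theorem norm_weightedShift_le (m : ι → ℂ) {C : ℝ} (hC : 0 ≤ C) (hm : ∀ i, ‖m i‖ ≤ C) (σ : ι ≃ ι) :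
    ‖weightedShift m hm σ‖ ≤ C :=
  (LinearMap.mkContinuous_norm_le _ (abs_nonneg C) _).trans_eq (abs_of_nonneg hC)

open Classical in
/-- A diagonal operator whose entries tend to zero is compact. -/
theorem isCompactOperator_diagonal (m : ι → ℂ) {C : ℝ} (hm : ∀ i, ‖m i‖ ≤ C)
    (hlim : Tendsto m cofinite (𝓝 0)) :
    IsCompactOperator (weightedShift m hm (Equiv.refl ι)) := by
  -- These are finite-rank truncations. They converge in operator norm because only finitely many
  -- entries exceed ε / 2.
  let T : Finset ι → (SqSum ι →L[ℂ] SqSum ι) := fun s =>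
    ∑ i ∈ s, (m i) • (lp.singleContinuousLinearMap ℂ (fun _ : ι => ℂ) 2 i ∘L
      lp.evalCLM ℂ (fun _ : ι => ℂ) 2 i)
  have hT : ∀ s x j, T s x j = if j ∈ s then m j * x j else 0 := by
    intro s x j
    simp only [T, _root_.sum_apply, lp.coeFn_sum, Finset.sum_apply,
      _root_.smul_apply, lp.coeFn_smul, Pi.smul_apply,
      ContinuousLinearMap.comp_apply, lp.singleContinuousLinearMap_apply]
    rw [← Finset.sum_ite_eq s j (fun j => m j * x j)]
    refine Finset.sum_congr rfl fun i _ => ?_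
    by_cases h : j = i
    · subst h
      simp only [lp.single_apply_self, if_true, smul_eq_mul]
      rfl
    · rw [lp.single_apply_ne _ _ _ h, if_neg h, smul_zero]
  have hTc : ∀ s, IsCompactOperator (T s) := by
    intro s
    have : T s ∈ compactOperator (RingHom.id ℂ) (SqSum ι) (SqSum ι) := by
      refine Submodule.sum_mem _ fun i _ => Submodule.smul_mem _ _ ?_
      exact (isCompactOperator_of_locallyCompactSpace_rng
        (lp.singleContinuousLinearMap ℂ (fun _ : ι => ℂ) 2 i)).comp_clm
        (lp.evalCLM ℂ (fun _ : ι => ℂ) 2 i)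
    exact this
  refine isCompactOperator_of_tendsto (l := atTop) (F := T) ?_ (Eventually.of_forall hTc)
  rw [Metric.tendsto_atTop]
  intro ε hε
  have h1 : {i | ¬ ‖m i‖ < ε / 2}.Finite := by
    have := (tendsto_zero_iff_norm_tendsto_zero.1 hlim).eventually (gt_mem_nhds (half_pos hε))
    exact this
  refine ⟨h1.toFinset, fun s hs => ?_⟩
  rw [dist_eq_norm]
  have h2 : ∀ i, ‖(if i ∈ s then (0 : ℂ) else - m i)‖ ≤ ε / 2 := by
    intro i
    split_ifs with h
    · simpa using (half_pos hε).le
    · have : i ∉ h1.toFinset := fun h' => h (hs h')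
      simp at this
      simpa using this.le
  have h3 : T s - weightedShift m hm (Equiv.refl ι) = weightedShift _ h2 (Equiv.refl ι) := by
    ext x : 1
    refine SqSum.ext fun i => ?_
    rw [_root_.sub_apply, lp.coeFn_sub, Pi.sub_apply, hT, weightedShift_apply,
      weightedShift_apply]
    split_ifs <;> simp
  rw [h3]
  exact (norm_weightedShift_le _ (half_pos hε).le h2 _).trans_lt (half_lt_self hε)

/-! ### Absence of eigenfunctions for a single mode -/

/-- Multiplication by `sin y` on Fourier coefficients. -/
def sinShift : SqSum ℤ →L[ℂ] SqSum ℤ :=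
  weightedShift (fun _ => (2 * Complex.I)⁻¹) (fun _ => le_rfl) (Equiv.subRight 1) -
    weightedShift (fun _ => (2 * Complex.I)⁻¹) (fun _ => le_rfl) (Equiv.addRight 1)

/-- Multiplication by `cos y` on Fourier coefficients. -/
def cosShift : SqSum ℤ →L[ℂ] SqSum ℤ :=
  weightedShift (fun _ => 2⁻¹) (fun _ => le_rfl) (Equiv.subRight 1) +
    weightedShift (fun _ => 2⁻¹) (fun _ => le_rfl) (Equiv.addRight 1)

theorem sinShift_apply (x : SqSum ℤ) (k : ℤ) :
    sinShift x k = (2 * Complex.I)⁻¹ * (x (k - 1) - x (k + 1)) := by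
  rw [mul_sub]; rfl

theorem cosShift_apply (x : SqSum ℤ) (k : ℤ) : cosShift x k = 2⁻¹ * (x (k - 1) + x (k + 1)) := by
  rw [mul_add]; rfl

/-! ### Calculus on coefficients: symmetry of sin and cos, Leibniz rules, integration by parts. -/

theorem inner_weightedShift_sub_one (m : ℂ) (x y : SqSum ℤ) :
    inner ℂ (weightedShift (fun _ => m) (fun _ => le_rfl) (Equiv.subRight 1) x) y =
      inner ℂ x (weightedShift (fun _ => star m) (fun _ => le_rfl) (Equiv.addRight 1) y) := by
  rw [lp.inner_eq_tsum, lp.inner_eq_tsum, ← (Equiv.addRight (1 : ℤ)).tsum_eq]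
  refine tsum_congr fun k => ?_
  simp [weightedShift_apply]
  ring

theorem inner_weightedShift_add_one (m : ℂ) (x y : SqSum ℤ) :
    inner ℂ (weightedShift (fun _ => m) (fun _ => le_rfl) (Equiv.addRight 1) x) y =
      inner ℂ x (weightedShift (fun _ => star m) (fun _ => le_rfl) (Equiv.subRight 1) y) := by
  rw [lp.inner_eq_tsum, lp.inner_eq_tsum, ← (Equiv.subRight (1 : ℤ)).tsum_eq]
  refine tsum_congr fun k => ?_
  simp [weightedShift_apply]
  ring

/-- Passing to adjoints swaps the two shifts, and conjugation flips the sign of 1/(2i); the two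
effects cancel. -/
theorem inner_sinShift (x y : SqSum ℤ) : inner ℂ (sinShift x) y = inner ℂ x (sinShift y) := by
  have h : ∀ σ : ℤ ≃ ℤ, weightedShift (fun _ => star (2 * Complex.I)⁻¹) (fun _ => le_rfl) σ y =
      -weightedShift (fun _ => (2 * Complex.I)⁻¹) (fun _ => le_rfl) σ y := by
    intro σ
    refine SqSum.ext fun k => ?_
    rw [lp.coeFn_neg, Pi.neg_apply, weightedShift_apply, weightedShift_apply]
    simp
  unfold sinShift
  rw [_root_.sub_apply, _root_.sub_apply, inner_sub_left, inner_sub_right,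
    inner_weightedShift_sub_one, inner_weightedShift_add_one, h, h, inner_neg_right,
    inner_neg_right]
  ring

theorem inner_cosShift (x y : SqSum ℤ) : inner ℂ (cosShift x) y = inner ℂ x (cosShift y) := by
  have h : ∀ σ : ℤ ≃ ℤ, weightedShift (fun _ => star (2 : ℂ)⁻¹) (fun _ => le_rfl) σ y =
      weightedShift (fun _ => 2⁻¹) (fun _ => le_rfl) σ y := by
    intro σ
    refine SqSum.ext fun k => ?_
    rw [weightedShift_apply, weightedShift_apply]
    simp
  unfold cosShift
  rw [_root_.add_apply, _root_.add_apply, inner_add_left, inner_add_right,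
    inner_weightedShift_sub_one, inner_weightedShift_add_one, h, h]
  ring

theorem sinShift_cosShift (x : SqSum ℤ) : sinShift (cosShift x) = cosShift (sinShift x) := by
  refine SqSum.ext fun k => ?_
  simp only [sinShift_apply, cosShift_apply]
  ring_nf

/-- `x'` consists of the Fourier coefficients of the derivative of the function with
coefficients `x`. -/
def IsDerivCoeff (x x' : SqSum ℤ) : Prop := ∀ k : ℤ, x' k = Complex.I * k * x k

/-- Integration by parts: the symbol ik is purely imaginary. -/
theorem IsDerivCoeff.inner_left {x x' y y' : SqSum ℤ} (hx : IsDerivCoeff x x')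
    (hy : IsDerivCoeff y y') : inner ℂ x' y = -inner ℂ x y' := by
  rw [lp.inner_eq_tsum, lp.inner_eq_tsum, ← tsum_neg]
  refine tsum_congr fun k => ?_
  simp [hx k, hy k]
  ring

theorem IsDerivCoeff.sin_mul {x x' : SqSum ℤ} (hx : IsDerivCoeff x x') :
    IsDerivCoeff (sinShift x) (sinShift x' + cosShift x) := by
  intro k
  rw [lp.coeFn_add, Pi.add_apply, sinShift_apply, sinShift_apply, cosShift_apply, hx, hx]
  push_cast
  field_simp
  ring

theorem IsDerivCoeff.cos_mul {x x' : SqSum ℤ} (hx : IsDerivCoeff x x') :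
    IsDerivCoeff (cosShift x) (cosShift x' - sinShift x) := by
  intro k
  rw [lp.coeFn_sub, Pi.sub_apply, cosShift_apply, sinShift_apply, cosShift_apply, hx, hx]
  push_cast
  field_simp
  ring_nf
  simp
  ring

theorem IsDerivCoeff.smul {x x' : SqSum ℤ} (c : ℂ) (hx : IsDerivCoeff x x') :
    IsDerivCoeff (c • x) (c • x') := by
  intro k
  rw [lp.coeFn_smul, lp.coeFn_smul, Pi.smul_apply, Pi.smul_apply, hx, smul_eq_mul, smul_eq_mul]
  ring

theorem IsDerivCoeff.sub {x x' y y' : SqSum ℤ} (hx : IsDerivCoeff x x') (hy : IsDerivCoeff y y') :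
    IsDerivCoeff (x - y) (x' - y') := by
  intro k
  rw [lp.coeFn_sub, lp.coeFn_sub, Pi.sub_apply, Pi.sub_apply, hx, hy]
  ring

/-- Multiplication by `sin y - μ` on Fourier coefficients. -/
def sinSubShift (μ : ℝ) : SqSum ℤ →L[ℂ] SqSum ℤ :=
  sinShift - (μ : ℂ) • ContinuousLinearMap.id ℂ (SqSum ℤ)

theorem sinSubShift_eq (μ : ℝ) (x : SqSum ℤ) : sinSubShift μ x = sinShift x - (μ : ℂ) • x := rfl

theorem inner_sinSubShift (μ : ℝ) (x y : SqSum ℤ) :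
    inner ℂ (sinSubShift μ x) y = inner ℂ x (sinSubShift μ y) := by
  simp only [sinSubShift_eq, inner_sub_left, inner_sub_right, inner_sinShift, inner_smul_left,
    inner_smul_right, Complex.conj_ofReal]

theorem sinSubShift_cosShift (μ : ℝ) (x : SqSum ℤ) :
    sinSubShift μ (cosShift x) = cosShift (sinSubShift μ x) := by
  simp only [sinSubShift_eq, map_sub, map_smul, sinShift_cosShift]

theorem IsDerivCoeff.sin_sub_mul {x x' : SqSum ℤ} (μ : ℝ) (hx : IsDerivCoeff x x') :
    IsDerivCoeff (sinSubShift μ x) (sinSubShift μ x' + cosShift x) := by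
  have h := hx.sin_mul.sub (hx.smul (μ : ℂ))
  rwa [← sinSubShift_eq, add_sub_right_comm, ← sinSubShift_eq] at h

/-- `‖(w g)'‖² = ‖w g'‖² + ⟨sin · w g, g⟩` for `w = sin - μ`. -/
theorem inner_deriv_sinSubShift (μ : ℝ) {g g' : SqSum ℤ} (hg : IsDerivCoeff g g') :
    inner ℂ (sinSubShift μ g' + cosShift g) (sinSubShift μ g' + cosShift g) =
      inner ℂ (sinSubShift μ g') (sinSubShift μ g') +
        inner ℂ (sinShift (sinSubShift μ g)) g := by
  -- Integrating (cos · w g)' against g produces the cross terms of the square, and differentiating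
  -- cos leaves the term with sin.
  have h1 := (hg.sin_sub_mul μ).cos_mul.inner_left hg
  have h2 : inner ℂ (cosShift (sinSubShift μ g)) g' = inner ℂ (cosShift g) (sinSubShift μ g') := by
    rw [← sinSubShift_cosShift, inner_sinSubShift]
  rw [h2, map_add, inner_sub_left, inner_add_left, inner_cosShift, inner_cosShift] at h1
  rw [inner_add_left, inner_add_right, inner_add_right]
  linear_combination h1

/-- Elliptic gain of two derivatives: it places A_l⁻¹ x and its first two derivatives in ℓ². -/
theorem summable_mode_mul (l : ℤ) (hl : l ≠ 0) (x : SqSum ℤ) (m : ℤ → ℂ)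
    (hm : ∀ k : ℤ, ‖m k‖ ≤ (k : ℝ) ^ 2 + (l : ℝ) ^ 2) :
    Summable fun k : ℤ => ‖m k * ((k : ℂ) ^ 2 + (l : ℂ) ^ 2)⁻¹ * x k‖ ^ 2 := by
  refine summable_sq_of_le x.summable fun k => ?_
  have hl' : (l : ℝ) ≠ 0 := by exact_mod_cast hl
  have hp : 0 < (k : ℝ) ^ 2 + (l : ℝ) ^ 2 := by positivity
  have : ‖((k : ℂ) ^ 2 + (l : ℂ) ^ 2)‖ = (k : ℝ) ^ 2 + (l : ℝ) ^ 2 := by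
    have h : ((k : ℂ) ^ 2 + (l : ℂ) ^ 2) = (((k : ℝ) ^ 2 + (l : ℝ) ^ 2 : ℝ) : ℂ) := by push_cast; ring
    rw [h, Complex.norm_real, Real.norm_of_nonneg hp.le]
  rw [norm_mul, norm_mul, norm_inv, this]
  refine mul_le_of_le_one_left (norm_nonneg _) ?_
  rw [← div_eq_mul_inv, div_le_one hp]
  exact hm k

theorem abs_intCast_le_sq (n : ℤ) : |(n : ℝ)| ≤ (n : ℝ) ^ 2 := by
  have h1 : |n| ≤ n ^ 2 := by
    rw [← sq_abs]
    nlinarith [abs_nonneg n, Int.le_self_sq |n|]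
  exact_mod_cast h1

/-- `sin y (1 + A_l⁻¹)` has no eigenfunction in `H¹` with a nonzero real eigenvalue. -/
theorem eq_zero_of_sinShift_eq {l : ℤ} (hl : l ≠ 0) {μ : ℝ} (hμ : μ ≠ 0) {f f' g : SqSum ℤ}
    (hf : IsDerivCoeff f f')
    (hg : ∀ k, g k = (1 - ((k : ℂ) ^ 2 + (l : ℂ) ^ 2)⁻¹) * f k)
    (h : sinShift g = (μ : ℂ) • f) : f = 0 := by
  have hl' : (l : ℝ) ≠ 0 := by exact_mod_cast hl
  have hne : ∀ k : ℤ, (k : ℂ) ^ 2 + (l : ℂ) ^ 2 ≠ 0 := fun k => by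
    have : 0 < (k : ℝ) ^ 2 + (l : ℝ) ^ 2 := by positivity
    exact_mod_cast this.ne'
  -- ψ = A_l⁻¹ f, followed by its first and second derivatives; hence f = ψ'' - l² ψ.
  let ψ : SqSum ℤ := SqSum.mk _ (summable_mode_mul l hl f (fun _ => -1) fun k => by
    have h1 : (1 : ℝ) ≤ (l : ℝ) ^ 2 := by
      have : 0 < l ^ 2 := by positivity
      exact_mod_cast this
    simp only [norm_neg, norm_one]
    nlinarith [sq_nonneg (k : ℝ)])
  let ψ₁ : SqSum ℤ := SqSum.mk _ (summable_mode_mul l hl f (fun k => -(Complex.I * k)) fun k => by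
    simp only [norm_neg, norm_mul, Complex.norm_I, one_mul, Complex.norm_intCast]
    nlinarith [abs_intCast_le_sq k, sq_nonneg (l : ℝ)])
  let ψ₂ : SqSum ℤ := SqSum.mk _ (summable_mode_mul l hl f (fun k => (k : ℂ) ^ 2) fun k => by
    simp only [norm_pow, Complex.norm_intCast, sq_abs]
    nlinarith [sq_nonneg (l : ℝ)])
  have d1 : IsDerivCoeff ψ ψ₁ := fun k => by
    simp only [ψ, ψ₁, SqSum.mk_apply]; ring
  have d2 : IsDerivCoeff ψ₁ ψ₂ := fun k => by
    simp only [ψ₁, ψ₂, SqSum.mk_apply]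
    linear_combination ((k : ℂ) ^ 2 * ((k : ℂ) ^ 2 + (l : ℂ) ^ 2)⁻¹ * f k) * Complex.I_sq
  have e1 : g = f + ψ := SqSum.ext fun k => by
    rw [hg, lp.coeFn_add, Pi.add_apply]
    simp only [ψ, SqSum.mk_apply]
    ring
  have e2 : ψ₂ = ((l : ℂ) ^ 2) • ψ + f := SqSum.ext fun k => by
    rw [lp.coeFn_add, Pi.add_apply, lp.coeFn_smul, Pi.smul_apply]
    simp only [ψ, ψ₂, SqSum.mk_apply, smul_eq_mul]
    field_simp [hne k]
    ring
  let g' : SqSum ℤ := f' + ψ₁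
  have dg : IsDerivCoeff g g' := fun k => by
    rw [e1, lp.coeFn_add, lp.coeFn_add, Pi.add_apply, Pi.add_apply, hf, d1]
    ring
  -- The eigenvalue equation in the form w g = -μ ψ, with w = sin - μ. It allows every pairing with
  -- w g to be replaced by one with ψ.
  have e3 : sinSubShift μ g = -((μ : ℂ) • ψ) := by
    rw [sinSubShift_eq, h, e1, smul_add]
    abel
  have e4 : sinSubShift μ f + sinShift ψ = 0 := by
    have : sinSubShift μ f = sinSubShift μ g - sinSubShift μ ψ := by
      rw [e1, map_add, add_sub_cancel_right]
    rw [this, e3, sinSubShift_eq]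
    abel
  have e5 : sinSubShift μ g' + cosShift g = -((μ : ℂ) • ψ₁) := SqSum.ext fun k => by
    rw [dg.sin_sub_mul μ k, e3, ← neg_smul, ← neg_smul, lp.coeFn_smul, lp.coeFn_smul,
      Pi.smul_apply, Pi.smul_apply, d1 k, smul_eq_mul, smul_eq_mul]
    ring
  have k1 : inner ℂ (sinSubShift μ ψ₂) g = (μ : ℂ) * inner ℂ ψ₁ ψ₁ := by
    rw [inner_sinSubShift, e3, inner_neg_right, inner_smul_right, d2.inner_left d1]
    ring
  have k2 : inner ℂ (sinSubShift μ ψ) g = -(μ : ℂ) * inner ℂ ψ ψ := by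
    rw [inner_sinSubShift, e3, inner_neg_right, inner_smul_right]
    ring
  have k3 : f = ψ₂ - ((l : ℂ) ^ 2) • ψ := by rw [e2]; abel
  -- The equation w f + sin · ψ = 0 tested against g, with f = ψ'' - l² ψ inserted.
  have k4 : inner ℂ (sinSubShift μ ψ₂) g - (l : ℂ) ^ 2 * inner ℂ (sinSubShift μ ψ) g +
      inner ℂ (sinShift ψ) g = 0 := by
    have := congrArg (fun x => inner ℂ x g) e4
    simp only [inner_zero_left, inner_add_left] at this
    rw [k3, map_sub, map_smul, inner_sub_left, inner_smul_left] at this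
    simpa using this
  have k5 := inner_deriv_sinSubShift μ dg
  rw [e5, e3, inner_neg_neg, inner_smul_left, inner_smul_right, map_neg, map_smul, inner_neg_left,
    inner_smul_left, Complex.conj_ofReal] at k5
  -- Both identities contain μ² ‖ψ'‖² and the indefinite term μ ⟨sin · ψ, g⟩. Eliminating these
  -- leaves a sum of nonnegative terms.
  have k6 : inner ℂ (sinSubShift μ g') (sinSubShift μ g') +
      (l : ℂ) ^ 2 * ((μ : ℂ) ^ 2 * inner ℂ ψ ψ) = 0 := by
    rw [k1, k2] at k4
    linear_combination (μ : ℂ) * k4 - k5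
  simp only [inner_self_eq_norm_sq_to_K] at k6
  have k7 : ‖sinSubShift μ g'‖ ^ 2 + (l : ℝ) ^ 2 * (μ ^ 2 * ‖ψ‖ ^ 2) = 0 := by
    apply Complex.ofReal_injective
    push_cast
    simpa using k6
  have k8 : (l : ℝ) ^ 2 * μ ^ 2 * ‖ψ‖ ^ 2 = 0 := by
    have : 0 ≤ (l : ℝ) ^ 2 * μ ^ 2 * ‖ψ‖ ^ 2 := by positivity
    nlinarith [sq_nonneg ‖sinSubShift μ g'‖]
  have k9 : ψ = 0 := by
    have : ‖ψ‖ ^ 2 = 0 := (mul_eq_zero.1 k8).resolve_left (by positivity)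
    simpa using this
  refine SqSum.ext fun k => ?_
  have := congrArg (fun x : SqSum ℤ => x k) k9
  simp only [ψ, SqSum.mk_apply, lp.coeFn_zero, Pi.zero_apply] at this
  simpa [hne k] using this

theorem eq_zero_of_forall_add_two {x : ℕ → ℂ} (h : ∀ n, x (n + 2) = x n)
    (hx : Tendsto x atTop (𝓝 0)) (n : ℕ) : x n = 0 := by
  have h1 : ∀ m, x (n + m * 2) = x n := by
    intro m
    induction m with
    | zero => simp
    | succ m ih => rw [← ih, ← h (n + m * 2)]; congr 1; ring
  have h2 : Tendsto (fun m : ℕ => x (n + m * 2)) atTop (𝓝 0) :=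
    hx.comp (tendsto_atTop_mono (fun m => (by simp; omega : id m ≤ n + m * 2)) tendsto_id)
  simp only [h1] at h2
  exact tendsto_nhds_unique tendsto_const_nhds h2

theorem SqSum.tendsto_cofinite (x : SqSum ι) : Tendsto x cofinite (𝓝 0) := by
  have := x.summable.tendsto_cofinite_zero
  rw [tendsto_zero_iff_norm_tendsto_zero]
  have h := this.sqrt
  simpa using h

/-- A square-summable sequence `g` with `sin · g` constant vanishes. -/
theorem eq_zero_of_forall_ne_zero {g : SqSum ℤ} (h : ∀ k : ℤ, k ≠ 0 → g (k - 1) = g (k + 1))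
    (k : ℤ) : g k = 0 := by
  have hp : Tendsto (fun n : ℕ => g (n : ℤ)) atTop (𝓝 0) := by
    rw [← Nat.cofinite_eq_atTop]
    exact g.tendsto_cofinite.comp (Nat.cast_injective (R := ℤ)).tendsto_cofinite
  have hn : Tendsto (fun n : ℕ => g (-(n : ℤ))) atTop (𝓝 0) := by
    rw [← Nat.cofinite_eq_atTop]
    exact g.tendsto_cofinite.comp
      (neg_injective.comp (Nat.cast_injective (R := ℤ))).tendsto_cofinite
  -- The relation at k = 0, linking the indices -1 and 1, is not available. The two half-lines are
  -- therefore treated separately, each running to infinity without crossing it.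
  obtain ⟨n, rfl | rfl⟩ := k.eq_nat_or_neg
  · refine eq_zero_of_forall_add_two (fun n => ?_) hp n
    have := h (n + 1) (by omega)
    rw [add_sub_cancel_right] at this
    rw [this]
    push_cast
    congr 1
  · refine eq_zero_of_forall_add_two (x := fun n : ℕ => g (-(n : ℤ))) (fun n => ?_) hn n
    have := h (-(n + 1)) (by omega)
    have e1 : (-(n + 1) - 1 : ℤ) = -((n + 2 : ℕ) : ℤ) := by push_cast; ring
    have e2 : (-(n + 1) + 1 : ℤ) = -(n : ℤ) := by ring
    rwa [e1, e2] at this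

/-! ### Lattices of Fourier modes -/

/-- An index set of Fourier modes `e^{i(l x + k y)}` with `l ≠ 0`, closed under shifts of `k`. -/
structure ModeLattice (ι : Type*) where
  /-- The wave number in `x`. -/
  l : ι → ℤ
  /-- The wave number in `y`. -/
  k : ι → ℤ
  /-- The shift of `k` by one. -/
  shift : ι ≃ ι
  l_shift : ∀ i, l (shift i) = l i
  k_shift : ∀ i, k (shift i) = k i + 1
  l_ne : ∀ i, l i ≠ 0
  inj : ∀ i j, l i = l j → k i = k j → i = j

namespace ModeLattice

variable (M : ModeLattice ι)

/-- The symbol of `-Δ`. -/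
def a (i : ι) : ℝ := (M.k i : ℝ) ^ 2 + (M.l i : ℝ) ^ 2

/-- The symbol of `1 + Δ⁻¹`. -/
def b (i : ι) : ℝ := 1 - (M.a i)⁻¹

/-- The modes in the kernel of `1 + Δ⁻¹`. -/
def Bad (i : ι) : Prop := |M.l i| = 1 ∧ M.k i = 0

/-- The Fourier coefficients of `∂ₓ (sin y (1 + Δ⁻¹) f)`. -/
def conv (x : ι → ℂ) (i : ι) : ℂ :=
  (M.l i : ℂ) / 2 * ((M.b (M.shift.symm i) : ℂ) * x (M.shift.symm i) -
    (M.b (M.shift i) : ℂ) * x (M.shift i))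

theorem l_shift_symm (i : ι) : M.l (M.shift.symm i) = M.l i := by
  rw [← M.l_shift, Equiv.apply_symm_apply]

theorem k_shift_symm (i : ι) : M.k (M.shift.symm i) = M.k i - 1 := by
  have := M.k_shift (M.shift.symm i)
  rw [Equiv.apply_symm_apply] at this
  omega

theorem one_le_l_sq (i : ι) : (1 : ℝ) ≤ (M.l i : ℝ) ^ 2 := by
  have h : 0 < M.l i ^ 2 := by have := M.l_ne i; positivity
  exact_mod_cast h

theorem one_le_a (i : ι) : 1 ≤ M.a i := by
  have := M.one_le_l_sq i
  unfold a
  nlinarith [sq_nonneg (M.k i : ℝ)]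

theorem a_pos (i : ι) : 0 < M.a i := one_pos.trans_le (M.one_le_a i)

theorem b_nonneg (i : ι) : 0 ≤ M.b i := by
  have := inv_le_one_of_one_le₀ (M.one_le_a i)
  unfold b
  linarith

theorem b_le_one (i : ι) : M.b i ≤ 1 := by
  have := inv_nonneg.2 (M.a_pos i).le
  unfold b
  linarith

theorem a_eq_one_of_bad {i : ι} (h : M.Bad i) : M.a i = 1 := by
  have h1 : M.l i ^ 2 = 1 := by rw [← sq_abs, h.1]; rfl
  have h2 : (M.l i : ℝ) ^ 2 = 1 := by exact_mod_cast h1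
  unfold a
  rw [h2, h.2]
  simp

theorem b_eq_zero_of_bad {i : ι} (h : M.Bad i) : M.b i = 0 := by
  unfold b
  rw [M.a_eq_one_of_bad h]
  simp

/-- The spectral gap: since l ≠ 0, either |l| ≥ 2 or k also contributes at least one. -/
theorem two_le_a_of_not_bad {i : ι} (h : ¬ M.Bad i) : 2 ≤ M.a i := by
  have h1 : 2 ≤ M.k i ^ 2 + M.l i ^ 2 := by
    have hl : 1 ≤ |M.l i| := Int.one_le_abs (M.l_ne i)
    rw [← sq_abs (M.k i), ← sq_abs (M.l i)]
    by_cases h0 : M.k i = 0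
    · have : |M.l i| ≠ 1 := fun h' => h ⟨h', h0⟩
      have : 2 ≤ |M.l i| := by omega
      nlinarith [sq_nonneg |M.k i|]
    · have : 1 ≤ |M.k i| := Int.one_le_abs h0
      nlinarith
  unfold a
  exact_mod_cast h1

theorem half_le_b_of_not_bad {i : ι} (h : ¬ M.Bad i) : 1 / 2 ≤ M.b i := by
  have h1 := M.two_le_a_of_not_bad h
  have h2 : (M.a i)⁻¹ ≤ 2⁻¹ := inv_anti₀ (by norm_num) h1
  unfold b
  linarith

/-- A bounded box contains finitely many modes, because a mode is determined by (l, k). This is the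
source of compactness. -/
theorem tendsto_a : Tendsto M.a cofinite atTop := by
  refine tendsto_atTop.2 fun C => ?_
  obtain ⟨n, hn⟩ := exists_nat_gt C
  have hinj : Function.Injective fun i => (M.l i, M.k i) := fun i j h =>
    M.inj i j (congrArg Prod.fst h) (congrArg Prod.snd h)
  have hfin : ((fun i => (M.l i, M.k i)) ⁻¹'
      (Set.Icc (-(n : ℤ)) n ×ˢ Set.Icc (-(n : ℤ)) n)).Finite :=
    Set.Finite.preimage hinj.injOn ((Set.finite_Icc _ _).prod (Set.finite_Icc _ _))
  refine hfin.subset fun i hi => ?_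
  have hi₀ : ¬ C ≤ M.a i := hi
  have hi' : M.a i < n := (not_le.1 hi₀).trans hn
  have h2 : M.k i ^ 2 + M.l i ^ 2 < n := by unfold a at hi'; exact_mod_cast hi'
  have h3 : |M.k i| ≤ n := by nlinarith [sq_abs (M.k i), Int.le_self_sq |M.k i|, sq_nonneg (M.l i)]
  have h4 : |M.l i| ≤ n := by nlinarith [sq_abs (M.l i), Int.le_self_sq |M.l i|, sq_nonneg (M.k i)]
  exact ⟨abs_le.1 h4, abs_le.1 h3⟩

theorem conv_smul (c : ℂ) (x : ι → ℂ) (i : ι) : M.conv (fun i => c * x i) i = c * M.conv x i := by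
  unfold conv
  ring

/-- The mode with the same `l` as `i` and with `k = n`. -/
def fiber (i : ι) (n : ℤ) : ι := (M.shift ^ (n - M.k i)) i

theorem fiber_self (i : ι) : M.fiber i (M.k i) = i := by
  simp [fiber]

theorem shift_fiber (i : ι) (n : ℤ) : M.shift (M.fiber i n) = M.fiber i (n + 1) := by
  unfold fiber
  rw [← Equiv.Perm.mul_apply, ← zpow_one_add]
  congr 2
  ring

theorem shift_symm_fiber (i : ι) (n : ℤ) : M.shift.symm (M.fiber i n) = M.fiber i (n - 1) := by
  rw [Equiv.symm_apply_eq, shift_fiber, sub_add_cancel]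

theorem lk_zpow (n : ℤ) (i : ι) :
    M.l ((M.shift ^ n) i) = M.l i ∧ M.k ((M.shift ^ n) i) = M.k i + n := by
  induction n with
  | zero => simp
  | succ n ih =>
    rw [add_comm (n : ℤ) 1, zpow_one_add, Equiv.Perm.mul_apply, l_shift, k_shift, ih.1, ih.2]
    exact ⟨rfl, by ring⟩
  | pred n ih =>
    have h : (M.shift ^ (-(n : ℤ) - 1)) i = M.shift.symm ((M.shift ^ (-(n : ℤ))) i) := by
      rw [Equiv.eq_symm_apply, ← Equiv.Perm.mul_apply, ← zpow_one_add]
      congr 2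
      ring
    rw [h, l_shift_symm, k_shift_symm, ih.1, ih.2]
    exact ⟨rfl, by ring⟩

theorem l_fiber (i : ι) (n : ℤ) : M.l (M.fiber i n) = M.l i := (M.lk_zpow _ _).1

theorem k_fiber (i : ι) (n : ℤ) : M.k (M.fiber i n) = n := by
  rw [fiber, (M.lk_zpow _ _).2]
  ring

theorem fiber_injective (i : ι) : Function.Injective (M.fiber i) := fun m n h => by
  rw [← M.k_fiber i m, h, k_fiber]

/-- There is no function in `H¹`, orthogonal to the bad modes, that is an eigenfunction of the
transport part on the good modes. -/
theorem eq_zero_of_eigen {f : SqSum ι} (hf : Summable fun i => M.a i * ‖f i‖ ^ 2)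
    (hbad : ∀ i, M.Bad i → f i = 0) {ν : ℝ}
    (h : ∀ i, ¬ M.Bad i → Complex.I * ν * f i + M.conv f i = 0) : f = 0 := by
  refine SqSum.ext fun i => ?_
  rw [lp.coeFn_zero, Pi.zero_apply]
  by_cases hbi : M.Bad i
  · exact hbad i hbi
  have hl : (M.l i : ℂ) ≠ 0 := by exact_mod_cast M.l_ne i
  -- The transport term preserves l, so the problem splits into fibres, and each fibre has at most
  -- one bad mode, at k = 0.
  have hnb : ∀ n : ℤ, n ≠ 0 → ¬ M.Bad (M.fiber i n) := fun n hn hb =>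
    hn ((M.k_fiber i n).symm.trans hb.2)
  let F : SqSum ℤ := SqSum.mk (fun n => f (M.fiber i n)) (f.summable.comp_injective (M.fiber_injective i))
  have hb1 : ∀ n : ℤ, ‖(M.b (M.fiber i n) : ℂ)‖ ≤ 1 := fun n => by
    rw [Complex.norm_real, Real.norm_of_nonneg (M.b_nonneg _)]
    exact M.b_le_one _
  let g : SqSum ℤ := weightedShift (fun n => (M.b (M.fiber i n) : ℂ)) hb1 (Equiv.refl ℤ) F
  have hg : ∀ n, g n = (M.b (M.fiber i n) : ℂ) * f (M.fiber i n) := fun n => rfl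
  have hconv : ∀ n, M.conv f (M.fiber i n) = (M.l i : ℂ) / 2 * (g (n - 1) - g (n + 1)) := by
    intro n
    rw [conv, shift_fiber, shift_symm_fiber, l_fiber, hg, hg]
  rw [← M.fiber_self i] at hbi ⊢
  generalize M.k i = m at hbi
  -- For ν = 0 the equation says that sin · g has no coefficient except possibly the one at k = 0.
  by_cases hν : ν = 0
  · have hgz := eq_zero_of_forall_ne_zero (g := g) (fun n hn => by
      have := h _ (hnb n hn)
      rw [hconv, hν] at this
      simpa [hl, sub_eq_zero] using this)
    have := hgz m
    rw [hg] at this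
    refine (mul_eq_zero.1 this).resolve_left ?_
    have := M.half_le_b_of_not_bad hbi
    exact Complex.ofReal_ne_zero.2 (by linarith : 0 < M.b (M.fiber i m)).ne'
  · let μ : ℝ := -ν / M.l i
    have hl' : (M.l i : ℝ) ≠ 0 := by exact_mod_cast M.l_ne i
    have hμ : μ ≠ 0 := div_ne_zero (neg_ne_zero.2 hν) hl'
    have hμ' : (μ : ℂ) ≠ 0 := by exact_mod_cast hμ
    -- The equation for f may fail at the bad mode. E is chosen so that sin · g = μ E holds at every
    -- mode; it agrees with f on the good modes, and b annihilates the discrepancy, so g is also b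
    -- E.
    let E : SqSum ℤ := (μ : ℂ)⁻¹ • sinShift g
    have hE : ∀ n, ¬ M.Bad (M.fiber i n) → E n = f (M.fiber i n) := by
      intro n hn
      have h1 := h _ hn
      rw [hconv] at h1
      have h2 : E n = (μ : ℂ)⁻¹ * sinShift g n := rfl
      rw [h2, sinShift_apply, inv_mul_eq_iff_eq_mul₀ hμ']
      have hμe : (μ : ℂ) = -ν / M.l i := by simp [μ]
      rw [hμe]
      have h3 : g (n - 1) - g (n + 1) = -(2 / (M.l i : ℂ)) * (Complex.I * ν * f (M.fiber i n)) := by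
        field_simp
        linear_combination 2 * h1
      rw [h3]
      field_simp
    -- At n = 0, the only place where E and f may differ, the factor n vanishes. Hence E inherits
    -- the H¹ bound of f.
    have hE' : Summable fun n : ℤ => ‖Complex.I * n * E n‖ ^ 2 := by
      refine (hf.comp_injective (M.fiber_injective i)).of_nonneg_of_le (fun _ => by positivity)
        fun n => ?_
      by_cases hn : n = 0
      · simp only [hn, Int.cast_zero, mul_zero, zero_mul, norm_zero, Function.comp]
        simpa using mul_nonneg (M.a_pos (M.fiber i 0)).le (sq_nonneg ‖f (M.fiber i 0)‖)
      · rw [hE n (hnb n hn), norm_mul, mul_pow]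
        refine mul_le_mul_of_nonneg_right ?_ (by positivity)
        rw [norm_mul, Complex.norm_I, one_mul, Complex.norm_intCast, sq_abs]
        unfold a
        rw [k_fiber]
        nlinarith [sq_nonneg (M.l (M.fiber i n) : ℝ)]
    have hz : E = 0 := by
      refine eq_zero_of_sinShift_eq (M.l_ne i) hμ (f' := SqSum.mk _ hE') (g := g)
        (fun n => rfl) (fun n => ?_) ?_
      · have hbn : (1 - ((n : ℂ) ^ 2 + (M.l i : ℂ) ^ 2)⁻¹) = (M.b (M.fiber i n) : ℂ) := by
          unfold b a
          rw [k_fiber, l_fiber]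
          push_cast
          rfl
        rw [hbn, hg]
        by_cases hn : M.Bad (M.fiber i n)
        · rw [M.b_eq_zero_of_bad hn]; simp
        · rw [hE n hn]
      · simp only [E]
        rw [smul_smul, mul_inv_cancel₀ hμ', one_smul]
    rw [← hE m hbi, hz]
    rfl

end ModeLattice

/-! ### The energy form and the resolvent estimate -/

/-- A bounded operator with strictly positive real part is invertible. -/
theorem exists_inverse_of_coercive {H : Type*} [NormedAddCommGroup H] [InnerProductSpace ℂ H]
    [CompleteSpace H] (G : H →L[ℂ] H) {c : ℝ} (hc : 0 < c)
    (hG : ∀ v, c * ‖v‖ ^ 2 ≤ (inner ℂ v (G v)).re) :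
    ∃ K : H →L[ℂ] H, (∀ v, K (G v) = v) ∧ ∀ v, G (K v) = v := by
  have hbelow : ∀ v, c * ‖v‖ ≤ ‖G v‖ := by
    intro v
    rcases eq_or_ne v 0 with rfl | hv
    · simp
    · have h1 : 0 < ‖v‖ := norm_pos_iff.2 hv
      have h2 := (hG v).trans ((Complex.re_le_norm _).trans (norm_inner_le_norm v (G v)))
      nlinarith
  have hanti : AntilipschitzWith (c⁻¹).toNNReal G := by
    refine ContinuousLinearMap.antilipschitz_of_bound G fun v => ?_
    rw [Real.coe_toNNReal _ (inv_nonneg.2 hc.le), ← div_eq_inv_mul, le_div_iff₀ hc, mul_comm]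
    exact hbelow v
  have hker : G.ker = ⊥ := LinearMap.ker_eq_bot.2 hanti.injective
  have hclosed : IsClosed (G.range : Set H) := hanti.isClosed_range G.uniformContinuous
  have hrange : G.range = ⊤ := by
    have := hclosed.completeSpace_coe
    rw [← G.range.orthogonal_orthogonal, Submodule.eq_top_iff']
    -- A vector w orthogonal to the closed range satisfies ⟨w, G w⟩ = 0, and coercivity forces w =
    -- 0.
    intro v w hw
    have h1 : inner ℂ w (G w) = 0 := by
      rw [← inner_conj_symm, hw (G w) ⟨w, rfl⟩, map_zero]
    have h2 := hG w
    rw [h1, Complex.zero_re] at h2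
    have h3 : ‖w‖ ^ 2 ≤ 0 := by nlinarith [sq_nonneg ‖w‖]
    have h4 : w = 0 := by
      have : ‖w‖ = 0 := by nlinarith [norm_nonneg w]
      simpa using this
    rw [h4, inner_zero_left]
  let e := ContinuousLinearEquiv.ofBijective G hker hrange
  exact ⟨e.symm, fun v => e.symm_apply_apply v, fun v => e.apply_symm_apply v⟩

namespace ModeLattice

variable (M : ModeLattice ι)

open Classical in
/-- The indicator of the bad modes. -/
def p (i : ι) : ℝ := if M.Bad i then 1 else 0

theorem p_of_bad {i : ι} (h : M.Bad i) : M.p i = 1 := if_pos h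

theorem p_of_not_bad {i : ι} (h : ¬ M.Bad i) : M.p i = 0 := if_neg h

/-- The symbol of `(-Δ)^{-1/2}`. -/
def n (i : ι) : ℝ := (√(M.a i))⁻¹

/-- The symbol of `(-Δ)^{-1/2} (1 + Δ⁻¹)`. -/
def s (i : ι) : ℝ := M.n i * M.b i

theorem sqrt_a_pos (i : ι) : 0 < √(M.a i) := Real.sqrt_pos.2 (M.a_pos i)

theorem n_pos (i : ι) : 0 < M.n i := inv_pos.2 (M.sqrt_a_pos i)

theorem n_mul_sqrt (i : ι) : M.n i * √(M.a i) = 1 := inv_mul_cancel₀ (M.sqrt_a_pos i).ne'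

theorem n_le_one (i : ι) : M.n i ≤ 1 :=
  inv_le_one_of_one_le₀ (Real.one_le_sqrt.2 (M.one_le_a i))

theorem s_nonneg (i : ι) : 0 ≤ M.s i := mul_nonneg (M.n_pos i).le (M.b_nonneg i)

theorem s_le_one (i : ι) : M.s i ≤ 1 :=
  mul_le_one₀ (M.n_le_one i) (M.b_nonneg i) (M.b_le_one i)

/-- ∂ₓ(-Δ)^{-1/2} is bounded. This is what makes the first-order transport term a bounded operator
after conjugation. -/
theorem abs_l_mul_n_le (i : ι) : |(M.l i : ℝ)| * M.n i ≤ 1 := by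
  rw [n, ← div_eq_mul_inv, div_le_one (M.sqrt_a_pos i)]
  refine Real.abs_le_sqrt ?_
  unfold a
  nlinarith [sq_nonneg (M.k i : ℝ)]

theorem abs_l_mul_s_le (i : ι) : |(M.l i : ℝ)| * M.s i ≤ 1 := by
  rw [s, ← mul_assoc]
  exact mul_le_one₀ (M.abs_l_mul_n_le i) (M.b_nonneg i) (M.b_le_one i)

theorem norm_form_diag_le (lam : ℝ) (i : ι) :
    ‖(M.b i : ℂ) * (Complex.I * lam * (M.a i : ℂ)⁻¹ + 1) + M.p i‖ ≤ |lam| + 2 := by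
  have hb : ‖(M.b i : ℂ)‖ ≤ 1 := by
    rw [Complex.norm_real, Real.norm_of_nonneg (M.b_nonneg i)]; exact M.b_le_one i
  have hp : ‖(M.p i : ℂ)‖ ≤ 1 := by
    unfold p; split_ifs <;> simp
  have ha : ‖Complex.I * lam * (M.a i : ℂ)⁻¹‖ ≤ |lam| := by
    rw [norm_mul, norm_mul, norm_inv, Complex.norm_I, one_mul, Complex.norm_real, Complex.norm_real,
      Real.norm_eq_abs, Real.norm_of_nonneg (M.a_pos i).le]
    exact mul_le_of_le_one_right (abs_nonneg _) (inv_le_one_of_one_le₀ (M.one_le_a i))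
  calc _ ≤ ‖(M.b i : ℂ)‖ * (‖Complex.I * lam * (M.a i : ℂ)⁻¹‖ + ‖(1 : ℂ)‖) + ‖(M.p i : ℂ)‖ := by
        refine (norm_add_le _ _).trans (add_le_add_left ?_ _)
        rw [norm_mul]
        exact mul_le_mul_of_nonneg_left (norm_add_le _ _) (norm_nonneg _)
    _ ≤ 1 * (|lam| + 1) + 1 := by
        rw [norm_one]
        gcongr
    _ = |lam| + 2 := by ring

theorem norm_form_off_le (α : ℝ) (i j : ι) :
    ‖(α : ℂ) * (M.s i * (M.l i / 2 : ℂ) * M.s j)‖ ≤ |α| := by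
  rw [norm_mul, Complex.norm_real, Real.norm_eq_abs]
  refine mul_le_of_le_one_right (abs_nonneg _) ?_
  rw [norm_mul, norm_mul, norm_div, Complex.norm_real, Complex.norm_real, Complex.norm_intCast,
    Real.norm_of_nonneg (M.s_nonneg i), Real.norm_of_nonneg (M.s_nonneg j)]
  have h1 := M.abs_l_mul_s_le i
  have h2 := M.s_nonneg i
  have h3 : M.s i * (|(M.l i : ℝ)| / ‖(2 : ℂ)‖) ≤ 1 := by
    rw [Complex.norm_ofNat]
    nlinarith [mul_nonneg (abs_nonneg (M.l i : ℝ)) h2]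
  exact mul_le_one₀ h3 (M.s_nonneg j) (M.s_le_one j)

/-- The operator `(-Δ)^{-1/2} (1 + Δ⁻¹) (iλ - L_α) (-Δ)^{-1/2}`, supplemented by the identity on the
bad modes. -/
def form (α lam : ℝ) : SqSum ι →L[ℂ] SqSum ι :=
  weightedShift (fun i => (M.b i : ℂ) * (Complex.I * lam * (M.a i : ℂ)⁻¹ + 1) + M.p i)
      (M.norm_form_diag_le lam) (Equiv.refl ι) +
    (weightedShift (fun i => (α : ℂ) * (M.s i * (M.l i / 2 : ℂ) * M.s (M.shift.symm i)))
        (fun i => M.norm_form_off_le α i _) M.shift.symm -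
      weightedShift (fun i => (α : ℂ) * (M.s i * (M.l i / 2 : ℂ) * M.s (M.shift i)))
        (fun i => M.norm_form_off_le α i _) M.shift)

theorem form_apply (α lam : ℝ) (v : SqSum ι) (i : ι) :
    M.form α lam v i =
      ((M.b i : ℂ) * (Complex.I * lam * (M.a i : ℂ)⁻¹ + 1) + M.p i) * v i +
      ((α : ℂ) * (M.s i * (M.l i / 2 : ℂ) * M.s (M.shift.symm i)) * v (M.shift.symm i) -
        (α : ℂ) * (M.s i * (M.l i / 2 : ℂ) * M.s (M.shift i)) * v (M.shift i)) := rfl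

/-- Multiplying by b from the left makes the weight s_i (l/2) s_j symmetric in the two neighbours, l
being constant along the shift. The off-diagonal part of `form` is thus an operator minus its
adjoint, hence skew. -/
theorem inner_form_off (α : ℝ) (v : SqSum ι) :
    inner ℂ v (weightedShift (fun i => (α : ℂ) * (M.s i * (M.l i / 2 : ℂ) * M.s (M.shift i)))
        (fun i => M.norm_form_off_le α i _) M.shift v) =
      star (inner ℂ v
        (weightedShift (fun i => (α : ℂ) * (M.s i * (M.l i / 2 : ℂ) * M.s (M.shift.symm i)))
        (fun i => M.norm_form_off_le α i _) M.shift.symm v)) := by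
  rw [← starRingEnd_apply, inner_conj_symm, lp.inner_eq_tsum, lp.inner_eq_tsum,
    ← M.shift.tsum_eq (fun i => inner ℂ (weightedShift _ _ M.shift.symm v i) (v i))]
  refine tsum_congr fun i => ?_
  simp only [weightedShift_apply, RCLike.inner_apply, map_mul, Complex.conj_ofReal,
    Equiv.symm_apply_apply, M.l_shift, map_div₀, map_intCast, map_ofNat]
  ring

/-- The skew off-diagonal part and the term with iλ drop out of the real part. What remains is b +
p, which is at least 1/2 on good modes and equals 1 on bad ones. -/
theorem coercive_form (α lam : ℝ) (v : SqSum ι) :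
    1 / 2 * ‖v‖ ^ 2 ≤ (inner ℂ v (M.form α lam v)).re := by
  unfold form
  rw [_root_.add_apply, _root_.sub_apply, inner_add_right, inner_sub_right, inner_form_off,
    Complex.add_re, Complex.sub_re, Complex.star_def, Complex.conj_re, sub_self, add_zero,
    SqSum.norm_sq, ← tsum_mul_left]
  have h := lp.hasSum_inner (𝕜 := ℂ) v (weightedShift
    (fun i => (M.b i : ℂ) * (Complex.I * lam * (M.a i : ℂ)⁻¹ + 1) + M.p i)
      (M.norm_form_diag_le lam) (Equiv.refl ι) v)
  have h' := Complex.hasSum_re h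
  rw [← h'.tsum_eq]
  refine Summable.tsum_le_tsum (fun i => ?_) (v.summable.mul_left _) h'.summable
  have h1 : (inner ℂ (v i) ((weightedShift
      (fun i => (M.b i : ℂ) * (Complex.I * lam * (M.a i : ℂ)⁻¹ + 1) + M.p i)
      (M.norm_form_diag_le lam) (Equiv.refl ι) v) i)).re = (M.b i + M.p i) * ‖v i‖ ^ 2 := by
    have h2 : inner ℂ (v i) (((M.b i : ℂ) * (Complex.I * lam * (M.a i : ℂ)⁻¹ + 1) + M.p i) * v i) =
        ((M.b i : ℂ) * (Complex.I * lam * (M.a i : ℂ)⁻¹ + 1) + M.p i) * ((‖v i‖ ^ 2 : ℝ) : ℂ) := by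
      rw [← smul_eq_mul, inner_smul_right, inner_self_eq_norm_sq_to_K]
      simp
    rw [weightedShift_apply, Equiv.refl_apply, h2, Complex.re_mul_ofReal, ← Complex.ofReal_inv]
    simp
  rw [h1]
  refine mul_le_mul_of_nonneg_right ?_ (by positivity)
  by_cases hb : M.Bad i
  · rw [M.p_of_bad hb, M.b_eq_zero_of_bad hb]; norm_num
  · rw [M.p_of_not_bad hb, add_zero]; exact M.half_le_b_of_not_bad hb

/-- The equation `(iλ - L_α) f = h` on the good modes. -/
def Solves (α lam : ℝ) (f h : ι → ℂ) : Prop :=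
  ∀ i, ¬ M.Bad i → Complex.I * lam * f i + M.a i * f i + α * M.conv f i = h i

/-- In the H¹ variable v = √a f the bounded operator `form` is the original equation multiplied by
s, which is nonzero on good modes. -/
theorem form_of_not_bad (α lam : ℝ) {f : ι → ℂ} {v : SqSum ι} (hv : ∀ i, v i = √(M.a i) * f i)
    {i : ι} (hb : ¬ M.Bad i) :
    M.form α lam v i = M.s i * (Complex.I * lam * f i + M.a i * f i + α * M.conv f i) := by
  rw [form_apply]
  have hsv : ∀ j, (M.s j : ℂ) * v j = M.b j * f j := by
    intro j
    have h1 : M.s j * √(M.a j) = M.b j := by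
      rw [s, mul_right_comm, n_mul_sqrt, one_mul]
    rw [hv, ← mul_assoc]
    exact_mod_cast congrArg (fun t : ℝ => (t : ℂ) * f j) h1
  rw [M.p_of_not_bad hb, conv]
  have h1 : ((M.b i : ℂ) * (Complex.I * lam * (M.a i : ℂ)⁻¹ + 1) + (0 : ℝ)) * v i =
      M.s i * (Complex.I * lam * f i + M.a i * f i) := by
    have hr : (M.a i : ℂ) = (√(M.a i) : ℂ) ^ 2 := by
      rw [← Complex.ofReal_pow, Real.sq_sqrt (M.a_pos i).le]
    have hne : (√(M.a i) : ℂ) ≠ 0 := Complex.ofReal_ne_zero.2 (M.sqrt_a_pos i).ne'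
    rw [hv, s, n, hr]
    push_cast
    field_simp
    ring
  rw [h1]
  linear_combination (α : ℂ) * M.s i * (M.l i / 2) * (hsv (M.shift.symm i) - hsv (M.shift i))

/-- Data vanishing on the bad modes, such as s h, therefore force the solution to vanish there as
well. -/
theorem form_of_bad (α lam : ℝ) (v : SqSum ι) {i : ι} (hb : M.Bad i) : M.form α lam v i = v i := by
  have h0 : M.s i = 0 := by rw [s, M.b_eq_zero_of_bad hb, mul_zero]
  rw [form_apply, h0, M.b_eq_zero_of_bad hb, M.p_of_bad hb]
  simp

theorem form_of_solves {α lam : ℝ} {f h : ι → ℂ} {v : SqSum ι} (hv : ∀ i, v i = √(M.a i) * f i)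
    (hbad : ∀ i, M.Bad i → f i = 0) (hs : M.Solves α lam f h) (i : ι) :
    M.form α lam v i = M.s i * h i := by
  by_cases hb : M.Bad i
  · rw [M.form_of_bad α lam v hb, hv, hbad i hb, s, M.b_eq_zero_of_bad hb]
    simp
  · rw [M.form_of_not_bad α lam hv hb, hs i hb]

/-- The weights in v = √a f and in s h combine so that ⟨v, `form` v⟩ = ⟨f, b h⟩; coercivity then
bounds the H¹ norm uniformly in α and λ. -/
theorem energy {α lam : ℝ} {f h v : SqSum ι} (hv : ∀ i, v i = √(M.a i) * f i)
    (hbad : ∀ i, M.Bad i → f i = 0) (hs : M.Solves α lam f h) :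
    ‖v‖ ^ 2 ≤ 2 * (‖f‖ * ‖h‖) := by
  have hb1 : ∀ i, ‖(M.b i : ℂ)‖ ≤ 1 := fun i => by
    rw [Complex.norm_real, Real.norm_of_nonneg (M.b_nonneg i)]; exact M.b_le_one i
  have h1 : inner ℂ v (M.form α lam v) =
      inner ℂ f (weightedShift (fun i => (M.b i : ℂ)) hb1 (Equiv.refl ι) h) := by
    rw [lp.inner_eq_tsum, lp.inner_eq_tsum]
    refine tsum_congr fun i => ?_
    rw [M.form_of_solves hv hbad hs, hv, weightedShift_apply, Equiv.refl_apply]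
    have h2 : (√(M.a i) : ℂ) * M.s i = M.b i := by
      have : √(M.a i) * M.s i = M.b i := by
        rw [s, ← mul_assoc, mul_comm (√(M.a i)), n_mul_sqrt, one_mul]
      exact_mod_cast this
    rw [← h2]
    simp only [RCLike.inner_apply, map_mul, Complex.conj_ofReal]
    ring
  have h2 := M.coercive_form α lam v
  rw [h1] at h2
  have h3 := (Complex.re_le_norm _).trans (norm_inner_le_norm (𝕜 := ℂ) f
    (weightedShift (fun i => (M.b i : ℂ)) hb1 (Equiv.refl ι) h))
  have h4 := ((weightedShift (fun i => (M.b i : ℂ)) hb1 (Equiv.refl ι)).le_opNorm h).trans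
    (mul_le_mul_of_nonneg_right (norm_weightedShift_le _ zero_le_one hb1 _) (norm_nonneg h))
  have h5 := mul_le_mul_of_nonneg_left h4 (norm_nonneg f)
  linarith

/-! ### The compactness argument and the bound uniform in λ. -/

theorem summable_sqrt_a_mul {f : SqSum ι} (hf : Summable fun i => ‖(M.a i : ℂ) * f i‖ ^ 2) :
    Summable fun i => ‖(√(M.a i) : ℂ) * f i‖ ^ 2 := by
  refine summable_sq_of_le hf fun i => ?_
  rw [norm_mul, norm_mul]
  refine mul_le_mul_of_nonneg_right ?_ (norm_nonneg _)
  rw [Complex.norm_real, Complex.norm_real, Real.norm_of_nonneg (M.sqrt_a_pos i).le,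
    Real.norm_of_nonneg (M.a_pos i).le, Real.sqrt_le_left (M.a_pos i).le]
  nlinarith [M.one_le_a i]

theorem norm_n_le (i : ι) : ‖(M.n i : ℂ)‖ ≤ 1 := by
  rw [Complex.norm_real, Real.norm_of_nonneg (M.n_pos i).le]
  exact M.n_le_one i

/-- The operator `(-Δ)^{-1/2}`. -/
def invSqrt : SqSum ι →L[ℂ] SqSum ι :=
  weightedShift (fun i => (M.n i : ℂ)) M.norm_n_le (Equiv.refl ι)

theorem invSqrt_apply (v : SqSum ι) (i : ι) : M.invSqrt v i = M.n i * v i := rfl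

theorem isCompactOperator_invSqrt : IsCompactOperator M.invSqrt := by
  refine isCompactOperator_diagonal _ _ ?_
  have h1 : Tendsto M.n cofinite (𝓝 0) :=
    tendsto_inv_atTop_zero.comp (Real.tendsto_sqrt_atTop.comp M.tendsto_a)
  have h2 := (Complex.continuous_ofReal.tendsto 0).comp h1
  rwa [Complex.ofReal_zero] at h2

/-- A normalized solution sequence with `|α| → ∞` and bounded data cannot exist. -/
theorem not_exists_bounded_sequence {α lam : ℕ → ℝ} {f h v : ℕ → SqSum ι} {C : ℝ}
    (hα : Tendsto (fun n => |α n|) atTop atTop) (hf : ∀ n, ‖f n‖ = 1) (hh : ∀ n, ‖h n‖ ≤ C)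
    (hv : ∀ n i, v n i = √(M.a i) * f n i) (hbad : ∀ n i, M.Bad i → f n i = 0)
    (hs : ∀ n, M.Solves (α n) (lam n) (f n) (h n)) : False := by
  have hC : 0 ≤ C := (norm_nonneg _).trans (hh 0)
  have hvb : ∀ n, ‖v n‖ ^ 2 ≤ 2 * C := fun n => by
    have := M.energy (hv n) (hbad n) (hs n)
    rw [hf n, one_mul] at this
    linarith [hh n]
  -- Rellich: f = (-Δ)^{-1/2} v with v bounded, so all f n lie in one compact set.
  obtain ⟨K, hK, hsub⟩ := M.isCompactOperator_invSqrt.image_closedBall_subset_compact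
    (f := (M.invSqrt : SqSum ι →ₗ[ℂ] SqSum ι)) (√(2 * C))
  have hmem : ∀ n, f n ∈ K := fun n => hsub ⟨v n, by
    rw [mem_closedBall_zero_iff]
    exact Real.le_sqrt_of_sq_le (hvb n), SqSum.ext fun i => by
      change M.invSqrt (v n) i = _
      rw [invSqrt_apply, hv, ← mul_assoc]
      have := M.n_mul_sqrt i
      rw [← Complex.ofReal_mul, this, Complex.ofReal_one, one_mul]⟩
  obtain ⟨F, -, φ, hφ, hlim⟩ := hK.tendsto_subseq hmem
  have hF : ‖F‖ = 1 := by
    refine tendsto_nhds_unique hlim.norm ?_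
    simp [hf]
  have hpt : ∀ i, Tendsto (fun n => (f (φ n) i : ℂ)) atTop (𝓝 (F i : ℂ)) := fun i =>
    ((lp.evalCLM ℂ (fun _ : ι => ℂ) 2 i).continuous.tendsto F).comp hlim
  have hFbad : ∀ i, M.Bad i → F i = 0 := fun i hi => by
    refine tendsto_nhds_unique (hpt i) ?_
    simp [hbad _ i hi]
  have hFsum : Summable fun i => M.a i * ‖F i‖ ^ 2 := by
    -- Fatou's argument: finite partial sums pass to the limit mode by mode and keep the bound 2C.
    refine summable_of_sum_le (c := 2 * C)
      (fun i => mul_nonneg (M.a_pos i).le (sq_nonneg _)) fun u => ?_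
    have ht : Tendsto (fun n => ∑ i ∈ u, M.a i * ‖f (φ n) i‖ ^ 2) atTop
        (𝓝 (∑ i ∈ u, M.a i * ‖F i‖ ^ 2)) :=
      tendsto_finsetSum _ fun i _ => ((hpt i).norm.pow 2).const_mul _
    refine le_of_tendsto' ht fun n => ?_
    have h1 : ∀ i, M.a i * ‖f (φ n) i‖ ^ 2 = ‖v (φ n) i‖ ^ 2 := fun i => by
      rw [hv, norm_mul, mul_pow, Complex.norm_real, Real.norm_of_nonneg (M.sqrt_a_pos i).le,
        Real.sq_sqrt (M.a_pos i).le]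
    simp only [h1]
    refine ((v (φ n)).summable.sum_le_tsum u fun i _ => sq_nonneg _).trans ?_
    rw [← SqSum.norm_sq]
    exact hvb _
  have hconv : ∀ i, Tendsto (fun n => M.conv (f (φ n)) i) atTop (𝓝 (M.conv F i)) := fun i =>
    Tendsto.const_mul _ (Tendsto.sub (G := ℂ) ((hpt _).const_mul _) ((hpt _).const_mul _))
  have hα0 : Tendsto (fun n => ((α (φ n) : ℂ))⁻¹) atTop (𝓝 0) := by
    rw [tendsto_zero_iff_norm_tendsto_zero]
    simp only [norm_inv, Complex.norm_real, Real.norm_eq_abs]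
    exact tendsto_inv_atTop_zero.comp (hα.comp hφ.tendsto_atTop)
  have hαne : ∀ᶠ n in atTop, (α (φ n) : ℂ) ≠ 0 := by
    filter_upwards [(hα.comp hφ.tendsto_atTop).eventually_gt_atTop 0] with n hn
    exact Complex.ofReal_ne_zero.2 (abs_pos.1 hn)
  -- Divided by α, the data and the diffusion tend to zero at each fixed mode, and only the
  -- transport balance survives.
  have hres : ∀ i, ¬ M.Bad i → Tendsto (fun n => Complex.I * ((lam (φ n) / α (φ n) : ℝ) : ℂ) *
      f (φ n) i) atTop (𝓝 (-M.conv F i)) := by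
    intro i hi
    have hb : Tendsto (fun n => (α (φ n) : ℂ)⁻¹ * h (φ n) i) atTop (𝓝 0) := by
      refine hα0.zero_mul_isBoundedUnder_le ⟨C, ?_⟩
      rw [eventually_map]
      exact Eventually.of_forall fun n =>
        (lp.norm_apply_le_norm (by simp) (h (φ n)) i).trans (hh _)
    have hc : Tendsto (fun n => (α (φ n) : ℂ)⁻¹ * (M.a i * f (φ n) i)) atTop (𝓝 0) := by
      simpa using hα0.mul ((hpt i).const_mul (M.a i : ℂ))
    have hd := (hb.sub hc).sub (hconv i)
    rw [sub_zero, zero_sub] at hd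
    refine hd.congr' ?_
    filter_upwards [hαne] with n hn
    rw [← hs (φ n) i hi]
    push_cast
    field_simp
    ring
  obtain ⟨i₀, hi₀⟩ : ∃ i, F i ≠ 0 := by
    by_contra hcon
    push Not at hcon
    rw [(SqSum.ext hcon : F = 0), norm_zero] at hF
    exact zero_ne_one hF
  have hi₀b : ¬ M.Bad i₀ := fun hb => hi₀ (hFbad _ hb)
  -- λ/α is not assumed bounded; its convergence is read off from one good mode on which F is
  -- nonzero.
  have hν : Tendsto (fun n => ((lam (φ n) / α (φ n) : ℝ) : ℂ)) atTop
      (𝓝 (-M.conv F i₀ / (Complex.I * F i₀))) := by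
    have h1 := (hres i₀ hi₀b).div ((hpt i₀).const_mul Complex.I)
      (mul_ne_zero Complex.I_ne_zero hi₀)
    refine h1.congr' ?_
    filter_upwards [(hpt i₀).eventually_ne hi₀] with n hn
    have := Complex.I_ne_zero
    rw [Pi.div_apply]
    field_simp
  -- The limit is so far only a complex number. Taking real parts of the real ratios exhibits it as
  -- real, as `eq_zero_of_eigen` requires.
  have hν' := (Complex.continuous_re.tendsto _).comp hν
  have hν'' := (Complex.continuous_ofReal.tendsto _).comp hν'
  have hzero := M.eq_zero_of_eigen hFsum hFbad
    (ν := (-M.conv F i₀ / (Complex.I * F i₀)).re) (fun i hi => by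
      have h1 := (hν''.const_mul Complex.I).mul (hpt i)
      have h2 := tendsto_nhds_unique h1 (hres i hi)
      rw [h2]
      ring)
  rw [hzero, norm_zero] at hF
  exact zero_ne_one hF

/-- Solutions are small relative to the data for large `|α|`, uniformly in `λ`. -/
theorem exists_norm_le {ε : ℝ} (hε : 0 < ε) : ∃ A : ℝ, ∀ α : ℝ, A ≤ |α| → ∀ (lam : ℝ)
    (f h : SqSum ι), (Summable fun i => ‖(M.a i : ℂ) * f i‖ ^ 2) → (∀ i, M.Bad i → f i = 0) →
    M.Solves α lam f h → ‖f‖ ≤ ε * ‖h‖ := by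
  by_contra hcon
  push Not at hcon
  choose α hα lam f h hsum hbad hs hlt using fun n : ℕ => hcon n
  have hpos : ∀ n, 0 < ‖f n‖ := fun n =>
    (mul_nonneg hε.le (norm_nonneg _)).trans_lt (hlt n)
  -- Failure of the estimate gives ε ‖h‖ < ‖f‖, so after dividing by ‖f‖ the data are bounded by 1 /
  -- ε.
  refine M.not_exists_bounded_sequence (α := α) (lam := lam) (C := 1 / ε)
    (f := fun n => ((‖f n‖ : ℂ))⁻¹ • f n) (h := fun n => ((‖f n‖ : ℂ))⁻¹ • h n)
    (v := fun n => ((‖f n‖ : ℂ))⁻¹ • SqSum.mk _ (M.summable_sqrt_a_mul (hsum n)))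
    (tendsto_atTop_mono hα tendsto_natCast_atTop_atTop) (fun n => ?_) (fun n => ?_)
    (fun n i => ?_) (fun n i hi => ?_) (fun n i hi => ?_)
  · rw [norm_smul, norm_inv, Complex.norm_real, norm_norm, inv_mul_cancel₀ (hpos n).ne']
  · rw [norm_smul, norm_inv, Complex.norm_real, norm_norm, inv_mul_le_iff₀ (hpos n),
      mul_one_div, le_div_iff₀ hε, mul_comm]
    exact (hlt n).le
  · simp only [lp.coeFn_smul, Pi.smul_apply, SqSum.mk_apply, smul_eq_mul]
    ring
  · simp only [lp.coeFn_smul, Pi.smul_apply, hbad n i hi, smul_zero]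
  · have h1 := hs n i hi
    have h2 : M.conv (((‖f n‖ : ℂ))⁻¹ • f n : SqSum ι) i = ((‖f n‖ : ℂ))⁻¹ * M.conv (f n) i :=
      M.conv_smul _ _ _
    rw [h2]
    simp only [lp.coeFn_smul, Pi.smul_apply, smul_eq_mul]
    rw [← h1]
    ring

end ModeLattice

namespace ModeLattice

variable (M : ModeLattice ι)

/-! ### Construction of the resolvents on sequences -/

/-- One derivative is lost: written in terms of v = √a f, the transport term has the bounded weights
l s / 2. -/
theorem summable_conv {f : ι → ℂ} {v : SqSum ι} (hv : ∀ i, v i = √(M.a i) * f i) :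
    Summable fun i => ‖M.conv f i‖ ^ 2 := by
  have hbd : ∀ i j, M.l j = M.l i → ‖(M.l i : ℂ) / 2 * (M.s j : ℂ)‖ ≤ 1 := by
    intro i j hl
    rw [norm_mul, norm_div, Complex.norm_intCast, Complex.norm_ofNat, Complex.norm_real,
      Real.norm_of_nonneg (M.s_nonneg j), ← hl]
    have := M.abs_l_mul_s_le j
    nlinarith [mul_nonneg (abs_nonneg (M.l j : ℝ)) (M.s_nonneg j)]
  have h := summable_sq_sub
    (summable_weightedShift (fun i => hbd i (M.shift.symm i) (M.l_shift_symm i)) M.shift.symm v)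
    (summable_weightedShift (fun i => hbd i (M.shift i) (M.l_shift i)) M.shift v)
  refine h.congr fun i => ?_
  have hsv : ∀ j, (M.s j : ℂ) * v j = M.b j * f j := by
    intro j
    have h1 : M.s j * √(M.a j) = M.b j := by
      rw [s, mul_right_comm, n_mul_sqrt, one_mul]
    rw [hv, ← mul_assoc]
    exact_mod_cast congrArg (fun t : ℝ => (t : ℂ) * f j) h1
  congr 2
  rw [mul_assoc, mul_assoc, hsv, hsv, conv]
  ring

theorem norm_s_le (i : ι) : ‖(M.s i : ℂ)‖ ≤ 1 := by
  rw [Complex.norm_real, Real.norm_of_nonneg (M.s_nonneg i)]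
  exact M.s_le_one i

theorem s_ne_zero {i : ι} (h : ¬ M.Bad i) : (M.s i : ℂ) ≠ 0 := by
  have := M.half_le_b_of_not_bad h
  exact Complex.ofReal_ne_zero.2 (mul_pos (M.n_pos i) (by linarith)).ne'

/-- The solution operator on the good modes. -/
theorem exists_good_resolvent (α lam : ℝ) : ∃ R : SqSum ι →L[ℂ] SqSum ι,
    (∀ h, (Summable fun i => ‖(M.a i : ℂ) * R h i‖ ^ 2) ∧ (∀ i, M.Bad i → R h i = 0) ∧
      M.Solves α lam (R h) h) ∧
    ∀ f h : SqSum ι, (Summable fun i => ‖(M.a i : ℂ) * f i‖ ^ 2) → (∀ i, M.Bad i → f i = 0) →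
      M.Solves α lam f h → R h = f := by
  obtain ⟨K, hK₁, hK₂⟩ := exists_inverse_of_coercive (M.form α lam) (by norm_num)
    (M.coercive_form α lam)
  let S := weightedShift (fun i => (M.s i : ℂ)) M.norm_s_le (Equiv.refl ι)
  have hS : ∀ h i, S h i = M.s i * h i := fun _ _ => rfl
  -- The equation is `form` v = s h with f = (-Δ)^{-1/2} v, so the inverse K of `form` is sandwiched
  -- between the two weights.
  refine ⟨M.invSqrt ∘L K ∘L S, fun h => ?_, fun f h hf hbad hs => ?_⟩
  · set v := K (S h) with hvdef
    change (Summable fun i => ‖(M.a i : ℂ) * M.invSqrt v i‖ ^ 2) ∧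
      (∀ i, M.Bad i → M.invSqrt v i = 0) ∧ M.Solves α lam (M.invSqrt v) h
    have hv : ∀ i, v i = √(M.a i) * M.invSqrt v i := fun i => by
      rw [invSqrt_apply, ← mul_assoc, ← Complex.ofReal_mul, mul_comm, mul_comm (√(M.a i)),
        n_mul_sqrt, Complex.ofReal_one, mul_one]
    have hfv : ∀ i, M.form α lam v i = M.s i * h i := fun i => by
      rw [hvdef, hK₂, hS]
    have hbad : ∀ i, M.Bad i → M.invSqrt v i = 0 := fun i hi => by
      have h1 := hfv i
      rw [M.form_of_bad α lam v hi, s, M.b_eq_zero_of_bad hi] at h1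
      rw [invSqrt_apply, h1]
      simp
    have hsol : M.Solves α lam (M.invSqrt v) h := fun i hi => by
      have h1 := hfv i
      rw [M.form_of_not_bad α lam hv hi] at h1
      exact mul_left_cancel₀ (M.s_ne_zero hi) h1
    refine ⟨?_, hbad, hsol⟩
    -- Regularity from the equation itself: on good modes a f = h - iλ f - α `conv` f, and each term
    -- on the right is square-summable.
    refine summable_sq_of_le (summable_sq_sub (summable_sq_sub h.summable
      (summable_sq_const_mul (Complex.I * lam) (M.invSqrt v).summable))
      (summable_sq_const_mul (α : ℂ) (M.summable_conv hv))) fun i => ?_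
    by_cases hi : M.Bad i
    · rw [hbad i hi]
      simp
    · rw [← hsol i hi]
      refine le_of_eq ?_
      congr 1
      ring
  · have hv : ∀ i, SqSum.mk _ (M.summable_sqrt_a_mul hf) i = √(M.a i) * f i := fun i => rfl
    have h1 : S h = M.form α lam (SqSum.mk _ (M.summable_sqrt_a_mul hf)) := SqSum.ext fun i => by
      rw [hS, M.form_of_solves hv hbad hs]
    change M.invSqrt (K (S h)) = f
    rw [h1, hK₁]
    refine SqSum.ext fun i => ?_
    rw [invSqrt_apply, hv, ← mul_assoc, ← Complex.ofReal_mul, n_mul_sqrt, Complex.ofReal_one,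
      one_mul]

/-! ### Adding the bad modes: a triangular system. -/

theorem conv_congr {f g : ι → ℂ} (h : ∀ i, ¬ M.Bad i → f i = g i) (i : ι) :
    M.conv f i = M.conv g i := by
  have h1 : ∀ j, (M.b j : ℂ) * f j = M.b j * g j := fun j => by
    by_cases hj : M.Bad j
    · rw [M.b_eq_zero_of_bad hj]; simp
    · rw [h j hj]
  rw [conv, conv, h1, h1]

/-- Bad modes have |l| = 1, so the coupling from good to bad modes is bounded even without a
derivative to spare. -/
theorem norm_bad_le (i j : ι) : ‖(M.p i : ℂ) * ((M.l i : ℂ) / 2) * M.b j‖ ≤ 1 := by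
  rw [norm_mul, Complex.norm_real, Real.norm_of_nonneg (M.b_nonneg j)]
  refine mul_le_one₀ ?_ (M.b_nonneg j) (M.b_le_one j)
  by_cases hi : M.Bad i
  · have h1 : |(M.l i : ℝ)| = 1 := by exact_mod_cast hi.1
    rw [M.p_of_bad hi, norm_mul, norm_div, Complex.norm_intCast, h1]
    norm_num
  · rw [M.p_of_not_bad hi]
    simp

/-- The solution operator on all modes. -/
theorem exists_full_resolvent (α lam : ℝ) : ∃ R : SqSum ι →L[ℂ] SqSum ι,
    (∀ h, (Summable fun i => ‖(M.a i : ℂ) * R h i‖ ^ 2) ∧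
      ∀ i, Complex.I * lam * R h i + M.a i * R h i + α * M.conv (R h) i = h i) ∧
    ∀ f h : SqSum ι, (Summable fun i => ‖(M.a i : ℂ) * f i‖ ^ 2) →
      (∀ i, Complex.I * lam * f i + M.a i * f i + α * M.conv f i = h i) → R h = f := by
  obtain ⟨R, hR₁, hR₂⟩ := M.exists_good_resolvent α lam
  let P := weightedShift (fun i => (M.p i : ℂ)) (C := 1)
    (fun i => by unfold p; split_ifs <;> simp) (Equiv.refl ι)
  let V := weightedShift _ (fun i => M.norm_bad_le i (M.shift.symm i)) M.shift.symm -
    weightedShift _ (fun i => M.norm_bad_le i (M.shift i)) M.shift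
  have hP : ∀ h i, P h i = M.p i * h i := fun _ _ => rfl
  have hV : ∀ h i, V h i = M.p i * M.conv h i := fun h i => by
    have : V h i = (M.p i : ℂ) * ((M.l i : ℂ) / 2) * M.b (M.shift.symm i) * h (M.shift.symm i) -
      (M.p i : ℂ) * ((M.l i : ℂ) / 2) * M.b (M.shift i) * h (M.shift i) := rfl
    rw [this, conv]
    ring
  have hz : Complex.I * (lam : ℂ) + 1 ≠ 0 := fun h0 => by
    have := congrArg Complex.re h0
    simp at this
  -- On a bad mode a = 1, and the equation is (iλ + 1) f = h - α `conv` f, whose right side depends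
  -- only on the good part R h already found.
  let D : SqSum ι →L[ℂ] SqSum ι := (Complex.I * (lam : ℂ) + 1)⁻¹ • (P - (α : ℂ) • (V ∘L R))
  have hD : ∀ h i, D h i =
      (Complex.I * (lam : ℂ) + 1)⁻¹ * (M.p i * (h i - α * M.conv (R h) i)) := fun h i => by
    have : D h i = (Complex.I * (lam : ℂ) + 1)⁻¹ * (P h i - α * V (R h) i) := rfl
    rw [this, hP, hV]
    ring
  have hDgood : ∀ h i, ¬ M.Bad i → D h i = 0 := fun h i hi => by
    rw [hD, M.p_of_not_bad hi]; simp
  have hadd : ∀ h i, (R + D) h i = R h i + D h i := fun _ _ => rfl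
  have hgood : ∀ h i, ¬ M.Bad i → (R + D) h i = R h i := fun h i hi => by
    rw [hadd, hDgood h i hi, add_zero]
  refine ⟨R + D, fun h => ⟨?_, fun i => ?_⟩, fun f h hf heq => ?_⟩
  · refine (summable_sq_add (hR₁ h).1 (D h).summable).congr fun i => ?_
    rw [hadd]
    by_cases hi : M.Bad i
    · rw [M.a_eq_one_of_bad hi]; simp
    · rw [hDgood h i hi]; simp
  · rw [M.conv_congr (hgood h) i]
    by_cases hi : M.Bad i
    · rw [hadd, (hR₁ h).2.1 i hi, hD, M.a_eq_one_of_bad hi, M.p_of_bad hi]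
      push_cast
      field_simp
      ring
    · rw [hgood h i hi]
      exact (hR₁ h).2.2 i hi
  -- Uniqueness: the good part of f solves the closed good system, and the bad equations then
  -- determine the rest.
  · let f₀ : SqSum ι := f - P f
    have hf₀ : ∀ i, f₀ i = f i - M.p i * f i := fun _ => rfl
    have hf₀good : ∀ i, ¬ M.Bad i → f₀ i = f i := fun i hi => by
      rw [hf₀, M.p_of_not_bad hi]; simp
    have hf₀bad : ∀ i, M.Bad i → f₀ i = 0 := fun i hi => by
      rw [hf₀, M.p_of_bad hi]; simp
    have hRf : R h = f₀ := by
      refine hR₂ f₀ h (summable_sq_of_le hf fun i => ?_) hf₀bad fun i hi => ?_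
      · by_cases hi : M.Bad i
        · rw [hf₀bad i hi, mul_zero, norm_zero]; exact norm_nonneg _
        · rw [hf₀good i hi]
      · rw [hf₀good i hi, M.conv_congr hf₀good]
        exact heq i
    refine SqSum.ext fun i => ?_
    by_cases hi : M.Bad i
    · have h1 := heq i
      rw [hadd, hD, hRf, M.conv_congr hf₀good, hf₀bad i hi, M.p_of_bad hi, ← h1,
        M.a_eq_one_of_bad hi]
      push_cast
      field_simp
      ring
    · rw [hgood h i hi, hRf, hf₀good i hi]

end ModeLattice

/-! ### From sequences to operators in a Hilbert space -/

theorem opResolvent_spec {E : Type*} [NormedAddCommGroup E] [NormedSpace ℂ E]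
    {T : E →ₗ.[ℂ] E} {z : ℂ} (h : z ∈ opResolventSet T) : IsResolvent T z (opResolvent T z) := by
  have h' : ∃ R : E →L[ℂ] E, IsResolvent T z R := h
  unfold opResolvent
  rw [dif_pos h']
  exact h'.choose_spec

section Abstract

variable {H : Type*} [NormedAddCommGroup H] [InnerProductSpace ℂ H]

/-- The operator `T` acts on Fourier coefficients as `L_α`. -/
def Represents (M : ModeLattice ι) (B : HilbertBasis ι ℂ H) (α : ℝ) (T : H →ₗ.[ℂ] H) : Prop :=
  ∀ f g : H, (f, g) ∈ T.graph ↔ (Summable fun i => ‖(M.a i : ℂ) * B.repr f i‖ ^ 2) ∧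
    ∀ i, B.repr g i = -(M.a i * B.repr f i) - α * M.conv (B.repr f) i

variable {M : ModeLattice ι} {B : HilbertBasis ι ℂ H} {α : ℝ} {T : H →ₗ.[ℂ] H}

theorem repr_ext (B : HilbertBasis ι ℂ H) {f g : H} (h : ∀ i, B.repr f i = B.repr g i) : f = g :=
  B.repr.injective (SqSum.ext h)

theorem Represents.summable (hT : Represents M B α T) (u : T.domain) :
    Summable fun i => ‖(M.a i : ℂ) * B.repr (u : H) i‖ ^ 2 :=
  ((hT u (T u)).1 (T.mem_graph u)).1

theorem Represents.repr_apply (hT : Represents M B α T) (u : T.domain) (i : ι) :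
    B.repr (T u) i = -(M.a i * B.repr (u : H) i) - α * M.conv (B.repr (u : H)) i :=
  ((hT u (T u)).1 (T.mem_graph u)).2 i

/-- Square-summability of a f already makes `conv` f square-summable, so the prescribed value of T f
exists in H. -/
theorem Represents.mem_domain (hT : Represents M B α T) {f : H}
    (hf : Summable fun i => ‖(M.a i : ℂ) * B.repr f i‖ ^ 2) : f ∈ T.domain := by
  let w : SqSum ι := -SqSum.mk _ hf - (α : ℂ) •
    SqSum.mk _ (M.summable_conv (v := SqSum.mk _ (M.summable_sqrt_a_mul hf)) fun i => rfl)
  refine LinearPMap.mem_domain_iff.2 ⟨B.repr.symm w, (hT _ _).2 ⟨hf, fun i => ?_⟩⟩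
  rw [LinearIsometryEquiv.apply_symm_apply]
  rfl

theorem repr_sub_apply (B : HilbertBasis ι ℂ H) (f g : H) (i : ι) :
    B.repr (f - g) i = B.repr f i - B.repr g i := by
  rw [map_sub]; rfl

theorem repr_smul_apply (B : HilbertBasis ι ℂ H) (c : ℂ) (f : H) (i : ι) :
    B.repr (c • f) i = c * B.repr f i := by
  rw [map_smul]; rfl

theorem Represents.mem_resolventSet (hT : Represents M B α T) (lam : ℝ) :
    Complex.I * (lam : ℂ) ∈ opResolventSet T := by
  obtain ⟨R, hR₁, hR₂⟩ := M.exists_full_resolvent α lam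
  let R' : H →L[ℂ] H := (B.repr.symm.toContinuousLinearEquiv : SqSum ι →L[ℂ] H) ∘L R ∘L
    (B.repr.toContinuousLinearEquiv : H →L[ℂ] SqSum ι)
  have hR' : ∀ f, B.repr (R' f) = R (B.repr f) := fun f => B.repr.apply_symm_apply _
  refine ⟨R', fun f => ?_, fun u => ?_⟩
  · have hd : R' f ∈ T.domain := hT.mem_domain (by rw [hR']; exact (hR₁ _).1)
    refine ⟨hd, repr_ext B fun i => ?_⟩
    rw [repr_sub_apply, repr_smul_apply, hT.repr_apply, hR', ← (hR₁ (B.repr f)).2 i]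
    ring
  · refine B.repr.injective ?_
    rw [hR']
    refine hR₂ _ _ (hT.summable u) fun i => ?_
    rw [repr_sub_apply, repr_smul_apply, hT.repr_apply]
    ring

variable {Y : Submodule ℂ H} [Y.HasOrthogonalProjection]

/-- `Y` is the closed span of the good modes. -/
def IsGoodSpace (M : ModeLattice ι) (B : HilbertBasis ι ℂ H) (Y : Submodule ℂ H) : Prop :=
  ∀ f : H, f ∈ Y ↔ ∀ i, M.Bad i → B.repr f i = 0

theorem IsGoodSpace.repr_starProjection_of_bad (hY : IsGoodSpace M B Y) (f : H) {i : ι}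
    (hi : M.Bad i) : B.repr (Y.starProjection f) i = 0 :=
  (hY _).1 (Y.starProjection_apply_mem f) i hi

/-- Good basis vectors lie in Y, and f minus its projection is orthogonal to them. -/
theorem IsGoodSpace.repr_starProjection_of_not_bad (hY : IsGoodSpace M B Y) (f : H) {i : ι}
    (hi : ¬ M.Bad i) : B.repr (Y.starProjection f) i = B.repr f i := by
  classical
  have hmem : B i ∈ Y := (hY _).2 fun j hj => by
    rw [B.repr_self, lp.single_apply_ne]
    rintro rfl
    exact hi hj
  have h := Y.sub_starProjection_mem_orthogonal f (B i) hmem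
  rw [inner_sub_right, ← B.repr_apply_apply, ← B.repr_apply_apply] at h
  exact (sub_eq_zero.1 h).symm

theorem Represents.repr_compression (hT : Represents M B α T) (hY : IsGoodSpace M B Y)
    (u : (compression Y T).domain) {i : ι} (hi : ¬ M.Bad i) :
    B.repr ((compression Y T u : Y) : H) i =
      -(M.a i * B.repr ((u : Y) : H) i) - α * M.conv (B.repr ((u : Y) : H)) i := by
  have h1 : ((compression Y T u : Y) : H) = Y.starProjection (T ⟨(u : Y), u.2⟩) := rfl
  rw [h1, hY.repr_starProjection_of_not_bad _ hi, hT.repr_apply]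

theorem Represents.mem_resolventSet_compression (hT : Represents M B α T) (hY : IsGoodSpace M B Y)
    (lam : ℝ) : Complex.I * (lam : ℂ) ∈ opResolventSet (compression Y T) := by
  obtain ⟨R, hR₁, hR₂⟩ := M.exists_good_resolvent α lam
  let R' : H →L[ℂ] H := (B.repr.symm.toContinuousLinearEquiv : SqSum ι →L[ℂ] H) ∘L R ∘L
    (B.repr.toContinuousLinearEquiv : H →L[ℂ] SqSum ι)
  have hR' : ∀ f, B.repr (R' f) = R (B.repr f) := fun f => B.repr.apply_symm_apply _
  let S : Y →L[ℂ] Y := (R' ∘L Y.subtypeL).codRestrict Y fun f => (hY _).2 fun i hi => by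
    change B.repr (R' f) i = 0
    rw [hR']
    exact (hR₁ _).2.1 i hi
  have hS : ∀ f : Y, B.repr (S f : H) = R (B.repr (f : H)) := fun f => hR' f
  refine ⟨S, fun f => ?_, fun u => ?_⟩
  · have hd : (S f : H) ∈ T.domain := hT.mem_domain (by rw [hS]; exact (hR₁ _).1)
    have hd' : S f ∈ (compression Y T).domain := hd
    refine ⟨hd', Subtype.ext (repr_ext B fun i => ?_)⟩
    by_cases hi : M.Bad i
    · rw [(hY _).1 (Subtype.prop _) i hi, (hY _).1 (Subtype.prop _) i hi]
    · rw [Submodule.coe_sub, Submodule.coe_smul, repr_sub_apply, repr_smul_apply,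
        hT.repr_compression hY ⟨S f, hd'⟩ hi]
      simp only [hS]
      rw [← (hR₁ (B.repr (f : H))).2.2 i hi]
      ring
  · refine Subtype.ext (B.repr.injective ?_)
    rw [hS]
    refine hR₂ _ _ (hT.summable ⟨(u : Y), u.2⟩) ((hY _).1 (u : Y).2) fun i hi => ?_
    rw [Submodule.coe_sub, Submodule.coe_smul, repr_sub_apply, repr_smul_apply,
      hT.repr_compression hY u hi]
    ring

theorem tendsto_iSup_enorm_zero {E : Type*} [SeminormedAddCommGroup E] {R : ℝ → ℝ → E}
    (h : ∀ ε > 0, ∃ A : ℝ, ∀ α : ℝ, A ≤ |α| → ∀ lam, ‖R α lam‖ ≤ ε) :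
    Tendsto (fun α : ℝ => ⨆ lam : ℝ, ‖R α lam‖ₑ) (comap (fun α : ℝ => |α|) atTop) (𝓝 0) := by
  rw [ENNReal.tendsto_nhds_zero]
  intro ε hε
  -- ε may be infinite; truncating at 1 makes its real part a usable positive bound.
  have hm : min ε 1 ≠ ⊤ := ne_top_of_le_ne_top ENNReal.one_ne_top (min_le_right _ _)
  have hpos : 0 < (min ε 1).toReal :=
    ENNReal.toReal_pos (lt_min hε one_pos).ne' hm
  obtain ⟨A, hA⟩ := h _ hpos
  filter_upwards [tendsto_comap.eventually (eventually_ge_atTop A)] with α hα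
  refine iSup_le fun lam => le_trans ?_ (min_le_left ε 1)
  rw [← ofReal_norm]
  exact ENNReal.ofReal_le_of_le_toReal (hA α hα lam)

/-- The resolvent bounds for a family of operators acting on Fourier coefficients as `L_α`. -/
theorem resolvent_bounds {T : ℝ → H →ₗ.[ℂ] H} (hT : ∀ α, Represents M B α (T α))
    (hY : IsGoodSpace M B Y) :
    (∀ᶠ α : ℝ in comap (fun α : ℝ => |α|) atTop, ∀ lam : ℝ,
        Complex.I * (lam : ℂ) ∈ opResolventSet (compression Y (T α)) ∧
        Complex.I * (lam : ℂ) ∈ opResolventSet (T α)) ∧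
      Tendsto (fun α : ℝ => ⨆ lam : ℝ,
          ‖opResolvent (compression Y (T α)) (Complex.I * (lam : ℂ))‖ₑ)
        (comap (fun α : ℝ => |α|) atTop) (𝓝 0) ∧
      Tendsto (fun α : ℝ => ⨆ lam : ℝ,
          ‖Y.starProjection ∘L opResolvent (T α) (Complex.I * (lam : ℂ))‖ₑ)
        (comap (fun α : ℝ => |α|) atTop) (𝓝 0) := by
  -- The resolvent sets contain the imaginary axis for every real α; large |α| matters only for the
  -- bounds.
  refine ⟨Eventually.of_forall fun α lam =>
    ⟨(hT α).mem_resolventSet_compression hY lam, (hT α).mem_resolventSet lam⟩,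
    tendsto_iSup_enorm_zero fun ε hε => ?_, tendsto_iSup_enorm_zero fun ε hε => ?_⟩
  · obtain ⟨A, hA⟩ := M.exists_norm_le hε
    refine ⟨A, fun α hα lam => ContinuousLinearMap.opNorm_le_bound _ hε.le fun f => ?_⟩
    have hR := opResolvent_spec ((hT α).mem_resolventSet_compression hY lam)
    set R := opResolvent (compression Y (T α)) (Complex.I * (lam : ℂ))
    obtain ⟨hd, heq⟩ := hR.right_inv f
    have h1 := hA α hα lam (B.repr (R f : H)) (B.repr (f : H))
      ((hT α).summable ⟨((R f : Y) : H), hd⟩) ((hY _).1 (R f).2) fun i hi => by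
        have h2 := congrArg (fun u : Y => B.repr (u : H) i) heq
        simp only at h2
        rw [Submodule.coe_sub, Submodule.coe_smul, repr_sub_apply, repr_smul_apply,
          (hT α).repr_compression hY ⟨R f, hd⟩ hi] at h2
        rw [← h2]
        ring
    rwa [B.repr.norm_map, B.repr.norm_map] at h1
  · obtain ⟨A, hA⟩ := M.exists_norm_le hε
    refine ⟨A, fun α hα lam => ContinuousLinearMap.opNorm_le_bound _ hε.le fun f => ?_⟩
    have hR := opResolvent_spec ((hT α).mem_resolventSet lam)
    set R := opResolvent (T α) (Complex.I * (lam : ℂ))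
    obtain ⟨hd, heq⟩ := hR.right_inv f
    have hgood : ∀ i, ¬ M.Bad i → B.repr (Y.starProjection (R f)) i = B.repr (R f) i :=
      fun i hi => hY.repr_starProjection_of_not_bad _ hi
    have hbad : ∀ i, M.Bad i → B.repr (Y.starProjection (R f)) i = 0 :=
      fun i hi => hY.repr_starProjection_of_bad _ hi
    -- The projected resolvent still solves the good equations, because `conv` ignores bad modes.
    -- The same estimate then bounds the second family.
    have h1 := hA α hα lam (B.repr (Y.starProjection (R f))) (B.repr f)
      (summable_sq_of_le ((hT α).summable ⟨R f, hd⟩) fun i => by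
        by_cases hi : M.Bad i
        · rw [hbad i hi, mul_zero, norm_zero]; exact norm_nonneg _
        · rw [hgood i hi]) hbad fun i hi => by
        have h2 := congrArg (fun u : H => B.repr u i) heq
        simp only at h2
        rw [repr_sub_apply, repr_smul_apply, (hT α).repr_apply] at h2
        rw [hgood i hi, M.conv_congr hgood, ← h2]
        ring
    rwa [B.repr.norm_map, B.repr.norm_map] at h1

end Abstract

/-! ### Orthogonal systems of exponentials -/

section General

variable {S κ : Type*} [TopologicalSpace S] [CompactSpace S] [MeasurableSpace S] [BorelSpace S]
  {μ : Measure S} [IsFiniteMeasure μ]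

theorem inner_toLp [SecondCountableTopologyEither S ℂ] (c : C(S, ℂ)) (f : Lp ℂ 2 μ) :
    inner ℂ (ContinuousMap.toLp 2 μ ℂ c) f = ∫ s, f s * star (c s) ∂μ := by
  rw [L2.inner_def]
  refine integral_congr_ae ?_
  filter_upwards [ContinuousMap.coeFn_toLp (p := 2) (𝕜 := ℂ) μ c] with s hs
  rw [hs]
  simp

/-- Stone–Weierstrass: the closure properties make the linear span of the e i a star subalgebra, and
it separates points. -/
theorem eq_zero_of_span [T2Space S] [NormalSpace S] [R1Space S] [SecondCountableTopologyEither S ℂ]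
    [μ.WeaklyRegular] {e : κ → C(S, ℂ)} (hone : ∃ i, e i = 1) (hmul : ∀ i j, ∃ k, e i * e j = e k)
    (hstar : ∀ i, ∃ j, star (e i) = e j) (hsep : ∀ x y, x ≠ y → ∃ i, e i x ≠ e i y)
    (g : Lp ℂ 2 μ) (h : ∀ i, ∫ s, g s * e i s ∂μ = 0) : g = 0 := by
  let B : StarSubalgebra ℂ C(S, ℂ) :=
    { Submodule.toSubalgebra (Submodule.span ℂ (Set.range e))
        (by obtain ⟨i, hi⟩ := hone; exact hi ▸ Submodule.subset_span ⟨i, rfl⟩)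
        (by
          intro x y hx hy
          have := Submodule.mul_mem_mul hx hy
          rw [Submodule.span_mul_span] at this
          refine Submodule.span_mono ?_ this
          rintro _ ⟨_, ⟨i, rfl⟩, _, ⟨j, rfl⟩, rfl⟩
          obtain ⟨k, hk⟩ := hmul i j
          exact ⟨k, hk.symm⟩) with
      star_mem' := by
        intro x hx
        change x ∈ Submodule.span ℂ (Set.range e) at hx
        change star x ∈ Submodule.span ℂ (Set.range e)
        induction hx using Submodule.span_induction with
        | mem x hx =>
          obtain ⟨i, rfl⟩ := hx
          obtain ⟨j, hj⟩ := hstar i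
          exact hj ▸ Submodule.subset_span ⟨j, rfl⟩
        | zero => rw [star_zero]; exact Submodule.zero_mem _
        | add x y _ _ hx hy => rw [star_add]; exact Submodule.add_mem _ hx hy
        | smul a x _ hx => rw [star_smul]; exact Submodule.smul_mem _ _ hx }
  refine eq_zero_of_test B (fun x y hxy => ?_) g fun c hc => ?_
  · obtain ⟨i, hi⟩ := hsep x y hxy
    exact ⟨_, ⟨e i, Submodule.subset_span ⟨i, rfl⟩, rfl⟩, hi⟩
  · change c ∈ Submodule.span ℂ (Set.range e) at hc
    induction hc using Submodule.span_induction with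
    | mem x hx => obtain ⟨i, rfl⟩ := hx; exact h i
    | zero => simp
    | add x y _ _ hx hy =>
      have h1 : ∀ c : C(S, ℂ), Integrable (fun s => g s * c s) μ := fun c =>
        integrable_mul_continuous (integrable_L2 g) c.continuous
      simp only [ContinuousMap.add_apply, mul_add]
      rw [integral_add (h1 x) (h1 y), hx, hy, add_zero]
    | smul a x _ hx =>
      simp only [ContinuousMap.smul_apply, smul_eq_mul, mul_left_comm _ a]
      rw [integral_const_mul, hx, mul_zero]

/-- The isometry J lets one construction serve both the full L² spaces and X, where totality is
required only against elements of X. -/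
theorem exists_hilbertBasis_of_orthogonal [SecondCountableTopologyEither S ℂ]
    {H : Type*} [NormedAddCommGroup H] [InnerProductSpace ℂ H]
    [CompleteSpace H] (J : H →ₗᵢ[ℂ] Lp ℂ 2 μ) (e : κ → C(S, ℂ)) (u : κ → H)
    (hu : ∀ i, J (u i) = ContinuousMap.toLp 2 μ ℂ (e i)) {N : ℝ} (hN : 0 < N)
    (hnorm : ∀ i, ∫ s, e i s * star (e i s) ∂μ = (N : ℂ) ^ 2)
    (horth : ∀ i j, i ≠ j → ∫ s, e j s * star (e i s) ∂μ = 0)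
    (htotal : ∀ g : H, (∀ i, ∫ s, J g s * star (e i s) ∂μ = 0) → g = 0) :
    ∃ B : HilbertBasis κ ℂ H, (∀ i, B i = (N : ℂ)⁻¹ • u i) ∧
      ∀ f i, B.repr f i = (N : ℂ)⁻¹ * ∫ s, J f s * star (e i s) ∂μ := by
  have hN' : (N : ℂ) ≠ 0 := Complex.ofReal_ne_zero.2 hN.ne'
  have hin : ∀ f i, inner ℂ ((N : ℂ)⁻¹ • u i) f = (N : ℂ)⁻¹ * ∫ s, J f s * star (e i s) ∂μ := by
    intro f i
    rw [inner_smul_left, ← J.inner_map_map, hu, inner_toLp]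
    simp
  have hJe : ∀ i j, ∫ s, J ((N : ℂ)⁻¹ • u j) s * star (e i s) ∂μ =
      (N : ℂ)⁻¹ * ∫ s, e j s * star (e i s) ∂μ := by
    intro i j
    rw [← integral_const_mul]
    refine integral_congr_ae ?_
    rw [map_smul, hu]
    filter_upwards [coeFn_smul_ae (N : ℂ)⁻¹ (ContinuousMap.toLp 2 μ ℂ (e j)),
      ContinuousMap.coeFn_toLp (p := 2) (𝕜 := ℂ) μ (e j)] with s h1 h2
    rw [h1, h2, mul_assoc]
  have hon : Orthonormal ℂ fun i => (N : ℂ)⁻¹ • u i := by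
    classical
    rw [orthonormal_iff_ite]
    intro i j
    rw [hin, hJe]
    split_ifs with hij
    · subst hij
      rw [hnorm]
      field_simp
    · rw [horth i j hij, mul_zero, mul_zero]
  refine ⟨HilbertBasis.mkOfOrthogonalEqBot hon ?_, fun i => ?_, fun f i => ?_⟩
  · rw [Submodule.eq_bot_iff]
    intro g hg
    refine htotal g fun i => ?_
    have := hg _ (Submodule.subset_span ⟨i, rfl⟩)
    rw [hin] at this
    exact (mul_eq_zero.1 this).resolve_left (inv_ne_zero hN')
  · rw [HilbertBasis.coe_mkOfOrthogonalEqBot]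
  · rw [HilbertBasis.repr_apply_apply, HilbertBasis.coe_mkOfOrthogonalEqBot, hin]

/-- Weak derivatives are characterized by Fourier coefficients. -/
theorem weak_iff_repr [SecondCountableTopologyEither S ℂ] {e : κ → C(S, ℂ)} {N : ℝ} (hN : 0 < N)
    (B : HilbertBasis κ ℂ (Lp ℂ 2 μ))
    (hB : ∀ i, B i = (N : ℂ)⁻¹ • (ContinuousMap.toLp 2 μ ℂ (e i)))
    (hrepr : ∀ f i, B.repr f i = (N : ℂ)⁻¹ * ∫ s, f s * star (e i s) ∂μ)
    {Test : C(S, ℂ) → Prop} {d : (S → ℂ) → S → ℂ} {m : κ → ℂ}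
    (htest : ∀ i, Test (star (e i)) ∧ ∀ s, d (star (e i) : C(S, ℂ)) s = -m i * star (e i s))
    (hcont : ∀ φ, Test φ → Continuous (d φ))
    (hparts : ∀ φ : C(S, ℂ), Test φ → ∀ i, ∫ s, e i s * d φ s ∂μ = -m i * ∫ s, e i s * φ s ∂μ)
    (f g : Lp ℂ 2 μ) :
    (∀ φ : C(S, ℂ), Test φ → ∫ s, f s * d φ s ∂μ = -∫ s, g s * φ s ∂μ) ↔
      ∀ i, B.repr g i = m i * B.repr f i := by
  have hN' : (N : ℂ) ≠ 0 := Complex.ofReal_ne_zero.2 hN.ne'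
  constructor
  · intro h i
    have h1 := h _ (htest i).1
    simp only [(htest i).2] at h1
    have h2 : ∫ s, f s * (-m i * star (e i s)) ∂μ = -m i * ∫ s, f s * star (e i s) ∂μ := by
      rw [← integral_const_mul]
      exact integral_congr_ae (ae_of_all _ fun s => by ring)
    rw [h2] at h1
    rw [hrepr, hrepr]
    have h3 : ∫ s, g s * star (e i s) ∂μ = m i * ∫ s, f s * star (e i s) ∂μ := by
      have h4 : ∫ s, g s * (star (e i) : C(S, ℂ)) s ∂μ = ∫ s, g s * star (e i s) ∂μ := rfl
      rw [← h4]
      linear_combination h1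
    rw [h3]
    ring
  · intro h φ hφ
    -- Pairings with φ and d φ are continuous functionals. Expanding f and g in the basis reduces
    -- the claim to integration by parts on exponentials.
    obtain ⟨Td, hTd⟩ := exists_pairing (μ := μ) ⟨d φ, hcont φ hφ⟩
    obtain ⟨Tφ, hTφ⟩ := exists_pairing (μ := μ) φ
    have hT : ∀ (c : C(S, ℂ)) (T : Lp ℂ 2 μ →L[ℂ] ℂ),
        (∀ f : Lp ℂ 2 μ, T f = ∫ s, f s * c s ∂μ) →
        ∀ i, T (B i) = (N : ℂ)⁻¹ * ∫ s, e i s * c s ∂μ := by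
      intro c T hT i
      rw [hB, map_smul, hT, smul_eq_mul]
      congr 1
      refine integral_congr_ae ?_
      filter_upwards [ContinuousMap.coeFn_toLp (p := 2) (𝕜 := ℂ) μ (e i)] with s hs
      rw [hs]
    have hi : ∀ i, Td (B i) = -m i * Tφ (B i) := fun i => by
      rw [hT _ Td hTd, hT _ Tφ hTφ]
      have h1 := hparts φ hφ i
      simp only [ContinuousMap.coe_mk]
      rw [h1]
      ring
    have s1 := (B.hasSum_repr f).mapL Td
    have s2 := ((B.hasSum_repr g).mapL Tφ).neg
    have h1 : Td f = -Tφ g := by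
      refine s1.unique (s2.congr_fun fun i => ?_)
      rw [map_smul, map_smul, hi, h i, smul_eq_mul, smul_eq_mul]
      ring
    rw [hTd, hTφ] at h1
    exact h1

end General

/-! ### Exponentials on the circle -/

theorem hasDerivAt_fourier_two_pi (n : ℤ) (x : ℝ) :
    HasDerivAt (fun t : ℝ => (fourier n (t : Circ) : ℂ)) (Complex.I * n * fourier n (x : Circ)) x := by
  convert hasDerivAt_fourier (2 * Real.pi) n x using 1
  have : (Real.pi : ℂ) ≠ 0 := by exact_mod_cast Real.pi_ne_zero
  push_cast
  field_simp

theorem dCirc_coe (φ : Circ → ℂ) (x : ℝ) : dCirc φ (x : Circ) = deriv (fun t : ℝ => φ (t : Circ)) x := by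
  have := deriv_comp_const_add (f := fun y : ℝ => φ (y : Circ)) x 0
  simpa [dCirc] using this

theorem dCirc_fourier (n : ℤ) (y : Circ) :
    dCirc (fourier n : C(Circ, ℂ)) y = Complex.I * n * fourier n y := by
  induction y using QuotientAddGroup.induction_on with
  | H x => exact (dCirc_coe _ x).trans (hasDerivAt_fourier_two_pi n x).deriv

theorem dCirc_const_mul (c : ℂ) (φ : Circ → ℂ) (y : Circ) :
    dCirc (fun y => c * φ y) y = c * dCirc φ y := by
  unfold dCirc
  exact deriv_const_mul_field c

theorem integral_fourier_mul_dCirc {φ : C(Circ, ℂ)} (hφ : TestCirc φ) (n : ℤ) :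
    ∫ y : Circ, fourier n y * dCirc φ y = -(Complex.I * n) * ∫ y : Circ, fourier n y * φ y := by
  rw [← AddCircle.intervalIntegral_preimage (2 * Real.pi) 0, ← AddCircle.intervalIntegral_preimage (2 * Real.pi) 0]
  simp only [dCirc_coe, zero_add]
  have hd : Differentiable ℝ fun t : ℝ => φ (t : Circ) := hφ.differentiable (by simp)
  have hc : Continuous (deriv fun t : ℝ => φ (t : Circ)) := hφ.continuous_deriv (by simp)
  have hf : Continuous fun t : ℝ => (fourier n (t : Circ) : ℂ) :=
    (fourier n).continuous.comp (AddCircle.continuous_mk' _)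
  rw [intervalIntegral.integral_mul_deriv_eq_deriv_mul
    (fun x _ => hasDerivAt_fourier_two_pi n x) (fun x _ => (hd x).hasDerivAt)
    ((continuous_const.mul hf).intervalIntegrable _ _) (hc.intervalIntegrable _ _)]
  -- By periodicity the boundary terms cancel.
  have h0 : ((2 * Real.pi : ℝ) : Circ) = ((0 : ℝ) : Circ) := by
    rw [AddCircle.coe_period]; rfl
  rw [h0, sub_self, zero_sub, ← intervalIntegral.integral_const_mul,
    ← intervalIntegral.integral_neg]
  refine intervalIntegral.integral_congr fun x _ => ?_
  ring

theorem star_fourier (n : ℤ) (y : Circ) : star (fourier n y : ℂ) = fourier (-n) y := by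
  rw [fourier_neg]; rfl

theorem star_fourier_map (n : ℤ) : star (fourier n : C(Circ, ℂ)) = fourier (-n) :=
  ContinuousMap.ext fun y => star_fourier n y

theorem integral_fourier (n : ℤ) :
    ∫ y : Circ, (fourier n y : ℂ) = if n = 0 then (2 * Real.pi : ℂ) else 0 := by
  split_ifs with hn
  · subst hn
    simp only [fourier_zero, integral_const, Complex.real_smul, mul_one]
    rw [measureReal_def, AddCircle.measure_univ, ENNReal.toReal_ofReal Real.two_pi_pos.le]
    push_cast
    rfl
  -- Integrating by parts against the constant 1 gives n times the integral equal to zero.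
  · have h := integral_fourier_mul_dCirc (testCirc_fourier 0) n
    simp only [dCirc_fourier, fourier_zero, Int.cast_zero, mul_zero, mul_one,
      integral_zero] at h
    have hn' : (n : ℂ) ≠ 0 := by exact_mod_cast hn
    simpa [hn'] using h.symm

theorem integral_fourier_mul_star (i j : ℤ) :
    ∫ y : Circ, (fourier j y : ℂ) * star (fourier i y : ℂ) =
      if i = j then (2 * Real.pi : ℂ) else 0 := by
  simp only [star_fourier, ← fourier_add]
  rw [integral_fourier]
  refine if_congr ?_ rfl rfl
  omega

theorem sinC_eq (y : Circ) :
    (sinC y : ℂ) = (2 * Complex.I)⁻¹ * (fourier 1 y - fourier (-1) y) := by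
  induction y using QuotientAddGroup.induction_on with
  | H x =>
    have h1 : sinC (x : Circ) = Real.sin x := rfl
    have hπ : (Real.pi : ℂ) ≠ 0 := by exact_mod_cast Real.pi_ne_zero
    have h2 : ∀ n : ℤ, (fourier n (x : Circ) : ℂ) = Complex.exp (n * x * Complex.I) := fun n => by
      rw [fourier_coe_apply]
      congr 1
      push_cast
      field_simp
    have h3 : ((x : Circ)) = (QuotientAddGroup.mk x : Circ) := rfl
    rw [← h3, h1, h2, h2, Complex.ofReal_sin, Complex.sin]
    push_cast
    have := Complex.I_sq
    rw [one_mul, neg_one_mul, mul_inv, Complex.inv_I]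
    ring

theorem sinC_mul_star_fourier (k : ℤ) (y : Circ) : (sinC y : ℂ) * star (fourier k y : ℂ) =
    (2 * Complex.I)⁻¹ * (star (fourier (k - 1) y : ℂ) - star (fourier (k + 1) y : ℂ)) := by
  rw [sinC_eq, star_fourier, star_fourier, star_fourier, mul_assoc, sub_mul, ← fourier_add,
    ← fourier_add]
  congr 4 <;> ring_nf

/-! ### The operators on the circle in Fourier coefficients -/

theorem sqrt_two_pi_pos : 0 < √(2 * Real.pi) := Real.sqrt_pos.2 Real.two_pi_pos

theorem sqrt_two_pi_sq : ((√(2 * Real.pi) : ℝ) : ℂ) ^ 2 = 2 * Real.pi := by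
  rw [← Complex.ofReal_pow, Real.sq_sqrt Real.two_pi_pos.le]
  push_cast
  rfl

theorem exists_circBasis : ∃ B : HilbertBasis ℤ ℂ L2Circ,
    (∀ k, B k = ((√(2 * Real.pi) : ℝ) : ℂ)⁻¹ • ContinuousMap.toLp 2 volume ℂ (fourier k)) ∧
      ∀ (f : L2Circ) k,
        B.repr f k = ((√(2 * Real.pi) : ℝ) : ℂ)⁻¹ * ∫ y : Circ, f y * star (fourier k y : ℂ) := by
  refine exists_hilbertBasis_of_orthogonal (LinearIsometry.id) (fun k => fourier k) _ (fun k => rfl)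
    sqrt_two_pi_pos (fun k => ?_) (fun i j hij => ?_) (fun g hg => ?_)
  · rw [integral_fourier_mul_star, if_pos rfl, sqrt_two_pi_sq]
  · rw [integral_fourier_mul_star, if_neg hij]
  · refine eq_zero_of_span (e := fun k : ℤ => (fourier k : C(Circ, ℂ)))
      ⟨0, ContinuousMap.ext fun y => fourier_zero⟩
      (fun i j => ⟨i + j, ContinuousMap.ext fun y => fourier_add.symm⟩)
      (fun i => ⟨-i, star_fourier_map i⟩)
      (fun x y hxy => ⟨1, fun h => hxy (fourier_one_injective h)⟩) g fun k => ?_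
    have := hg (-k)
    simp only [star_fourier, neg_neg] at this
    exact this

/-- The Fourier basis of `L²(𝕋)`. -/
def circBasis : HilbertBasis ℤ ℂ L2Circ := exists_circBasis.choose

theorem circBasis_repr (f : L2Circ) (k : ℤ) : circBasis.repr f k =
    ((√(2 * Real.pi) : ℝ) : ℂ)⁻¹ * ∫ y : Circ, f y * star (fourier k y : ℂ) :=
  exists_circBasis.choose_spec.2 f k

theorem hasWeakD_iff (f g : L2Circ) :
    HasWeakD f g ↔ ∀ k, circBasis.repr g k = Complex.I * k * circBasis.repr f k := by
  refine weak_iff_repr (e := fun k => fourier k) sqrt_two_pi_pos circBasis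
    exists_circBasis.choose_spec.1 circBasis_repr (Test := TestCirc) (d := dCirc)
    (m := fun k : ℤ => Complex.I * k) (fun k => ⟨?_, fun y => ?_⟩) (fun φ hφ => continuous_dCirc hφ)
    (fun φ hφ k => integral_fourier_mul_dCirc hφ k) f g
  · rw [star_fourier_map]; exact testCirc_fourier _
  · rw [star_fourier_map, dCirc_fourier, star_fourier]
    push_cast
    ring

/-- The modes `e^{i(l x + k y)}` with fixed `l`. -/
def circLattice (l : ℤ) (hl : l ≠ 0) : ModeLattice ℤ where
  l _ := l
  k k := k
  shift := Equiv.addRight 1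
  l_shift _ := rfl
  k_shift _ := rfl
  l_ne _ := hl
  inj _ _ _ h := h

theorem circLattice_a (l : ℤ) (hl : l ≠ 0) (k : ℤ) :
    ((circLattice l hl).a k : ℂ) = (k : ℂ) ^ 2 + (l : ℂ) ^ 2 := by
  unfold ModeLattice.a
  push_cast
  rfl

theorem ModeLattice.norm_a {ι : Type*} (M : ModeLattice ι) (i : ι) : ‖(M.a i : ℂ)‖ = M.a i := by
  rw [Complex.norm_real, Real.norm_of_nonneg (M.a_pos i).le]

theorem ModeLattice.a_ne_zero {ι : Type*} (M : ModeLattice ι) (i : ι) : (M.a i : ℂ) ≠ 0 :=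
  Complex.ofReal_ne_zero.2 (M.a_pos i).ne'

theorem mem_graph_opAMode_iff {l : ℤ} (hl : l ≠ 0) (f g : L2Circ) : (f, g) ∈ (opAMode l).graph ↔
    ∀ k, circBasis.repr g k = -((circLattice l hl).a k * circBasis.repr f k) := by
  rw [graph_opAMode]
  constructor
  · rintro ⟨f₁, f₂, h1, h2, h3⟩ k
    simp only at h1 h3
    rw [h3, repr_sub_apply, repr_smul_apply, (hasWeakD_iff _ _).1 h2, (hasWeakD_iff _ _).1 h1,
      circLattice_a]
    linear_combination (k : ℂ) ^ 2 * circBasis.repr f k * Complex.I_sq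
  · intro h
    -- Both derivatives have symbols dominated by k² ≤ a, so their coefficients are dominated by
    -- those of g.
    have hle : ∀ m : ℤ → ℂ, (∀ k : ℤ, ‖m k‖ ≤ (k : ℝ) ^ 2) →
        Summable fun k : ℤ => ‖m k * circBasis.repr f k‖ ^ 2 := by
      intro m hm
      refine summable_sq_of_le (SqSum.summable (circBasis.repr g)) fun k => ?_
      rw [h, norm_neg, norm_mul, norm_mul, ModeLattice.norm_a]
      refine mul_le_mul_of_nonneg_right ((hm k).trans ?_) (norm_nonneg _)
      change (k : ℝ) ^ 2 ≤ (k : ℝ) ^ 2 + (l : ℝ) ^ 2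
      nlinarith [sq_nonneg (l : ℝ)]
    refine ⟨circBasis.repr.symm (SqSum.mk _ (hle (fun k => Complex.I * k) fun k => ?_)),
      circBasis.repr.symm (SqSum.mk _ (hle (fun k => -(k : ℂ) ^ 2) fun k => ?_)),
      (hasWeakD_iff _ _).2 fun k => ?_, (hasWeakD_iff _ _).2 fun k => ?_,
      repr_ext circBasis fun k => ?_⟩
    · rw [norm_mul, Complex.norm_I, one_mul, Complex.norm_intCast]
      exact abs_intCast_le_sq k
    · rw [norm_neg, norm_pow, Complex.norm_intCast, sq_abs]
    · rw [LinearIsometryEquiv.apply_symm_apply, SqSum.mk_apply]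
    · rw [LinearIsometryEquiv.apply_symm_apply, LinearIsometryEquiv.apply_symm_apply,
        SqSum.mk_apply, SqSum.mk_apply]
      linear_combination -(k : ℂ) ^ 2 * circBasis.repr f k * Complex.I_sq
    · rw [repr_sub_apply, repr_smul_apply, LinearIsometryEquiv.apply_symm_apply,
        SqSum.mk_apply, h, circLattice_a]
      ring

/-! ### Multiplication by sin y and the symbol of the single-mode operator. -/

theorem memLp_mul_continuous {S : Type*} [TopologicalSpace S] [CompactSpace S]
    [MeasurableSpace S] [BorelSpace S] {μ : Measure S}
    (f : Lp ℂ 2 μ) {c : S → ℂ} (hc : Continuous c) : MemLp (fun s => c s * f s) 2 μ := by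
  obtain ⟨C, hC⟩ := isCompact_univ.exists_bound_of_continuousOn hc.continuousOn
  refine (Lp.memLp f).of_le_mul (c := C) (hc.aestronglyMeasurable.mul (Lp.aestronglyMeasurable f))
    (ae_of_all _ fun s => ?_)
  rw [norm_mul]
  exact mul_le_mul_of_nonneg_right (hC s (Set.mem_univ s)) (norm_nonneg _)

theorem repr_eq_of_ae_sinC_mul {f g : L2Circ} (h : g =ᵐ[volume] fun y => (sinC y : ℂ) * f y)
    (k : ℤ) : circBasis.repr g k =
      (2 * Complex.I)⁻¹ * (circBasis.repr f (k - 1) - circBasis.repr f (k + 1)) := by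
  have hi : ∀ n : ℤ, Integrable fun y : Circ => f y * star (fourier n y : ℂ) := fun n =>
    integrable_mul_continuous (integrable_L2 f) (fourier n).continuous.star
  have h1 : ∫ y : Circ, g y * star (fourier k y : ℂ) =
      (2 * Complex.I)⁻¹ * ((∫ y : Circ, f y * star (fourier (k - 1) y : ℂ)) -
        ∫ y : Circ, f y * star (fourier (k + 1) y : ℂ)) := by
    rw [← integral_sub (hi _) (hi _), ← integral_const_mul]
    refine integral_congr_ae (h.mono fun y hy => ?_)
    simp only
    rw [hy, mul_right_comm, sinC_mul_star_fourier]
    ring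
  rw [circBasis_repr, circBasis_repr, circBasis_repr, h1]
  ring

theorem ae_eq_sinC_mul_iff (f g : L2Circ) : (g =ᵐ[volume] fun y => (sinC y : ℂ) * f y) ↔
    ∀ k, circBasis.repr g k =
      (2 * Complex.I)⁻¹ * (circBasis.repr f (k - 1) - circBasis.repr f (k + 1)) := by
  refine ⟨repr_eq_of_ae_sinC_mul, fun h => ?_⟩
  have hm := memLp_mul_continuous f (Complex.continuous_ofReal.comp continuous_sinC)
  have hq : hm.toLp =ᵐ[volume] fun y => (sinC y : ℂ) * f y := hm.coeFn_toLp
  have : g = hm.toLp := repr_ext circBasis fun k => by rw [h, repr_eq_of_ae_sinC_mul hq]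
  rw [this]
  exact hq

theorem mem_graph_sub_smul_iff {E : Type*} [AddCommGroup E] [Module ℂ E] (T₁ T₂ : E →ₗ.[ℂ] E)
    (c : ℂ) (f g : E) : (f, g) ∈ (T₁ - c • T₂).graph ↔
      ∃ g₁ g₂, (f, g₁) ∈ T₁.graph ∧ (f, g₂) ∈ T₂.graph ∧ g = g₁ - c • g₂ := by
  constructor
  · intro h
    obtain ⟨u, hu, hg⟩ := (LinearPMap.mem_graph_iff _).1 h
    obtain ⟨h1, h2⟩ : (u : E) ∈ T₁.domain ∧ (u : E) ∈ T₂.domain := u.2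
    simp only at hu hg
    subst hu
    exact ⟨_, _, T₁.mem_graph ⟨u, h1⟩, T₂.mem_graph ⟨u, h2⟩, hg.symm⟩
  · rintro ⟨g₁, g₂, h1, h2, rfl⟩
    obtain ⟨u₁, hu₁, hg₁⟩ := (LinearPMap.mem_graph_iff _).1 h1
    obtain ⟨u₂, hu₂, hg₂⟩ := (LinearPMap.mem_graph_iff _).1 h2
    simp only at hu₁ hg₁ hu₂ hg₂
    subst hu₁
    have hm : (u₁ : E) ∈ (T₁ - c • T₂).domain := ⟨u₁.2, hu₂ ▸ u₂.2⟩
    refine (LinearPMap.mem_graph_iff _).2 ⟨⟨u₁, hm⟩, rfl, ?_⟩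
    have h3 : u₂ = ⟨(u₁ : E), hm.2⟩ := Subtype.ext hu₂
    simp only
    rw [← hg₁, ← hg₂, h3]
    rfl

theorem mem_graph_opΛMode_iff {l : ℤ} (hl : l ≠ 0) (f g : L2Circ) : (f, g) ∈ (opΛMode l).graph ↔
    ∀ k : ℤ, circBasis.repr g k = (2 * Complex.I)⁻¹ *
      ((circLattice l hl).b (k - 1) * circBasis.repr f (k - 1) -
        (circLattice l hl).b (k + 1) * circBasis.repr f (k + 1)) := by
  have hb : ∀ k, ((circLattice l hl).b k : ℂ) = 1 - ((circLattice l hl).a k : ℂ)⁻¹ := fun k => by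
    unfold ModeLattice.b
    push_cast
    rfl
  have key : ∀ ψ : L2Circ, (ψ, f) ∈ (opAMode l).graph →
      ∀ k, circBasis.repr (f + ψ) k = (circLattice l hl).b k * circBasis.repr f k := by
    intro ψ hψ k
    have h1 := (mem_graph_opAMode_iff hl ψ f).1 hψ k
    have h2 : circBasis.repr (f + ψ) k = circBasis.repr f k + circBasis.repr ψ k := by
      rw [map_add]; rfl
    have h3 := (circLattice l hl).a_ne_zero k
    rw [h2, hb, h1]
    field_simp
    ring
  have hgr : (f, g) ∈ graphΛMode l ↔ ∀ k : ℤ, circBasis.repr g k = (2 * Complex.I)⁻¹ *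
      ((circLattice l hl).b (k - 1) * circBasis.repr f (k - 1) -
        (circLattice l hl).b (k + 1) * circBasis.repr f (k + 1)) := by
    constructor
    · rintro ⟨ψ, hψ, hg⟩ k
      rw [(ae_eq_sinC_mul_iff _ _).1 hg, key ψ hψ, key ψ hψ]
    · intro h
      -- A_l is onto because a ≥ 1, so ψ = A_l⁻¹ f exists for every f.
      have hs : Summable fun k : ℤ => ‖-((circLattice l hl).a k : ℂ)⁻¹ * circBasis.repr f k‖ ^ 2 := by
        refine summable_sq_of_le (SqSum.summable (circBasis.repr f)) fun k => ?_
        rw [norm_mul, norm_neg, norm_inv, ModeLattice.norm_a]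
        exact mul_le_of_le_one_left (norm_nonneg _)
          (inv_le_one_of_one_le₀ (ModeLattice.one_le_a _ k))
      have hψ : (circBasis.repr.symm (SqSum.mk _ hs), f) ∈ (opAMode l).graph := by
        refine (mem_graph_opAMode_iff hl _ _).2 fun k => ?_
        have h3 := (circLattice l hl).a_ne_zero k
        rw [LinearIsometryEquiv.apply_symm_apply, SqSum.mk_apply]
        field_simp
      refine ⟨_, hψ, (ae_eq_sinC_mul_iff _ _).2 fun k => ?_⟩
      rw [key _ hψ, key _ hψ]
      exact h k
  rw [← hgr]
  -- The relation is single-valued because A_l is injective: f = 0 forces ψ = 0.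
  have : (opΛMode l).graph = graphΛMode l := by
    refine Submodule.toLinearPMap_graph_eq _ ?_
    rintro ⟨x, y⟩ ⟨ψ, hψ, hy⟩ hx
    simp only at hx hψ hy
    subst hx
    refine repr_ext circBasis fun k => ?_
    have hψ0 : ψ = 0 := repr_ext circBasis fun k => by
      have h1 := (mem_graph_opAMode_iff hl ψ 0).1 hψ k
      have h2 := (circLattice l hl).a_ne_zero k
      rw [map_zero] at h1 ⊢
      simpa [h2] using h1
    rw [(ae_eq_sinC_mul_iff _ _).1 hy, hψ0, add_zero, map_zero]
    simp
  rw [this]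

theorem represents_opLMode {l : ℤ} (hl : l ≠ 0) (α : ℝ) :
    Represents (circLattice l hl) circBasis α (opLMode α l) := by
  intro f g
  have hconv : ∀ k : ℤ, (circLattice l hl).conv (circBasis.repr f) k = (l : ℂ) / 2 *
      ((circLattice l hl).b (k - 1) * circBasis.repr f (k - 1) -
        (circLattice l hl).b (k + 1) * circBasis.repr f (k + 1)) := fun k => rfl
  have hI : ∀ z : ℂ, (Complex.I * α * l) * ((2 * Complex.I)⁻¹ * z) = α * (l / 2 * z) := fun z => by
    have := Complex.I_ne_zero
    field_simp
  unfold opLMode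
  rw [mem_graph_sub_smul_iff]
  constructor
  · rintro ⟨g₁, g₂, h1, h2, rfl⟩
    rw [mem_graph_opAMode_iff hl] at h1
    rw [mem_graph_opΛMode_iff hl] at h2
    refine ⟨(SqSum.summable (circBasis.repr g₁)).congr fun k => by rw [h1, norm_neg], fun k => ?_⟩
    rw [repr_sub_apply, repr_smul_apply, h1, h2, hconv, hI]
  · rintro ⟨hs, hg⟩
    have hbd : ∀ k, ‖((circLattice l hl).b k : ℂ) * circBasis.repr f k‖ ≤ ‖circBasis.repr f k‖ :=
      fun k => by
        rw [norm_mul, Complex.norm_real, Real.norm_of_nonneg (ModeLattice.b_nonneg _ _)]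
        exact mul_le_of_le_one_left (norm_nonneg _) (ModeLattice.b_le_one _ _)
    let w : SqSum ℤ := sinShift (SqSum.mk _ (summable_sq_of_le (SqSum.summable (circBasis.repr f)) hbd))
    refine ⟨-circBasis.repr.symm (SqSum.mk _ hs), circBasis.repr.symm w,
      (mem_graph_opAMode_iff hl _ _).2 fun k => ?_, (mem_graph_opΛMode_iff hl _ _).2 fun k => ?_,
      repr_ext circBasis fun k => ?_⟩
    · rw [map_neg, LinearIsometryEquiv.apply_symm_apply]
      rfl
    · rw [LinearIsometryEquiv.apply_symm_apply]
      exact sinShift_apply _ k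
    · rw [repr_sub_apply, repr_smul_apply, map_neg, LinearIsometryEquiv.apply_symm_apply,
        LinearIsometryEquiv.apply_symm_apply, hg, hconv, ← hI]
      have hw : w k = (2 * Complex.I)⁻¹ *
          ((circLattice l hl).b (k - 1) * circBasis.repr f (k - 1) -
            (circLattice l hl).b (k + 1) * circBasis.repr f (k + 1)) := sinShift_apply _ k
      rw [hw]
      rfl

theorem isGoodSpace_spaceYMode {l : ℤ} (hl : l ≠ 0) :
    IsGoodSpace (circLattice l hl) circBasis (spaceYMode l) := by
  intro f
  have h0 : circBasis.repr f 0 = 0 ↔ ∫ y : Circ, f y = 0 := by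
    rw [circBasis_repr]
    simp only [fourier_zero, star_one, mul_one]
    have : ((√(2 * Real.pi) : ℝ) : ℂ)⁻¹ ≠ 0 :=
      inv_ne_zero (Complex.ofReal_ne_zero.2 sqrt_two_pi_pos.ne')
    rw [mul_eq_zero, or_iff_right this]
  change (|l| = 1 → ∫ y : Circ, f y = 0) ↔ ∀ k : ℤ, (|l| = 1 ∧ k = 0) → circBasis.repr f k = 0
  rw [← h0]
  constructor
  · rintro h k ⟨h1, rfl⟩
    exact h h1
  · exact fun h h1 => h 0 ⟨h1, rfl⟩

/-! ### The operators on the torus in Fourier coefficients -/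

/-- The exponential `e^{i(l x + k y)}` for `p = (l, k)`. -/
def torusExp (p : ℤ × ℤ) : C(Torus, ℂ) :=
  (fourier p.1).comp ⟨Prod.fst, continuous_fst⟩ * (fourier p.2).comp ⟨Prod.snd, continuous_snd⟩

theorem torusExp_apply (p : ℤ × ℤ) (q : Torus) :
    torusExp p q = fourier p.1 q.1 * fourier p.2 q.2 := rfl

theorem star_torusExp (p : ℤ × ℤ) (q : Torus) : star (torusExp p q) = torusExp (-p) q := by
  rw [torusExp_apply, torusExp_apply, star_mul', star_fourier, star_fourier]
  rfl

theorem star_torusExp_map (p : ℤ × ℤ) : star (torusExp p) = torusExp (-p) :=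
  ContinuousMap.ext fun q => star_torusExp p q

theorem torusExp_mul (p q : ℤ × ℤ) : torusExp p * torusExp q = torusExp (p + q) :=
  ContinuousMap.ext fun s => by
    rw [ContinuousMap.mul_apply, torusExp_apply, torusExp_apply, torusExp_apply, Prod.fst_add,
      Prod.snd_add, fourier_add, fourier_add]
    ring

theorem integral_torusExp_mul_star (i j : ℤ × ℤ) :
    ∫ q : Torus, torusExp j q * star (torusExp i q) =
      if i = j then ((2 * Real.pi : ℝ) : ℂ) ^ 2 else 0 := by
  have h : ∀ q : Torus, torusExp j q * star (torusExp i q) =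
      ((fourier j.1 q.1 : ℂ) * star (fourier i.1 q.1 : ℂ)) *
        ((fourier j.2 q.2 : ℂ) * star (fourier i.2 q.2 : ℂ)) := fun q => by
    rw [torusExp_apply, torusExp_apply, star_mul']
    ring
  simp only [h]
  have h2 := integral_prod_mul (μ := (volume : Measure Circ)) (ν := (volume : Measure Circ))
    (fun x : Circ => (fourier j.1 x : ℂ) * star (fourier i.1 x : ℂ))
    (fun y : Circ => (fourier j.2 y : ℂ) * star (fourier i.2 y : ℂ))
  rw [Measure.volume_eq_prod, h2, integral_fourier_mul_star, integral_fourier_mul_star]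
  by_cases h1 : i.1 = j.1 <;> by_cases h2 : i.2 = j.2
  · rw [if_pos h1, if_pos h2, if_pos (Prod.ext h1 h2)]
    push_cast
    ring
  · rw [if_neg h2, if_neg (fun h => h2 (congrArg Prod.snd h)), mul_zero]
  · rw [if_neg h1, if_neg (fun h => h1 (congrArg Prod.fst h)), zero_mul]
  · rw [if_neg h1, if_neg (fun h => h1 (congrArg Prod.fst h)), zero_mul]

theorem eq_zero_of_torusExp (g : L2Torus)
    (hg : ∀ p, ∫ q : Torus, g q * star (torusExp p q) = 0) : g = 0 := by
  refine eq_zero_of_span (e := torusExp)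
    ⟨0, ContinuousMap.ext fun q => by simp [torusExp_apply]⟩
    (fun i j => ⟨i + j, torusExp_mul i j⟩) (fun i => ⟨-i, star_torusExp_map i⟩)
    (fun x y hxy => ?_) g fun p => ?_
  · by_cases h : x.1 = y.1
    · refine ⟨(0, 1), fun h' => hxy (Prod.ext h (fourier_one_injective ?_))⟩
      simpa only [torusExp_apply, fourier_zero, one_mul] using h'
    · refine ⟨(1, 0), fun h' => h (fourier_one_injective ?_)⟩
      simpa only [torusExp_apply, fourier_zero, mul_one] using h'
  · have := hg (-p)
    simpa only [star_torusExp, neg_neg] using this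

theorem exists_torusBasis : ∃ B : HilbertBasis (ℤ × ℤ) ℂ L2Torus,
    (∀ p, B p = ((2 * Real.pi : ℝ) : ℂ)⁻¹ • ContinuousMap.toLp 2 volume ℂ (torusExp p)) ∧
      ∀ (f : L2Torus) p, B.repr f p =
        ((2 * Real.pi : ℝ) : ℂ)⁻¹ * ∫ q : Torus, f q * star (torusExp p q) := by
  refine exists_hilbertBasis_of_orthogonal (LinearIsometry.id) torusExp _ (fun k => rfl)
    Real.two_pi_pos (fun k => ?_) (fun i j hij => ?_) (fun g hg => eq_zero_of_torusExp g hg)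
  · rw [integral_torusExp_mul_star, if_pos rfl]
  · rw [integral_torusExp_mul_star, if_neg hij]

/-- The Fourier basis of `L²(𝕋²)`. -/
def torusBasis : HilbertBasis (ℤ × ℤ) ℂ L2Torus := exists_torusBasis.choose

theorem torusBasis_repr (f : L2Torus) (p : ℤ × ℤ) : torusBasis.repr f p =
    ((2 * Real.pi : ℝ) : ℂ)⁻¹ * ∫ q : Torus, f q * star (torusExp p q) :=
  exists_torusBasis.choose_spec.2 f p

theorem testTorus_torusExp (p : ℤ × ℤ) : TestTorus (torusExp p) := by
  have h1 := ContDiff.comp (testCirc_fourier p.1) (contDiff_fst (𝕜 := ℝ) (E := ℝ) (F := ℝ))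
  have h2 := ContDiff.comp (testCirc_fourier p.2) (contDiff_snd (𝕜 := ℝ) (E := ℝ) (F := ℝ))
  exact ContDiff.mul h1 h2

theorem dX_torusExp (p : ℤ × ℤ) (q : Torus) :
    dX (torusExp p) q = Complex.I * p.1 * torusExp p q := by
  have h : dX (torusExp p) q = dCirc (fun x => fourier p.2 q.2 * fourier p.1 x) q.1 := by
    have : (fun x => (fourier p.2 q.2 * fourier p.1 x : ℂ)) = fun x => torusExp p (x, q.2) :=
      funext fun x => mul_comm _ _
    rw [this]
    rfl
  rw [h, dCirc_const_mul, dCirc_fourier, torusExp_apply]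
  ring

theorem dY_torusExp (p : ℤ × ℤ) (q : Torus) :
    dY (torusExp p) q = Complex.I * p.2 * torusExp p q := by
  have h : dY (torusExp p) q = dCirc (fun y => fourier p.1 q.1 * fourier p.2 y) q.2 := rfl
  rw [h, dCirc_const_mul, dCirc_fourier, torusExp_apply]
  ring

/-- By Fubini it suffices to integrate by parts on the circle for each fixed y, where the
y-exponential is a constant factor. -/
theorem integral_torusExp_mul_dX {φ : C(Torus, ℂ)} (hφ : TestTorus φ) (p : ℤ × ℤ) :
    ∫ q : Torus, torusExp p q * dX φ q = -(Complex.I * p.1) * ∫ q : Torus, torusExp p q * φ q := by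
  have hi : ∀ c : Torus → ℂ, Continuous c → Integrable (fun q : Torus => torusExp p q * c q) :=
    fun c hc => ((torusExp p).continuous.mul hc).integrable_of_hasCompactSupport
      (HasCompactSupport.of_compactSpace _)
  have h1 := integral_prod_symm _ (hi _ (continuous_dX hφ))
  have h2 := integral_prod_symm _ (hi _ φ.continuous)
  rw [← Measure.volume_eq_prod] at h1 h2
  rw [h1, h2, ← integral_const_mul]
  refine integral_congr_ae (ae_of_all _ fun y => ?_)
  let ψ : C(Circ, ℂ) := φ.comp ⟨fun x => (x, y), by fun_prop⟩
  have hψ : TestCirc ψ := by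
    obtain ⟨t, rfl⟩ := QuotientAddGroup.mk_surjective y
    have h4 := ContDiff.comp (f := fun s : ℝ => (s, t)) hφ (contDiff_id.prodMk contDiff_const)
    exact h4
  have h3 := integral_fourier_mul_dCirc hψ p.1
  have e1 : ∀ x : Circ, torusExp p (x, y) * dX φ (x, y) =
      fourier p.2 y * (fourier p.1 x * dCirc ψ x) := fun x => by
    have : dX φ (x, y) = dCirc ψ x := rfl
    rw [this, torusExp_apply]
    ring
  have e2 : ∀ x : Circ, torusExp p (x, y) * φ (x, y) =
      fourier p.2 y * (fourier p.1 x * ψ x) := fun x => by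
    have : φ (x, y) = ψ x := rfl
    rw [this, torusExp_apply]
    ring
  simp only [e1, e2]
  rw [integral_const_mul, integral_const_mul, h3]
  ring

theorem integral_torusExp_mul_dY {φ : C(Torus, ℂ)} (hφ : TestTorus φ) (p : ℤ × ℤ) :
    ∫ q : Torus, torusExp p q * dY φ q = -(Complex.I * p.2) * ∫ q : Torus, torusExp p q * φ q := by
  have hi : ∀ c : Torus → ℂ, Continuous c → Integrable (fun q : Torus => torusExp p q * c q) :=
    fun c hc => ((torusExp p).continuous.mul hc).integrable_of_hasCompactSupport
      (HasCompactSupport.of_compactSpace _)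
  have h1 := integral_prod _ (hi _ (continuous_dY hφ))
  have h2 := integral_prod _ (hi _ φ.continuous)
  rw [← Measure.volume_eq_prod] at h1 h2
  rw [h1, h2, ← integral_const_mul]
  refine integral_congr_ae (ae_of_all _ fun x => ?_)
  let ψ : C(Circ, ℂ) := φ.comp ⟨fun y => (x, y), by fun_prop⟩
  have hψ : TestCirc ψ := by
    obtain ⟨t, rfl⟩ := QuotientAddGroup.mk_surjective x
    have h4 := ContDiff.comp (f := fun s : ℝ => (t, s)) hφ (contDiff_const.prodMk contDiff_id)
    exact h4
  have h3 := integral_fourier_mul_dCirc hψ p.2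
  have e1 : ∀ y : Circ, torusExp p (x, y) * dY φ (x, y) =
      fourier p.1 x * (fourier p.2 y * dCirc ψ y) := fun y => by
    have : dY φ (x, y) = dCirc ψ y := rfl
    rw [this, torusExp_apply]
    ring
  have e2 : ∀ y : Circ, torusExp p (x, y) * φ (x, y) =
      fourier p.1 x * (fourier p.2 y * ψ y) := fun y => by
    have : φ (x, y) = ψ y := rfl
    rw [this, torusExp_apply]
    ring
  simp only [e1, e2]
  rw [integral_const_mul, integral_const_mul, h3]
  ring

theorem hasWeakDX_iff (f g : L2Torus) :
    HasWeakDX f g ↔ ∀ p, torusBasis.repr g p = Complex.I * p.1 * torusBasis.repr f p := by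
  refine weak_iff_repr (e := torusExp) Real.two_pi_pos torusBasis
    exists_torusBasis.choose_spec.1 torusBasis_repr (Test := TestTorus) (d := dX)
    (m := fun p : ℤ × ℤ => Complex.I * p.1) (fun p => ⟨?_, fun q => ?_⟩)
    (fun φ hφ => continuous_dX hφ) (fun φ hφ p => integral_torusExp_mul_dX hφ p) f g
  · rw [star_torusExp_map]; exact testTorus_torusExp _
  · rw [star_torusExp_map, dX_torusExp, star_torusExp]
    simp

theorem hasWeakDY_iff (f g : L2Torus) :
    HasWeakDY f g ↔ ∀ p, torusBasis.repr g p = Complex.I * p.2 * torusBasis.repr f p := by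
  refine weak_iff_repr (e := torusExp) Real.two_pi_pos torusBasis
    exists_torusBasis.choose_spec.1 torusBasis_repr (Test := TestTorus) (d := dY)
    (m := fun p : ℤ × ℤ => Complex.I * p.2) (fun p => ⟨?_, fun q => ?_⟩)
    (fun φ hφ => continuous_dY hφ) (fun φ hφ p => integral_torusExp_mul_dY hφ p) f g
  · rw [star_torusExp_map]; exact testTorus_torusExp _
  · rw [star_torusExp_map, dY_torusExp, star_torusExp]
    simp

theorem repr_eq_of_ae_sinMul {f g : L2Torus} (h : g =ᵐ[volume] sinMul f)
    (p : ℤ × ℤ) : torusBasis.repr g p =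
      (2 * Complex.I)⁻¹ * (torusBasis.repr f (p.1, p.2 - 1) - torusBasis.repr f (p.1, p.2 + 1)) := by
  have hi : ∀ n : ℤ × ℤ, Integrable fun q : Torus => f q * star (torusExp n q) := fun n =>
    integrable_mul_continuous (integrable_L2 f) (torusExp n).continuous.star
  have h1 : ∫ q : Torus, g q * star (torusExp p q) =
      (2 * Complex.I)⁻¹ * ((∫ q : Torus, f q * star (torusExp (p.1, p.2 - 1) q)) -
        ∫ q : Torus, f q * star (torusExp (p.1, p.2 + 1) q)) := by
    rw [← integral_sub (hi _) (hi _), ← integral_const_mul]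
    refine integral_congr_ae (h.mono fun q hq => ?_)
    simp only
    rw [hq, sinMul, torusExp_apply, torusExp_apply, torusExp_apply, star_mul', star_mul', star_mul']
    linear_combination f q * star (fourier p.1 q.1 : ℂ) * sinC_mul_star_fourier p.2 q.2
  rw [torusBasis_repr, torusBasis_repr, torusBasis_repr, h1]
  ring

theorem hasWeakDX_sinMul_iff (f g : L2Torus) : HasWeakDX (sinMul f) g ↔
    ∀ p, torusBasis.repr g p = Complex.I * p.1 * ((2 * Complex.I)⁻¹ *
      (torusBasis.repr f (p.1, p.2 - 1) - torusBasis.repr f (p.1, p.2 + 1))) := by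
  have hm := memLp_mul_continuous f
    (Complex.continuous_ofReal.comp (continuous_sinC.comp (continuous_snd (X := Circ) (Y := Circ))))
  have hq : hm.toLp =ᵐ[volume] sinMul f := hm.coeFn_toLp
  -- The product is a bare function; its L² class has the same integrals and does have Fourier
  -- coefficients.
  have h1 : HasWeakDX (sinMul f) g ↔ HasWeakDX hm.toLp g := by
    unfold HasWeakDX
    refine forall_congr' fun φ => forall_congr' fun _ => ?_
    rw [integral_congr_ae (hq.mono fun q hq => congrArg (fun t => t * dX φ q) hq)]
  rw [h1, hasWeakDX_iff]
  exact forall_congr' fun p => by rw [repr_eq_of_ae_sinMul hq]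

/-! ### Functions with zero mean in `x` -/

theorem repr_eq_zero_of_mem {f : L2Torus} (hf : f ∈ L2Zero) (k : ℤ) :
    torusBasis.repr f (0, k) = 0 := by
  have h1 := integral_prod_symm _
    (integrable_mul_continuous (integrable_L2 f) (torusExp (0, k)).continuous.star)
  rw [← Measure.volume_eq_prod] at h1
  have h2 : ∫ q : Torus, f q * star (torusExp (0, k) q) = 0 := by
    refine h1.trans (integral_eq_zero_of_ae ?_)
    have hf' : ∀ᵐ y : Circ, ∫ x : Circ, f (x, y) = 0 := hf
    filter_upwards [hf'] with y hy
    simp only [torusExp_apply, fourier_zero, one_mul]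
    rw [integral_mul_const, hy, zero_mul]
    rfl
  rw [torusBasis_repr, h2, mul_zero]

theorem toLp_torusExp_mem {p : ℤ × ℤ} (hp : p.1 ≠ 0) :
    ContinuousMap.toLp 2 volume ℂ (torusExp p) ∈ L2Zero := by
  change ∀ᵐ y : Circ, ∫ x : Circ, (ContinuousMap.toLp 2 volume ℂ (torusExp p) : L2Torus) (x, y) = 0
  filter_upwards [ae_slice (ContinuousMap.coeFn_toLp (p := 2) (𝕜 := ℂ) volume (torusExp p))]
    with y hy
  rw [integral_congr_ae hy]
  simp only [torusExp_apply]
  rw [integral_mul_const, integral_fourier, if_neg hp, zero_mul]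

/-- The modes `(l, k)` with `l ≠ 0`. -/
abbrev TorusMode : Type := {p : ℤ × ℤ // p.1 ≠ 0}

/-- The exponentials with `l ≠ 0` as elements of `L²₀(𝕋²)`. -/
def spaceExp (i : TorusMode) : SpaceX :=
  (⟨ContinuousMap.toLp 2 volume ℂ (torusExp i.1), toLp_torusExp_mem i.2⟩ : L2Zero)

/-- Elements of X have no coefficients with l = 0, so the exponentials with l ≠ 0 are already total
in X. -/
theorem exists_spaceBasis : ∃ B : HilbertBasis TorusMode ℂ SpaceX,
    (∀ i, B i = ((2 * Real.pi : ℝ) : ℂ)⁻¹ • spaceExp i) ∧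
      ∀ (f : SpaceX) (i : TorusMode), B.repr f i =
        ((2 * Real.pi : ℝ) : ℂ)⁻¹ * ∫ q : Torus, (f : L2Torus) q * star (torusExp i.1 q) := by
  refine exists_hilbertBasis_of_orthogonal SpaceX.incl (fun i : TorusMode => torusExp i.1) spaceExp
    (fun k => rfl) Real.two_pi_pos (fun k => ?_) (fun i j hij => ?_) (fun g hg => ?_)
  · rw [integral_torusExp_mul_star, if_pos rfl]
  · rw [integral_torusExp_mul_star, if_neg (fun h => hij (Subtype.ext h))]
  · have h0 : (g : L2Torus) = 0 := by
      refine repr_ext torusBasis fun p => ?_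
      rw [map_zero]
      change torusBasis.repr (g : L2Torus) p = 0
      by_cases hp : p.1 = 0
      · obtain ⟨l, k⟩ := p
        simp only at hp
        subst hp
        exact repr_eq_zero_of_mem (show L2Zero from g).2 k
      · rw [torusBasis_repr]
        have := hg ⟨p, hp⟩
        simp only at this
        rw [this, mul_zero]
    exact SpaceX.incl.injective (h0.trans (map_zero SpaceX.incl).symm)

/-- The Fourier basis of `L²₀(𝕋²)`. -/
def spaceBasis : HilbertBasis TorusMode ℂ SpaceX := exists_spaceBasis.choose

theorem spaceBasis_repr (f : SpaceX) (i : TorusMode) :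
    spaceBasis.repr f i = torusBasis.repr (f : L2Torus) i.1 := by
  rw [torusBasis_repr]
  exact exists_spaceBasis.choose_spec.2 f i

theorem torusBasis_repr_coe (f : SpaceX) {p : ℤ × ℤ} (hp : p.1 = 0) :
    torusBasis.repr (f : L2Torus) p = 0 := by
  obtain ⟨l, k⟩ := p
  simp only at hp
  subst hp
  exact repr_eq_zero_of_mem (show L2Zero from f).2 k

/-- The lattice of modes of `L²₀(𝕋²)`. -/
def torusLattice : ModeLattice TorusMode where
  l i := i.1.1
  k i := i.1.2
  shift :=
    { toFun := fun i => ⟨(i.1.1, i.1.2 + 1), i.2⟩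
      invFun := fun i => ⟨(i.1.1, i.1.2 - 1), i.2⟩
      left_inv := fun _ => Subtype.ext (Prod.ext rfl (add_sub_cancel_right _ _))
      right_inv := fun _ => Subtype.ext (Prod.ext rfl (sub_add_cancel _ _)) }
  l_shift _ := rfl
  k_shift _ := rfl
  l_ne i := i.2
  inj _ _ h1 h2 := Subtype.ext (Prod.ext h1 h2)

/-! ### The symbols of A, Λ̂ and L_α on L²₀(𝕋²). -/

theorem torusLattice_a (i : TorusMode) :
    (torusLattice.a i : ℂ) = (i.1.2 : ℂ) ^ 2 + (i.1.1 : ℂ) ^ 2 := by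
  unfold ModeLattice.a
  push_cast
  rfl

theorem mem_graph_opA_iff (f g : SpaceX) : (f, g) ∈ opA.graph ↔
    ∀ i, spaceBasis.repr g i = -(torusLattice.a i * spaceBasis.repr f i) := by
  rw [graph_opA]
  constructor
  · rintro ⟨fx, fy, fxx, fxy, fyy, h1, h2, h3, -, h5, h6⟩ i
    simp only at h1 h2 h6
    have hadd : torusBasis.repr (fxx + fyy) i.1 =
        torusBasis.repr fxx i.1 + torusBasis.repr fyy i.1 := by
      rw [map_add]; rfl
    rw [spaceBasis_repr, spaceBasis_repr, h6, hadd, (hasWeakDX_iff _ _).1 h3,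
      (hasWeakDX_iff _ _).1 h1, (hasWeakDY_iff _ _).1 h5, (hasWeakDY_iff _ _).1 h2, torusLattice_a]
    linear_combination ((i.1.1 : ℂ) ^ 2 + (i.1.2 : ℂ) ^ 2) *
      torusBasis.repr (f : L2Torus) i.1 * Complex.I_sq
  · intro h
    -- Weak derivatives are tested in all of L²(𝕋²), so the relation is extended to l = 0, where
    -- both sides vanish.
    have hfull : ∀ p : ℤ × ℤ, torusBasis.repr (g : L2Torus) p =
        -(((p.2 : ℂ) ^ 2 + (p.1 : ℂ) ^ 2) * torusBasis.repr (f : L2Torus) p) := by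
      intro p
      by_cases hp : p.1 = 0
      · rw [torusBasis_repr_coe f hp, torusBasis_repr_coe g hp]; simp
      · have := h ⟨p, hp⟩
        rwa [spaceBasis_repr, spaceBasis_repr, torusLattice_a] at this
    -- Each of the five derivatives, including the mixed one, has a symbol dominated by k² + l², so
    -- the Laplacian controls it.
    have hex : ∀ m : ℤ × ℤ → ℂ, (∀ p : ℤ × ℤ, ‖m p‖ ≤ (p.2 : ℝ) ^ 2 + (p.1 : ℝ) ^ 2) →
        ∃ u : L2Torus, ∀ p, torusBasis.repr u p = m p * torusBasis.repr (f : L2Torus) p := by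
      intro m hm
      refine ⟨torusBasis.repr.symm (SqSum.mk (fun p => m p * torusBasis.repr (f : L2Torus) p)
        (summable_sq_of_le (SqSum.summable (torusBasis.repr (g : L2Torus))) fun p => ?_)),
        fun p => by rw [LinearIsometryEquiv.apply_symm_apply, SqSum.mk_apply]⟩
      rw [hfull, norm_neg, norm_mul, norm_mul]
      refine mul_le_mul_of_nonneg_right ((hm p).trans ?_) (norm_nonneg _)
      have : ((p.2 : ℂ) ^ 2 + (p.1 : ℂ) ^ 2) = (((p.2 : ℝ) ^ 2 + (p.1 : ℝ) ^ 2 : ℝ) : ℂ) := by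
        push_cast; rfl
      rw [this, Complex.norm_real]
      exact Real.le_norm_self _
    obtain ⟨fx, hx⟩ := hex (fun p => Complex.I * p.1) fun p => by
      rw [norm_mul, Complex.norm_I, one_mul, Complex.norm_intCast]
      nlinarith [abs_intCast_le_sq p.1, sq_nonneg (p.2 : ℝ)]
    obtain ⟨fy, hy⟩ := hex (fun p => Complex.I * p.2) fun p => by
      rw [norm_mul, Complex.norm_I, one_mul, Complex.norm_intCast]
      nlinarith [abs_intCast_le_sq p.2, sq_nonneg (p.1 : ℝ)]
    obtain ⟨fxx, hxx⟩ := hex (fun p => -(p.1 : ℂ) ^ 2) fun p => by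
      rw [norm_neg, norm_pow, Complex.norm_intCast, sq_abs]
      nlinarith [sq_nonneg (p.2 : ℝ)]
    obtain ⟨fxy, hxy⟩ := hex (fun p => -((p.1 : ℂ) * p.2)) fun p => by
      rw [norm_neg, norm_mul, Complex.norm_intCast, Complex.norm_intCast]
      nlinarith [sq_nonneg (|(p.1 : ℝ)| - |(p.2 : ℝ)|), sq_abs (p.1 : ℝ), sq_abs (p.2 : ℝ)]
    obtain ⟨fyy, hyy⟩ := hex (fun p => -(p.2 : ℂ) ^ 2) fun p => by
      rw [norm_neg, norm_pow, Complex.norm_intCast, sq_abs]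
      nlinarith [sq_nonneg (p.1 : ℝ)]
    refine ⟨fx, fy, fxx, fxy, fyy, (hasWeakDX_iff _ _).2 hx, (hasWeakDY_iff _ _).2 hy,
      (hasWeakDX_iff _ _).2 fun p => ?_, (hasWeakDY_iff _ _).2 fun p => ?_,
      (hasWeakDY_iff _ _).2 fun p => ?_, repr_ext torusBasis fun p => ?_⟩
    · rw [hxx, hx]
      linear_combination -(p.1 : ℂ) ^ 2 * torusBasis.repr (f : L2Torus) p * Complex.I_sq
    · rw [hxy, hx]
      linear_combination -(p.1 : ℂ) * p.2 * torusBasis.repr (f : L2Torus) p * Complex.I_sq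
    · rw [hyy, hy]
      linear_combination -(p.2 : ℂ) ^ 2 * torusBasis.repr (f : L2Torus) p * Complex.I_sq
    · have hadd : torusBasis.repr (fxx + fyy) p =
        torusBasis.repr fxx p + torusBasis.repr fyy p := by
        rw [map_add]; rfl
      rw [hadd, hxx, hyy, hfull]
      ring

theorem hasWeakDX_sinMul_coe_iff (f g : SpaceX) :
    HasWeakDX (sinMul (f : L2Torus)) (g : L2Torus) ↔
    ∀ i : TorusMode, spaceBasis.repr g i = Complex.I * i.1.1 * ((2 * Complex.I)⁻¹ *
      (spaceBasis.repr f (torusLattice.shift.symm i) - spaceBasis.repr f (torusLattice.shift i))) := by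
  rw [hasWeakDX_sinMul_iff]
  constructor
  · intro h i
    rw [spaceBasis_repr, spaceBasis_repr, spaceBasis_repr]
    exact h i.1
  · intro h p
    by_cases hp : p.1 = 0
    · rw [torusBasis_repr_coe g hp, hp]
      simp
    · have := h ⟨p, hp⟩
      rwa [spaceBasis_repr, spaceBasis_repr, spaceBasis_repr] at this

theorem repr_add_of_mem_graph_opA {f ψ : SpaceX} (hψ : (ψ, f) ∈ opA.graph) (i : TorusMode) :
    spaceBasis.repr (f + ψ) i = torusLattice.b i * spaceBasis.repr f i := by
  have h1 := (mem_graph_opA_iff ψ f).1 hψ i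
  have h2 : spaceBasis.repr (f + ψ) i = spaceBasis.repr f i + spaceBasis.repr ψ i := by
    rw [map_add]; rfl
  have h3 := torusLattice.a_ne_zero i
  have hb : (torusLattice.b i : ℂ) = 1 - (torusLattice.a i : ℂ)⁻¹ := by
    unfold ModeLattice.b
    push_cast
    rfl
  rw [h2, hb, h1]
  field_simp
  ring

theorem graph_opΛ : opΛ.graph = graphΛ := by
  refine Submodule.toLinearPMap_graph_eq _ ?_
  rintro ⟨x, y⟩ ⟨-, ψ, g, hψ, hg, hy⟩ hx
  simp only at hx hψ hy hg
  subst hx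
  have hg0 : g = 0 := repr_ext spaceBasis fun i => by
    rw [(hasWeakDX_sinMul_coe_iff _ _).1 hg, repr_add_of_mem_graph_opA hψ,
      repr_add_of_mem_graph_opA hψ, map_zero]
    simp
  rw [hy, hg0, smul_zero]

theorem repr_of_mem_graphΛ {f g : SpaceX} (h : (f, g) ∈ opΛ.graph) (i : TorusMode) :
    spaceBasis.repr g i = -Complex.I * torusLattice.conv (spaceBasis.repr f) i := by
  rw [graph_opΛ] at h
  obtain ⟨-, ψ, u, hψ, hu, hg⟩ := h
  simp only at hψ hu hg
  rw [hg, repr_smul_apply, (hasWeakDX_sinMul_coe_iff _ _).1 hu, repr_add_of_mem_graph_opA hψ,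
    repr_add_of_mem_graph_opA hψ]
  have := Complex.I_ne_zero
  change _ = -Complex.I * ((i.1.1 : ℂ) / 2 * _)
  field_simp

theorem exists_repr {f : TorusMode → ℂ} (hf : Summable fun i => ‖f i‖ ^ 2) :
    ∃ u : SpaceX, ∀ i, spaceBasis.repr u i = f i :=
  ⟨spaceBasis.repr.symm (SqSum.mk f hf), fun i => by
    rw [LinearIsometryEquiv.apply_symm_apply, SqSum.mk_apply]⟩

/-- The inclusion D(A) ⊂ D(Λ̂), which makes the domain of L_α equal to D(A). -/
theorem exists_mem_graph_opΛ {f : SpaceX}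
    (hf : Summable fun i => ‖(torusLattice.a i : ℂ) * spaceBasis.repr f i‖ ^ 2) :
    ∃ g, (f, g) ∈ opΛ.graph := by
  rw [graph_opΛ]
  let v : SqSum TorusMode := SqSum.mk _ (torusLattice.summable_sqrt_a_mul hf)
  have hv : ∀ i, v i = √(torusLattice.a i) * spaceBasis.repr f i := fun i => rfl
  obtain ⟨ψ, hψ⟩ := exists_repr (f := fun i => -(torusLattice.a i : ℂ)⁻¹ * spaceBasis.repr f i) (by
    refine summable_sq_of_le (SqSum.summable (spaceBasis.repr f)) fun i => ?_
    rw [norm_mul, norm_neg, norm_inv, ModeLattice.norm_a]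
    exact mul_le_of_le_one_left (norm_nonneg _) (inv_le_one_of_one_le₀ (ModeLattice.one_le_a _ i)))
  have hψA : (ψ, f) ∈ opA.graph := (mem_graph_opA_iff _ _).2 fun i => by
    have h3 := torusLattice.a_ne_zero i
    rw [hψ]
    field_simp
  obtain ⟨g, hg⟩ := exists_repr (f := fun i => torusLattice.conv (spaceBasis.repr f) i)
    (torusLattice.summable_conv hv)
  -- The domain condition concerns sin y · f without the factor b; it follows from |l| a^{-1/2} ≤ 1
  -- applied to v = √a f.
  have hbd : ∀ i j : TorusMode, torusLattice.l j = torusLattice.l i →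
      ‖Complex.I * i.1.1 * (2 * Complex.I)⁻¹ * (torusLattice.n j : ℂ)‖ ≤ 1 := by
    intro i j hl
    have h1 := torusLattice.abs_l_mul_n_le j
    rw [hl] at h1
    change |(i.1.1 : ℝ)| * _ ≤ 1 at h1
    rw [norm_mul, norm_mul, norm_mul, norm_inv, norm_mul, Complex.norm_I, Complex.norm_intCast,
      Complex.norm_ofNat, Complex.norm_real, Real.norm_of_nonneg (torusLattice.n_pos j).le]
    nlinarith [mul_nonneg (abs_nonneg (i.1.1 : ℝ)) (torusLattice.n_pos j).le]
  have hnv : ∀ i, (torusLattice.n i : ℂ) * v i = spaceBasis.repr f i := fun i => by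
    rw [hv, ← mul_assoc, ← Complex.ofReal_mul, torusLattice.n_mul_sqrt, Complex.ofReal_one, one_mul]
  obtain ⟨k, hk⟩ := exists_repr (summable_sq_sub
    (summable_weightedShift (fun i => hbd i _ (torusLattice.l_shift_symm i))
      torusLattice.shift.symm v)
    (summable_weightedShift (fun i => hbd i _ (torusLattice.l_shift i)) torusLattice.shift v))
  refine ⟨(-Complex.I) • g, ⟨k, (hasWeakDX_sinMul_coe_iff _ _).2 fun i => ?_⟩, ψ, g, hψA,
    (hasWeakDX_sinMul_coe_iff _ _).2 fun i => ?_, rfl⟩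
  · rw [hk, ← hnv, ← hnv]
    ring
  · rw [hg, repr_add_of_mem_graph_opA hψA, repr_add_of_mem_graph_opA hψA]
    have := Complex.I_ne_zero
    change (i.1.1 : ℂ) / 2 * _ = _
    field_simp

theorem represents_opL (α : ℝ) : Represents torusLattice spaceBasis α (opL α) := by
  intro f g
  unfold opL
  rw [mem_graph_sub_smul_iff]
  have hI : ∀ z : ℂ, Complex.I * α * (-Complex.I * z) = α * z := fun z => by
    linear_combination -α * z * Complex.I_sq
  constructor
  · rintro ⟨g₁, g₂, h1, h2, rfl⟩
    rw [mem_graph_opA_iff] at h1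
    refine ⟨(SqSum.summable (spaceBasis.repr g₁)).congr fun i => by rw [h1, norm_neg], fun i => ?_⟩
    rw [repr_sub_apply, repr_smul_apply, h1, repr_of_mem_graphΛ h2, hI]
  · rintro ⟨hs, hg⟩
    obtain ⟨g₁, h1⟩ := exists_repr hs
    obtain ⟨g₂, h2⟩ := exists_mem_graph_opΛ hs
    have hneg : ∀ i, spaceBasis.repr (-g₁) i = -spaceBasis.repr g₁ i := fun i => by
      rw [map_neg]; rfl
    refine ⟨-g₁, g₂, (mem_graph_opA_iff _ _).2 fun i => ?_, h2, repr_ext spaceBasis fun i => ?_⟩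
    · rw [hneg, h1]
    · rw [repr_sub_apply, repr_smul_apply, hneg, h1, repr_of_mem_graphΛ h2, hI, hg]

/-- Integrating the l-th x-mode over y leaves a multiple of the coefficient at (l, 0), and for |l| =
1 these are exactly the bad modes. -/
theorem isGoodSpace_spaceY : IsGoodSpace torusLattice spaceBasis spaceY := by
  intro f
  have h0 : ∀ l : ℤ, (∀ x : Circ, ∫ y : Circ, modeProj l (f : L2Torus) (x, y) = 0) ↔
      torusBasis.repr (f : L2Torus) (l, 0) = 0 := by
    intro l
    rw [integral_modeProj_eq_zero_iff, torusBasis_repr]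
    have h1 : ((2 * Real.pi : ℝ) : ℂ)⁻¹ ≠ 0 :=
      inv_ne_zero (Complex.ofReal_ne_zero.2 Real.two_pi_pos.ne')
    rw [mul_eq_zero, or_iff_right h1]
    simp only [torusExp_apply, fourier_zero, mul_one, star_fourier]
  change (∀ l : ℤ, |l| = 1 → ∀ x : Circ, ∫ y : Circ, modeProj l (f : L2Torus) (x, y) = 0) ↔ _
  constructor
  · rintro h ⟨⟨l, k⟩, hl⟩ ⟨h1, h2⟩
    change |l| = 1 at h1
    change k = 0 at h2
    subst h2
    rw [spaceBasis_repr]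
    exact (h0 l).1 (h l h1)
  · intro h l hl
    have hne : l ≠ 0 := by rintro rfl; simp at hl
    have := h ⟨(l, 0), hne⟩ ⟨hl, rfl⟩
    rw [spaceBasis_repr] at this
    exact (h0 l).2 this

end Kolmogorov

end

open Kolmogorov in
/-- For large `|α|` the imaginary axis lies in the resolvent sets of `Q L_α` (in `Y`) and of `L_α`
(in `X = L²₀(𝕋²)`), and the suprema over the axis of `‖(iλ - Q L_α)⁻¹‖` and `‖Q (iλ - L_α)⁻¹‖`
tend to `0` as `|α| → ∞`; likewise for `L_{α,l}` in `L²(𝕋)`, for every `l ≠ 0`. -/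
theorem mainTheorem8 :
    ((∀ᶠ α : ℝ in comap (fun α : ℝ => |α|) atTop, ∀ lam : ℝ,
        Complex.I * (lam : ℂ) ∈ opResolventSet (compression spaceY (opL α)) ∧
        Complex.I * (lam : ℂ) ∈ opResolventSet (opL α)) ∧
      Tendsto (fun α : ℝ => ⨆ lam : ℝ,
          ‖opResolvent (compression spaceY (opL α)) (Complex.I * (lam : ℂ))‖ₑ)
        (comap (fun α : ℝ => |α|) atTop) (𝓝 0) ∧
      Tendsto (fun α : ℝ => ⨆ lam : ℝ,
          ‖spaceY.starProjection ∘L opResolvent (opL α) (Complex.I * (lam : ℂ))‖ₑ)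
        (comap (fun α : ℝ => |α|) atTop) (𝓝 0)) ∧
    ∀ l : ℤ, l ≠ 0 →
      ((∀ᶠ α : ℝ in comap (fun α : ℝ => |α|) atTop, ∀ lam : ℝ,
          Complex.I * (lam : ℂ) ∈ opResolventSet (compression (spaceYMode l) (opLMode α l)) ∧
          Complex.I * (lam : ℂ) ∈ opResolventSet (opLMode α l)) ∧
        Tendsto (fun α : ℝ => ⨆ lam : ℝ,
            ‖opResolvent (compression (spaceYMode l) (opLMode α l)) (Complex.I * (lam : ℂ))‖ₑ)
          (comap (fun α : ℝ => |α|) atTop) (𝓝 0) ∧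
        Tendsto (fun α : ℝ => ⨆ lam : ℝ,
            ‖(spaceYMode l).starProjection ∘L opResolvent (opLMode α l) (Complex.I * (lam : ℂ))‖ₑ)
          (comap (fun α : ℝ => |α|) atTop) (𝓝 0)) := by
  exact ⟨resolvent_bounds represents_opL isGoodSpace_spaceY, fun l hl =>
    resolvent_bounds (represents_opLMode hl) (isGoodSpace_spaceYMode hl)⟩
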